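/- Theorem 1.4. Let $n,k\in\mathbb N=\{1,2,\dots\}$, $p,q\in[1,\infty)$, and let $\omega\in A_p$ on $\mathbb R^n$, that is, $\omega$ is nonnegative, locally integrable, and $[\omega]_{A_p}<\infty$, where $$[\omega]_{A_p}:=\sup_Q\Big[\frac1{|Q|}\int_Q\omega\,dx\Big]\Big[\frac1{|Q|}\int_Q\omega^{-\frac1{p-1}}\,dx\Big]^{p-1}\ (p>1),\qquad [\omega]_{A_1}:=\sup_Q\Big[\frac1{|Q|}\int_Q\omega\,dx\Big]\big\|\omega^{-1}\big\|_{L^\infty(Q)};$$ all cubes $Q\subset\mathbb R^n$ are open and bounded, with edges of length $\ell(Q)>0$ parallel to the coordinate axes. Put $p_\omega:=\inf\{r\in[1,\infty):\omega\in A_r\}$ and assume $n\big(\frac{p_\omega}{p}-\frac1q\big)<k$. Let $\gamma_{p,q}:=1$ if $p=1$ and $\gamma_{p,q}:=\frac1q$ if $p>1$. For a cube $Q$, let $\dot W^{k,p}_\omega(Q)$ be the set of all $f\in L^1_{\rm loc}(Q)$ whose weak derivatives $\partial^\alpha f$, $|\alpha|=k$, exist on $Q$ and satisfy $\int_Q|\partial^\alpha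 f|^p\omega\,dx<\infty$, and let $|\nabla^kf|:=(\sum_{|\alpha|=k}|\partial^\alpha f|^2)^{1/2}$. Let also $\Delta_h^kf(x):=\sum_{j=0}^k(-1)^{k-j}\binom kj f(x+jh)$ and $Q(x,k):=\{h\in\mathbb R^n: x+ih\in Q\text{ for all }i\in\{1,\dots,k\}\}$. Then there exists a constant $C\in(0,\infty)$ such that, for every $s\in(0,1)$, every cube $Q$ and every $f\in\dot W^{k,p}_\omega(Q)$, $$(1-s)^{\gamma_{p,q}}\left\{\int_Q\left[\int_{Q(x,k)}\frac{|\Delta_h^kf(x)|^q}{|h|^{n+skq}}\,dh\right]^{\frac pq}\omega(x)\,dx\right\}^{\frac1p}\le C\,[\ell(Q)]^{(1-s)k}\left[\int_Q|\nabla^kf(x)|^p\,\omega(x)\,dx\right]^{\frac1p}.$$ -/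

import Mathlib

open MeasureTheory Set
open scoped ENNReal ContDiff

noncomputable section

namespace GagliardoCube

/-- The Euclidean space `ℝⁿ`. -/
abbrev Rn (n : ℕ) : Type := EuclideanSpace ℝ (Fin n)

/-- The open cube with edges parallel to the axes, lower corner `a` and edge length `l`. -/
def cube {n : ℕ} (a : Rn n) (l : ℝ) : Set (Rn n) :=
  {x | ∀ i, a i < x i ∧ x i < a i + l}

/-! ### Muckenhoupt weights -/

/-- The `A_p` constant of a nonnegative function `w`, as an extended nonnegative real
(so `0⁻¹ = ∞`). The suprema run over all cubes. -/
def apConst {n : ℕ} (p : ℝ) (w : Rn n → ℝ) : ℝ≥0∞ :=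
  if p = 1 then
    ⨆ (a : Rn n) (l : ℝ) (_ : 0 < l),
      ((∫⁻ x in cube a l, ENNReal.ofReal (w x)) / volume (cube a l)) *
        essSup (fun x => (ENNReal.ofReal (w x))⁻¹) (volume.restrict (cube a l))
  else
    ⨆ (a : Rn n) (l : ℝ) (_ : 0 < l),
      ((∫⁻ x in cube a l, ENNReal.ofReal (w x)) / volume (cube a l)) *
        ((∫⁻ x in cube a l, (ENNReal.ofReal (w x)) ^ (-(1 / (p - 1)))) /
          volume (cube a l)) ^ (p - 1)

/-- `w` is an `A_p`-weight (used for `1 ≤ p < ⊤`). -/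
structure IsApWeight {n : ℕ} (p : ℝ) (w : Rn n → ℝ) : Prop where
  nonneg : ∀ x, 0 ≤ w x
  locallyIntegrable : LocallyIntegrable w volume
  apConst_lt_top : apConst p w < ⊤

/-- The critical index `p_w = inf {r ∈ [1, ∞) : w ∈ A_r}`. -/
def criticalIndex {n : ℕ} (w : Rn n → ℝ) : ℝ :=
  sInf {r : ℝ | 1 ≤ r ∧ IsApWeight r w}

/-! ### Weighted Lebesgue spaces -/

/-- `(∫_Ω F(x)^p w(x) dx)^{1/p}` for `F` with values in `[0, ∞]`. -/
def wNorm {n : ℕ} (p : ℝ) (w : Rn n → ℝ) (Ω : Set (Rn n)) (F : Rn n → ℝ≥0∞) : ℝ≥0∞ :=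
  (∫⁻ x in Ω, F x ^ p * ENNReal.ofReal (w x)) ^ (1 / p)

/-- `g ∈ L^p_w(Ω)`. -/
def MemWLp {n : ℕ} {𝕜 : Type*} [RCLike 𝕜] (p : ℝ) (w : Rn n → ℝ) (Ω : Set (Rn n))
    (g : Rn n → 𝕜) : Prop :=
  AEStronglyMeasurable g (volume.restrict Ω) ∧ wNorm p w Ω (fun x => ‖g x‖ₑ) < ⊤

/-! ### Weak derivatives and homogeneous weighted Sobolev spaces -/

/-- The classical partial derivative in the `i`-th coordinate direction. -/
def partialDeriv {n : ℕ} (i : Fin n) (φ : Rn n → ℝ) : Rn n → ℝ :=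
  fun x => lineDeriv ℝ φ x (EuclideanSpace.single i 1)

/-- The classical derivative `∂^α φ` for a multi-index `α` (used for smooth `φ`). -/
def multiDeriv {n : ℕ} (α : Fin n → ℕ) (φ : Rn n → ℝ) : Rn n → ℝ :=
  (List.finRange n).foldr (fun i ψ => (partialDeriv i)^[α i] ψ) φ

/-- `g` is an `α`-th weak partial derivative of `f` on the open set `Ω`. -/
structure HasWeakDeriv {n : ℕ} {𝕜 : Type*} [RCLike 𝕜] (Ω : Set (Rn n)) (α : Fin n → ℕ)
    (f g : Rn n → 𝕜) : Prop where
  locallyIntegrableOn_left : LocallyIntegrableOn f Ω volume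
  locallyIntegrableOn_right : LocallyIntegrableOn g Ω volume
  integral_eq : ∀ φ : Rn n → ℝ, ContDiff ℝ ∞ φ → HasCompactSupport φ → tsupport φ ⊆ Ω →
    ∫ x in Ω, multiDeriv α φ x • f x = (-1 : ℝ) ^ (∑ i, α i) • ∫ x in Ω, φ x • g x

open Classical in
/-- The `α`-th weak partial derivative of `f` on `Ω`, unique up to null subsets of `Ω`
(and `0` if there is none). -/
def weakDeriv {n : ℕ} {𝕜 : Type*} [RCLike 𝕜] (Ω : Set (Rn n)) (α : Fin n → ℕ)
    (f : Rn n → 𝕜) : Rn n → 𝕜 :=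
  if h : ∃ g, HasWeakDeriv Ω α f g then h.choose else 0

/-- `f` belongs to the homogeneous weighted Sobolev space of order `k` and exponent `p`
on the open set `Ω`. -/
structure MemHomSobolev {n : ℕ} {𝕜 : Type*} [RCLike 𝕜] (k : ℕ) (p : ℝ) (w : Rn n → ℝ)
    (Ω : Set (Rn n)) (f : Rn n → 𝕜) : Prop where
  locallyIntegrableOn : LocallyIntegrableOn f Ω volume
  exists_weakDeriv : ∀ α : Fin n → ℕ, ∑ i, α i = k → ∃ g, HasWeakDeriv Ω α f g
  memWLp_weakDeriv : ∀ α : Fin n → ℕ, ∑ i, α i = k → MemWLp p w Ω (weakDeriv Ω α f)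

/-- `|∇^k f|(x) = (∑_{|α| = k} |∂^α f(x)|²)^{1/2}`, with weak derivatives on `Ω`. -/
def gradNorm {n : ℕ} {𝕜 : Type*} [RCLike 𝕜] (k : ℕ) (Ω : Set (Rn n))
    (f : Rn n → 𝕜) (x : Rn n) : ℝ :=
  Real.sqrt (∑ α ∈ Finset.piAntidiag (Finset.univ : Finset (Fin n)) k, ‖weakDeriv Ω α f x‖ ^ 2)

/-! ### Differences -/

/-- The `k`-th order difference `Δ_h^k f(x)`. -/
def diff {n : ℕ} {𝕜 : Type*} [RCLike 𝕜] (k : ℕ) (h : Rn n) (f : Rn n → 𝕜) (x : Rn n) : 𝕜 :=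
  ∑ j ∈ Finset.range (k + 1), (-1 : 𝕜) ^ (k - j) * (k.choose j : 𝕜) * f (x + (j : ℝ) • h)

/-- `Ω(x, k) = {h : x + i h ∈ Ω for i = 1, …, k}`. -/
def admissible {n : ℕ} (Ω : Set (Rn n)) (x : Rn n) (k : ℕ) : Set (Rn n) :=
  {h | ∀ i ∈ Finset.Icc 1 k, x + (i : ℝ) • h ∈ Ω}

/-- `(∫_{Ω(x,k)} |Δ_h^k f(x)|^q / |h|^{n + s k q} dh)^{1/q}`, with values in `[0, ∞]`. -/
def gagliardo {n : ℕ} {𝕜 : Type*} [RCLike 𝕜] (k : ℕ) (q s : ℝ) (Ω : Set (Rn n))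
    (f : Rn n → 𝕜) (x : Rn n) : ℝ≥0∞ :=
  (∫⁻ h in admissible Ω x k,
    ‖diff k h f x‖ₑ ^ q / ‖h‖ₑ ^ ((n : ℝ) + s * (k : ℝ) * q)) ^ (1 / q)

/-- The exponent `γ_{p,q}`: `1` if `p = 1`, and `1/q` if `p > 1`. -/
def gammaExp (p q : ℝ) : ℝ := if p = 1 then 1 else 1 / q

end GagliardoCube

end

/-!
For `x` in a cube `Q`, the inner integral of `|Δ_h^k f(x)|^q / |h|^(n + s k q)` is split into the
dyadic annuli `k |h| ≈ r` with `r = 2^(-m) n ℓ(Q)`. Each annulus contributes about `r^((1 - s) k q)`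
times a quantity of size `|∇^k f|^q` near `x`, so that everything rests on a bound for differences
at one scale which is uniform in that scale; the powers of `1 - s` come from the geometric series
`∑ 2^(-m (1 - s) k q) ≲ (1 - s)⁻¹`.

*One scale.* Differences of order `k` annihilate polynomials of degree less than `k`. For a smooth
function the Taylor polynomial with centre `z` may therefore be subtracted, and averaging the
remainder over all `z` in a subcube which contains `x, x + h, …, x + k h` gives
`|Δ_h^k f(x)| ≲ r^k ∑_j P_r g(x + j h)`, where `g` dominates the derivatives of order `k` and `P_r`
is a truncated Riesz potential (`potential`, `IsJet.enorm_diff_le_potential`). Mollification carries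
this over to weak derivatives, off a null set (`exists_null_enorm_diff_le`). Writing the potential
as a superposition of averages over balls of radius `τ r`, `0 < τ < 1`, makes both the
commutation with mollifiers and the mapping properties below elementary.

*Integration in `h`.* If `u ≤ q` and `n (1/u - 1/q) < k`, the potential satisfies a subcritical
Sobolev inequality, so that its `L^q` mean over a ball is bounded by the `L^u` mean of `g` over the
doubled ball (`setLIntegral_potential_rpow_le`). Together with the splitting into annuli this gives
the pointwise bound `gagliardo_rpow_le`.

*Integration in `x`, `p > 1`.* By the hypothesis on the critical index there is `r ≤ p` with
`w ∈ A_r` such that `u = p / r` is admissible (`IsApWeight.exists_exponent`). No self-improvement of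
Muckenhoupt weights is needed: if the critical index is too close to `p`, then `r = p` will do. All
scales are bounded by one maximal function of `g^u`, and Muckenhoupt's theorem in `L^r(w)` finishes
the proof with the factor `(1 - s)^(-1/q)`. Muckenhoupt's theorem is deduced from the boundedness of
maximal functions with respect to doubling measures, via the pointwise domination of the maximal
function by the composition of the maximal functions of `w` and of its dual weight
(`BallAp.maxFun_rpow_le`, `BallAp.exists_lintegral_maxFun_le`).

*Integration in `x`, `p = 1`.* The maximal operator is not bounded on `L^1(w)`. Instead the `q`-th
root is taken inside the sum over the scales, and each scale is integrated separately: averages over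
balls of a fixed radius are bounded on `L^1(w)` for `w ∈ A_1`. This costs the full factor
`(1 - s)⁻¹` (`exists_lintegral_le_of_eq_one`).
-/

namespace GagliardoCube

/-! ### The layer cake formula and maximal functions -/

section MaximalFunction

/-- Layer cake formula for a single value in `[0, ∞]`. -/
theorem rpow_eq_lintegral_indicator {p : ℝ} (hp : 0 < p) (a : ℝ≥0∞) :
    a ^ p = ENNReal.ofReal p *
      ∫⁻ t in Ioi (0 : ℝ), {t : ℝ | ENNReal.ofReal t < a}.indicator
        (fun t => ENNReal.ofReal (t ^ (p - 1))) t := by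
  have hint : ∀ b : ℝ, 0 ≤ b → ENNReal.ofReal p * ∫⁻ t in Ioc 0 b, ENNReal.ofReal (t ^ (p - 1)) =
      ENNReal.ofReal (b ^ p) := by
    intro b hb
    rw [← ofReal_integral_eq_lintegral_ofReal]
    · rw [← intervalIntegral.integral_of_le hb, integral_rpow (Or.inl (by linarith)),
        ← ENNReal.ofReal_mul hp.le]
      congr 1
      rw [sub_add_cancel, Real.zero_rpow hp.ne', sub_zero]
      field_simp
    · exact (intervalIntegral.intervalIntegrable_rpow' (by linarith)).1
    · filter_upwards [self_mem_ae_restrict measurableSet_Ioc] with t ht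
      exact Real.rpow_nonneg ht.1.le _
  have hmeas : MeasurableSet {t : ℝ | ENNReal.ofReal t < a} :=
    measurableSet_lt (by fun_prop) measurable_const
  rw [lintegral_indicator hmeas, Measure.restrict_restrict hmeas]
  rcases eq_or_ne a ⊤ with rfl | ha
  · rw [ENNReal.top_rpow_of_pos hp]
    symm
    refine ENNReal.eq_top_of_forall_nnreal_le fun r => ?_
    have h := hint ((r : ℝ) ^ (1 / p)) (by positivity)
    rw [← Real.rpow_mul r.coe_nonneg, one_div_mul_cancel hp.ne', Real.rpow_one,
      ENNReal.ofReal_coe_nnreal] at h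
    rw [← h]
    gcongr
    intro t ht
    exact ⟨by simp, ht.1⟩
  · lift a to NNReal using ha
    have hE : (volume.restrict ({t : ℝ | ENNReal.ofReal t < a} ∩ Ioi 0)) =
        volume.restrict (Ioc 0 (a : ℝ)) := by
      rw [← Measure.restrict_congr_set Ioo_ae_eq_Ioc]
      congr 1
      ext t
      rw [mem_inter_iff, and_comm]
      refine and_congr_right fun ht => ?_
      change ENNReal.ofReal t < a ↔ _
      replace ht : 0 < t := ht
      rw [← ENNReal.ofReal_coe_nnreal, ENNReal.ofReal_lt_ofReal_iff_of_nonneg ht.le]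
    rw [hE, hint (a : ℝ) a.coe_nonneg, ← ENNReal.ofReal_rpow_of_nonneg a.coe_nonneg hp.le,
      ENNReal.ofReal_coe_nnreal]

variable {X : Type*} [MeasurableSpace X]

/-- Layer cake formula for the measure with density `h`. -/
theorem lintegral_rpow_eq_lintegral_meas_ofReal_lt {μ : Measure X} [SFinite μ] {p : ℝ}
    (hp : 0 < p) {f h : X → ℝ≥0∞} (hf : Measurable f) (hh : Measurable h) :
    ∫⁻ x, h x * f x ^ p ∂μ = ENNReal.ofReal p *
      ∫⁻ t in Ioi (0 : ℝ), ENNReal.ofReal (t ^ (p - 1)) *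
        ∫⁻ x in {x | ENNReal.ofReal t < f x}, h x ∂μ := by
  have hS : MeasurableSet {z : X × ℝ | ENNReal.ofReal z.2 < f z.1} :=
    measurableSet_lt (by fun_prop) (by fun_prop)
  have hm : Measurable (fun z : X × ℝ => h z.1 *
      {z : X × ℝ | ENNReal.ofReal z.2 < f z.1}.indicator
        (fun z => ENNReal.ofReal (z.2 ^ (p - 1))) z) :=
    (hh.comp measurable_fst).mul (Measurable.indicator (by fun_prop) hS)
  calc ∫⁻ x, h x * f x ^ p ∂μ
      = ∫⁻ x, (ENNReal.ofReal p * ∫⁻ t in Ioi (0 : ℝ), h x *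
        {z : X × ℝ | ENNReal.ofReal z.2 < f z.1}.indicator
          (fun z => ENNReal.ofReal (z.2 ^ (p - 1))) (x, t)) ∂μ := by
        refine lintegral_congr fun x => ?_
        rw [rpow_eq_lintegral_indicator hp, lintegral_const_mul]
        · rw [mul_left_comm]
          rfl
        · exact (Measurable.indicator (by fun_prop) hS).comp measurable_prodMk_left
    _ = ENNReal.ofReal p * ∫⁻ t in Ioi (0 : ℝ), ∫⁻ x, h x *
        {z : X × ℝ | ENNReal.ofReal z.2 < f z.1}.indicator
          (fun z => ENNReal.ofReal (z.2 ^ (p - 1))) (x, t) ∂μ := by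
        rw [lintegral_const_mul' _ _ ENNReal.ofReal_ne_top, lintegral_lintegral_swap]
        exact hm.aemeasurable
    _ = _ := by
        congr 1
        refine lintegral_congr fun t => ?_
        have hSt : MeasurableSet {x | ENNReal.ofReal t < f x} :=
          measurableSet_lt measurable_const hf
        rw [← lintegral_const_mul _ hh, ← lintegral_indicator hSt]
        refine lintegral_congr fun x => ?_
        by_cases hx : ENNReal.ofReal t < f x
        · rw [indicator_of_mem (by exact hx), indicator_of_mem (by exact hx), mul_comm]
        · rw [indicator_of_notMem (by exact hx), indicator_of_notMem (by exact hx), mul_zero]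

/-- Marcinkiewicz interpolation between a weak type `(1, 1)` bound, in the form which has already
been localized to the large values of `f`, and the trivial bound on `L^∞`. -/
theorem lintegral_rpow_le_of_weak_type {μ : Measure X} [SFinite μ] {p : ℝ} (hp : 1 < p)
    {f F : X → ℝ≥0∞} (hf : Measurable f) (hF : Measurable F) {C : ℝ≥0∞} (hC : C ≠ ⊤)
    (hweak : ∀ t : ℝ, 0 < t → ENNReal.ofReal t * μ {x | ENNReal.ofReal t < F x} ≤
      C * ∫⁻ x in {x | ENNReal.ofReal t < 2 * f x}, f x ∂μ) :
    ∫⁻ x, F x ^ p ∂μ ≤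
      ENNReal.ofReal p * C * (ENNReal.ofReal (p - 1))⁻¹ * 2 ^ (p - 1) * ∫⁻ x, f x ^ p ∂μ := by
  have hp0 : 0 < p := by linarith
  have hp1 : 0 < p - 1 := by linarith
  have h1 := lintegral_rpow_eq_lintegral_meas_ofReal_lt (μ := μ) hp0 hF measurable_const
    (h := fun _ => 1)
  have h2 := lintegral_rpow_eq_lintegral_meas_ofReal_lt (μ := μ) hp1 (hf.const_mul 2) hf
  simp only [one_mul] at h1
  rw [h1]
  calc _ ≤ ENNReal.ofReal p * ∫⁻ t in Ioi (0 : ℝ), C * (ENNReal.ofReal (t ^ (p - 1 - 1)) *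
        ∫⁻ x in {x | ENNReal.ofReal t < 2 * f x}, f x ∂μ) := by
        refine mul_le_mul_right (setLIntegral_mono' measurableSet_Ioi fun t ht => ?_) _
        have ht' : (0 : ℝ) < t := ht
        have : t ^ (p - 1) = t ^ (p - 1 - 1) * t := by
          rw [← Real.rpow_add_one ht'.ne', sub_add_cancel]
        rw [this, ENNReal.ofReal_mul (by positivity), mul_assoc, mul_left_comm C]
        refine mul_le_mul_right ?_ _
        simpa using hweak t ht'
    _ = ENNReal.ofReal p * C * (ENNReal.ofReal (p - 1))⁻¹ *
        ∫⁻ x, f x * (2 * f x) ^ (p - 1) ∂μ := by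
        rw [h2, lintegral_const_mul' _ _ hC]
        rw [mul_assoc _ _⁻¹, ← mul_assoc _⁻¹, ENNReal.inv_mul_cancel (by simpa using hp)
          ENNReal.ofReal_ne_top, one_mul, mul_assoc]
    _ = _ := by
        rw [mul_assoc _ (2 ^ (p - 1) : ℝ≥0∞), ← lintegral_const_mul _ (hf.pow_const p)]
        congr 1
        refine lintegral_congr fun x => ?_
        rw [ENNReal.mul_rpow_of_nonneg _ _ hp1.le, mul_left_comm]
        congr 1
        conv_rhs => rw [← sub_add_cancel p 1, ENNReal.rpow_add_of_nonneg _ _ hp1.le zero_le_one,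
          ENNReal.rpow_one, mul_comm]

variable [PseudoMetricSpace X]

/-- The uncentered maximal function of `f ≥ 0` with respect to `μ`, over balls of radius at
most `T`. -/
noncomputable def maxFun (μ : Measure X) (T : ℝ) (f : X → ℝ≥0∞) (x : X) : ℝ≥0∞ :=
  ⨆ (c : X) (t : ℝ) (_ : 0 < t ∧ t ≤ T) (_ : x ∈ Metric.ball c t),
    (∫⁻ y in Metric.ball c t, f y ∂μ) / μ (Metric.ball c t)

theorem le_maxFun (μ : Measure X) {T : ℝ} (f : X → ℝ≥0∞) {x c : X} {t : ℝ} (ht : 0 < t)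
    (htT : t ≤ T) (hx : x ∈ Metric.ball c t) :
    (∫⁻ y in Metric.ball c t, f y ∂μ) / μ (Metric.ball c t) ≤ maxFun μ T f x :=
  le_iSup_of_le c <| le_iSup_of_le t <| le_iSup_of_le ⟨ht, htT⟩ <| le_iSup_of_le hx le_rfl

theorem lt_maxFun_iff {μ : Measure X} {T : ℝ} {f : X → ℝ≥0∞} {x : X} {b : ℝ≥0∞} :
    b < maxFun μ T f x ↔ ∃ c t, (0 < t ∧ t ≤ T) ∧ x ∈ Metric.ball c t ∧
      b < (∫⁻ y in Metric.ball c t, f y ∂μ) / μ (Metric.ball c t) := by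
  simp only [maxFun, lt_iSup_iff, exists_prop]

variable [BorelSpace X]

theorem measurable_maxFun (μ : Measure X) (T : ℝ) (f : X → ℝ≥0∞) :
    Measurable (maxFun μ T f) := by
  refine measurable_of_Ioi fun b => IsOpen.measurableSet ?_
  rw [isOpen_iff_mem_nhds]
  intro x hx
  obtain ⟨c, t, ht, hxt, hb⟩ := lt_maxFun_iff.1 hx
  filter_upwards [Metric.isOpen_ball.mem_nhds hxt] with y hy
  exact lt_maxFun_iff.2 ⟨c, t, ht, hy, hb⟩

variable [SecondCountableTopology X]

/-- Weak type `(1, 1)` bound for the maximal function of a doubling measure, by the Vitali covering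
lemma. -/
theorem mul_meas_lt_maxFun_le {μ : Measure X} {D : ℝ≥0∞}
    (hD : ∀ c t, 0 < t → μ (Metric.ball c (5 * t)) ≤ D * μ (Metric.ball c t))
    (T : ℝ) (f : X → ℝ≥0∞) (b : ℝ≥0∞) :
    b * μ {x | b < maxFun μ T f x} ≤ D * ∫⁻ x, f x ∂μ := by
  set S : Set (X × ℝ) := {a | (0 < a.2 ∧ a.2 ≤ T) ∧
    b < (∫⁻ y in Metric.ball a.1 a.2, f y ∂μ) / μ (Metric.ball a.1 a.2)} with hS
  obtain ⟨u, huS, hdisj, hcov⟩ := Vitali.exists_disjoint_subfamily_covering_enlargement_closedBall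
    S Prod.fst Prod.snd T (fun a ha => ha.1.2) 4 (by norm_num)
  have hdisj' : u.PairwiseDisjoint fun a => Metric.ball a.1 a.2 :=
    hdisj.mono fun a => Metric.ball_subset_closedBall
  have hcount : u.Countable := hdisj'.countable_of_isOpen (fun a _ => Metric.isOpen_ball)
    fun a ha => Metric.nonempty_ball.2 (huS ha).1.1
  have hsub : {x | b < maxFun μ T f x} ⊆ ⋃ a ∈ u, Metric.ball a.1 (5 * a.2) := by
    intro x hx
    obtain ⟨c, t, ht, hxt, hb⟩ := lt_maxFun_iff.1 hx
    obtain ⟨a, ha, hsub⟩ := hcov (c, t) ⟨ht, hb⟩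
    refine mem_biUnion ha ?_
    have := (huS ha).1.1
    exact Metric.closedBall_subset_ball (by linarith) (hsub (Metric.ball_subset_closedBall hxt))
  calc b * μ {x | b < maxFun μ T f x}
      ≤ b * ∑' a : u, μ (Metric.ball a.1.1 (5 * a.1.2)) := by
        gcongr
        exact (measure_mono hsub).trans (measure_biUnion_le μ hcount _)
    _ ≤ ∑' a : u, D * ∫⁻ y in Metric.ball a.1.1 a.1.2, f y ∂μ := by
        rw [← ENNReal.tsum_mul_left]
        refine ENNReal.tsum_le_tsum fun a => ?_
        have ha := huS a.2
        calc b * μ (Metric.ball a.1.1 (5 * a.1.2))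
            ≤ b * (D * μ (Metric.ball a.1.1 a.1.2)) := by gcongr; exact hD _ _ ha.1.1
          _ = D * (b * μ (Metric.ball a.1.1 a.1.2)) := by ring
          _ ≤ _ := by gcongr; exact ENNReal.mul_le_of_le_div ha.2.le
    _ = D * ∫⁻ y in ⋃ a ∈ u, Metric.ball a.1 a.2, f y ∂μ := by
        rw [ENNReal.tsum_mul_left,
          lintegral_biUnion hcount (fun a _ => Metric.isOpen_ball.measurableSet) hdisj']
    _ ≤ D * ∫⁻ x, f x ∂μ := by
        gcongr
        exact Measure.restrict_le_self

/-- The maximal function of a doubling measure is bounded on `L^p`, `p > 1`. -/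
theorem lintegral_maxFun_rpow_le {μ : Measure X} [SFinite μ] {D : ℝ≥0∞} (hDtop : D ≠ ⊤)
    (hD : ∀ c t, 0 < t → μ (Metric.ball c (5 * t)) ≤ D * μ (Metric.ball c t))
    {p : ℝ} (hp : 1 < p) (T : ℝ) {f : X → ℝ≥0∞} (hf : Measurable f) :
    ∫⁻ x, maxFun μ T f x ^ p ∂μ ≤
      ENNReal.ofReal p * (2 * D) * (ENNReal.ofReal (p - 1))⁻¹ * 2 ^ (p - 1) *
        ∫⁻ x, f x ^ p ∂μ := by
  refine lintegral_rpow_le_of_weak_type hp hf (measurable_maxFun μ T f)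
    (ENNReal.mul_ne_top (by simp) hDtop) fun t ht => ?_
  have hSt : MeasurableSet {x | ENNReal.ofReal t < 2 * f x} :=
    measurableSet_lt measurable_const (hf.const_mul 2)
  set g := {x | ENNReal.ofReal t < 2 * f x}.indicator f with hg
  have hfg : ∀ x, f x ≤ g x + ENNReal.ofReal (t / 2) := by
    intro x
    by_cases hx : ENNReal.ofReal t < 2 * f x
    · rw [hg, indicator_of_mem (by exact hx)]
      exact le_self_add
    · rw [hg, indicator_of_notMem (by exact hx), zero_add, ENNReal.ofReal_div_of_pos two_pos,
        ENNReal.le_div_iff_mul_le (by simp) (by simp), mul_comm]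
      simpa using hx
  have hsub : {x | ENNReal.ofReal t < maxFun μ T f x} ⊆
      {x | ENNReal.ofReal (t / 2) < maxFun μ T g x} := by
    intro x hx
    obtain ⟨c, s, hs, hxs, hb⟩ := lt_maxFun_iff.1 hx
    refine lt_maxFun_iff.2 ⟨c, s, hs, hxs, ?_⟩
    have h1 : (∫⁻ y in Metric.ball c s, f y ∂μ) / μ (Metric.ball c s) ≤
        (∫⁻ y in Metric.ball c s, g y ∂μ) / μ (Metric.ball c s) + ENNReal.ofReal (t / 2) := by
      calc _ ≤ (∫⁻ y in Metric.ball c s, g y + ENNReal.ofReal (t / 2) ∂μ) /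
            μ (Metric.ball c s) := by gcongr with y; exact hfg y
        _ ≤ _ := by
          rw [lintegral_add_right _ measurable_const, setLIntegral_const, ENNReal.add_div]
          gcongr
          exact ENNReal.div_le_of_le_mul le_rfl
    have h2 := hb.trans_le h1
    rw [← add_halves t, ENNReal.ofReal_add (by positivity) (by positivity), add_halves t] at h2
    exact lt_of_add_lt_add_right h2
  calc ENNReal.ofReal t * μ {x | ENNReal.ofReal t < maxFun μ T f x}
      ≤ (2 * ENNReal.ofReal (t / 2)) * μ {x | ENNReal.ofReal (t / 2) < maxFun μ T g x} := by
        gcongr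
        rw [← ENNReal.ofReal_ofNat 2, ← ENNReal.ofReal_mul (by norm_num)]
        gcongr
        linarith
    _ ≤ 2 * (D * ∫⁻ x, g x ∂μ) := by
        rw [mul_assoc]
        refine mul_le_mul_right ?_ _
        exact mul_meas_lt_maxFun_le hD T g _
    _ = _ := by rw [hg, lintegral_indicator hSt, mul_assoc]

end MaximalFunction

/-! ### Jensen and Hölder inequalities -/

section Jensen

variable {X : Type*} [MeasurableSpace X] {μ : Measure X}

theorem lintegral_rpow_le_rpow_lintegral {F : X → ℝ≥0∞} (hF : AEMeasurable F μ) {θ : ℝ}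
    (h0 : 0 ≤ θ) (h1 : θ ≤ 1) :
    ∫⁻ x, F x ^ θ ∂μ ≤ (∫⁻ x, F x ∂μ) ^ θ * μ univ ^ (1 - θ) := by
  simpa using ENNReal.lintegral_mul_norm_pow_le (μ := μ) hF (g := fun _ => 1) aemeasurable_const
    h0 (sub_nonneg.2 h1) (by ring)

theorem rpow_lintegral_le_lintegral_rpow {F : X → ℝ≥0∞} (hF : AEMeasurable F μ) {q : ℝ}
    (hq : 1 ≤ q) :
    (∫⁻ x, F x ∂μ) ^ q ≤ μ univ ^ (q - 1) * ∫⁻ x, F x ^ q ∂μ := by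
  have hq0 : 0 < q := by linarith
  have h := lintegral_rpow_le_rpow_lintegral (hF.pow_const q) (θ := 1 / q) (by positivity)
    ((div_le_one hq0).2 hq)
  simp only [← ENNReal.rpow_mul, mul_one_div_cancel hq0.ne', ENNReal.rpow_one] at h
  have h' := ENNReal.rpow_le_rpow h hq0.le
  rw [ENNReal.mul_rpow_of_nonneg _ _ hq0.le, ← ENNReal.rpow_mul, ← ENNReal.rpow_mul,
    one_div_mul_cancel hq0.ne', ENNReal.rpow_one, sub_mul, one_div_mul_cancel hq0.ne', one_mul,
    mul_comm] at h'
  exact h'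

end Jensen

variable {n : ℕ}

/-! ### Cubes and balls -/

theorem isOpen_cube (a : Rn n) (l : ℝ) : IsOpen (cube a l) := by
  have : cube a l = ⋂ i, {x : Rn n | a i < x i ∧ x i < a i + l} := by
    ext x; simp [cube]
  rw [this]
  refine isOpen_iInter_of_finite fun i => ?_
  have hc : Continuous fun x : Rn n => x i := by fun_prop
  exact (isOpen_lt continuous_const hc).inter (isOpen_lt hc continuous_const)

theorem measurableSet_cube (a : Rn n) (l : ℝ) : MeasurableSet (cube a l) :=
  (isOpen_cube a l).measurableSet

theorem volume_cube (a : Rn n) (l : ℝ) : volume (cube a l) = ENNReal.ofReal l ^ n := by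
  have h : cube a l = WithLp.ofLp ⁻¹' (univ.pi fun i => Ioo (a i) (a i + l)) := by
    ext x; simp [cube]
  rw [h, (PiLp.volume_preserving_ofLp (Fin n)).measure_preimage
    (MeasurableSet.univ_pi fun i => measurableSet_Ioo).nullMeasurableSet, Real.volume_pi_Ioo]
  simp

theorem volume_cube_ne_zero (a : Rn n) {l : ℝ} (hl : 0 < l) : volume (cube a l) ≠ 0 := by
  rw [volume_cube]
  exact pow_ne_zero _ (by simpa using hl)

theorem volume_cube_ne_top (a : Rn n) (l : ℝ) : volume (cube a l) ≠ ⊤ := by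
  rw [volume_cube]
  exact ENNReal.pow_ne_top ENNReal.ofReal_ne_top

theorem volume_ball_ne_zero (c : Rn n) {t : ℝ} (ht : 0 < t) : volume (Metric.ball c t) ≠ 0 :=
  (Metric.measure_ball_pos _ c ht).ne'

theorem volume_ball_ne_top (c : Rn n) (t : ℝ) : volume (Metric.ball c t) ≠ ⊤ :=
  measure_ball_lt_top.ne

theorem volume_ball_eq (c : Rn n) {t : ℝ} (ht : 0 < t) :
    volume (Metric.ball c t) = ENNReal.ofReal t ^ n * volume (Metric.ball (0 : Rn n) 1) := by
  rw [Measure.addHaar_ball_of_pos _ _ ht, ENNReal.ofReal_pow ht.le, finrank_euclideanSpace_fin]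

theorem volume_ball_mul (c c' : Rn n) {s t : ℝ} (hs : 0 < s) (ht : 0 < t) :
    volume (Metric.ball c (s * t)) = ENNReal.ofReal s ^ n * volume (Metric.ball c' t) := by
  rw [volume_ball_eq c (mul_pos hs ht), volume_ball_eq c' ht, ENNReal.ofReal_mul hs.le, mul_pow,
    mul_assoc]

/-- The cube with centre `c` and edge length `2 t`. -/
abbrev centeredCube (c : Rn n) (t : ℝ) : Set (Rn n) :=
  cube (c - WithLp.toLp 2 fun _ => t) (2 * t)

theorem ball_subset_centeredCube (c : Rn n) (t : ℝ) : Metric.ball c t ⊆ centeredCube c t := by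
  intro x hx i
  have h : ‖(x - c) i‖ < t := (PiLp.norm_apply_le (x - c) i).trans_lt
    (by simpa [dist_eq_norm] using hx)
  rw [PiLp.sub_apply, Real.norm_eq_abs, abs_lt] at h
  simp only [PiLp.sub_apply]
  constructor <;> linarith

/-- The ratio of the volumes of a circumscribed cube and of a ball. -/
noncomputable def cubeRatio (n : ℕ) : ℝ≥0∞ := 2 ^ n / volume (Metric.ball (0 : Rn n) 1)

theorem cubeRatio_ne_top (n : ℕ) : cubeRatio n ≠ ⊤ :=
  ENNReal.div_ne_top (by simp) (volume_ball_ne_zero _ one_pos)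

theorem volume_centeredCube (c : Rn n) {t : ℝ} (ht : 0 < t) :
    volume (centeredCube c t) = cubeRatio n * volume (Metric.ball c t) := by
  rw [volume_cube, volume_ball_eq c ht, cubeRatio, mul_comm (ENNReal.ofReal t ^ n), ← mul_assoc,
    ENNReal.div_mul_cancel (volume_ball_ne_zero _ one_pos) (volume_ball_ne_top _ _),
    ENNReal.ofReal_mul (by norm_num), mul_pow]
  simp

/-! ### The Muckenhoupt condition on balls -/

/-- The `A_r` condition, `1 < r`, over balls, for a weight with values in `[0, ∞]` and with an
explicit constant. -/
def BallAp (r : ℝ) (C : ℝ≥0∞) (V : Rn n → ℝ≥0∞) : Prop :=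
  ∀ (c : Rn n) (t : ℝ), 0 < t →
    (∫⁻ x in Metric.ball c t, V x) * (∫⁻ x in Metric.ball c t, V x ^ (-(1 / (r - 1)))) ^ (r - 1) ≤
      C * volume (Metric.ball c t) ^ r

section Muckenhoupt

variable {r : ℝ} {C : ℝ≥0∞} {V : Rn n → ℝ≥0∞}

/-- The reverse of the `A_r` condition, which holds for every weight and every set by Hölder's
inequality. -/
theorem volume_rpow_le_of_weight (hr : 1 < r) (hV : Measurable V) (hV0 : ∀ x, V x ≠ 0)
    (hVt : ∀ x, V x ≠ ⊤) (E : Set (Rn n)) :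
    volume E ^ r ≤ (∫⁻ x in E, V x) * (∫⁻ x in E, V x ^ (-(1 / (r - 1)))) ^ (r - 1) := by
  have hr0 : 0 < r := by linarith
  have hr1 : 0 < r - 1 := by linarith
  have h := ENNReal.lintegral_mul_norm_pow_le (μ := volume.restrict E) hV.aemeasurable
    (hV.pow_const (-(1 / (r - 1)))).aemeasurable (p := 1 / r) (q := (r - 1) / r) (by positivity)
    (by positivity) (by field_simp; ring)
  have h1 : ∀ x, V x ^ (1 / r) * (V x ^ (-(1 / (r - 1)))) ^ ((r - 1) / r) = 1 := by
    intro x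
    rw [← ENNReal.rpow_mul, ← ENNReal.rpow_add _ _ (hV0 x) (hVt x)]
    have : 1 / r + -(1 / (r - 1)) * ((r - 1) / r) = 0 := by field_simp; ring
    rw [this, ENNReal.rpow_zero]
  simp only [h1, lintegral_const, Measure.restrict_apply_univ, one_mul] at h
  have h' := ENNReal.rpow_le_rpow h hr0.le
  rw [ENNReal.mul_rpow_of_nonneg _ _ hr0.le, ← ENNReal.rpow_mul, ← ENNReal.rpow_mul,
    one_div_mul_cancel hr0.ne', ENNReal.rpow_one, div_mul_cancel₀ _ hr0.ne'] at h'
  exact h'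

/-- The doubling constant of an `A_r` weight. -/
noncomputable def doublingConst (n : ℕ) (r : ℝ) (C : ℝ≥0∞) : ℝ≥0∞ :=
  C * (ENNReal.ofReal 5 ^ n) ^ r

theorem doublingConst_ne_top (hr : 1 < r) (hC : C ≠ ⊤) : doublingConst n r C ≠ ⊤ :=
  ENNReal.mul_ne_top hC (ENNReal.rpow_ne_top_of_nonneg (by linarith)
    (ENNReal.pow_ne_top ENNReal.ofReal_ne_top))

theorem BallAp.mul_volume_le (h : BallAp r C V) (hr : 1 < r) (c : Rn n) {t : ℝ} (ht : 0 < t) :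
    (∫⁻ x in Metric.ball c (5 * t), V x) *
      (∫⁻ x in Metric.ball c (5 * t), V x ^ (-(1 / (r - 1)))) ^ (r - 1) ≤
      doublingConst n r C * volume (Metric.ball c t) ^ r := by
  refine (h c (5 * t) (by positivity)).trans_eq ?_
  rw [volume_ball_mul c c (by norm_num) ht, ENNReal.mul_rpow_of_nonneg _ _ (by linarith),
    doublingConst, mul_assoc]

theorem volume_ball_rpow_ne_zero (c : Rn n) {t : ℝ} (ht : 0 < t) (r : ℝ) :
    volume (Metric.ball c t) ^ r ≠ 0 := by
  simp [ENNReal.rpow_eq_zero_iff, volume_ball_ne_zero c ht, volume_ball_ne_top c t]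

theorem volume_ball_rpow_ne_top (c : Rn n) {t : ℝ} (ht : 0 < t) (r : ℝ) :
    volume (Metric.ball c t) ^ r ≠ ⊤ := by
  simp [ENNReal.rpow_eq_top_iff, volume_ball_ne_zero c ht, volume_ball_ne_top c t]

theorem BallAp.doubling (h : BallAp r C V) (hr : 1 < r) (hV : Measurable V)
    (hV0 : ∀ x, V x ≠ 0) (hVt : ∀ x, V x ≠ ⊤) (c : Rn n) (t : ℝ) (ht : 0 < t) :
    volume.withDensity V (Metric.ball c (5 * t)) ≤
      doublingConst n r C * volume.withDensity V (Metric.ball c t) := by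
  rw [withDensity_apply _ Metric.isOpen_ball.measurableSet,
    withDensity_apply _ Metric.isOpen_ball.measurableSet]
  refine (ENNReal.mul_le_mul_iff_left (volume_ball_rpow_ne_zero c ht r)
    (volume_ball_rpow_ne_top c ht r)).1 ?_
  calc (∫⁻ x in Metric.ball c (5 * t), V x) * volume (Metric.ball c t) ^ r
      ≤ (∫⁻ x in Metric.ball c (5 * t), V x) * ((∫⁻ x in Metric.ball c t, V x) *
        (∫⁻ x in Metric.ball c (5 * t), V x ^ (-(1 / (r - 1)))) ^ (r - 1)) := by
        gcongr
        refine (volume_rpow_le_of_weight hr hV hV0 hVt _).trans ?_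
        gcongr
        linarith
    _ = ((∫⁻ x in Metric.ball c (5 * t), V x) *
        (∫⁻ x in Metric.ball c (5 * t), V x ^ (-(1 / (r - 1)))) ^ (r - 1)) *
          (∫⁻ x in Metric.ball c t, V x) := by ring
    _ ≤ (doublingConst n r C * volume (Metric.ball c t) ^ r) * (∫⁻ x in Metric.ball c t, V x) := by
        exact mul_le_mul_left (h.mul_volume_le hr c ht) _
    _ = _ := by ring

/-- The dual weight of an `A_r` weight is doubling as well. -/
theorem BallAp.dual_doubling (h : BallAp r C V) (hr : 1 < r) (hV : Measurable V)
    (hV0 : ∀ x, V x ≠ 0) (hVt : ∀ x, V x ≠ ⊤) (c : Rn n) (t : ℝ) (ht : 0 < t) :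
    volume.withDensity (fun x => V x ^ (-(1 / (r - 1)))) (Metric.ball c (5 * t)) ≤
      doublingConst n r C ^ (1 / (r - 1)) *
        volume.withDensity (fun x => V x ^ (-(1 / (r - 1)))) (Metric.ball c t) := by
  have hr1 : 0 < r - 1 := by linarith
  rw [withDensity_apply _ Metric.isOpen_ball.measurableSet,
    withDensity_apply _ Metric.isOpen_ball.measurableSet, ← ENNReal.rpow_le_rpow_iff hr1,
    ENNReal.mul_rpow_of_nonneg _ _ hr1.le, ← ENNReal.rpow_mul, one_div_mul_cancel hr1.ne',
    ENNReal.rpow_one]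
  refine (ENNReal.mul_le_mul_iff_left (volume_ball_rpow_ne_zero c ht r)
    (volume_ball_rpow_ne_top c ht r)).1 ?_
  set σ : Rn n → ℝ≥0∞ := fun x => V x ^ (-(1 / (r - 1))) with hσ
  calc (∫⁻ x in Metric.ball c (5 * t), σ x) ^ (r - 1) * volume (Metric.ball c t) ^ r
      ≤ (∫⁻ x in Metric.ball c (5 * t), σ x) ^ (r - 1) *
        ((∫⁻ x in Metric.ball c (5 * t), V x) * (∫⁻ x in Metric.ball c t, σ x) ^ (r - 1)) := by
        gcongr
        refine (volume_rpow_le_of_weight hr hV hV0 hVt _).trans ?_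
        gcongr
        linarith
    _ = ((∫⁻ x in Metric.ball c (5 * t), V x) *
        (∫⁻ x in Metric.ball c (5 * t), σ x) ^ (r - 1)) *
          (∫⁻ x in Metric.ball c t, σ x) ^ (r - 1) := by ring
    _ ≤ (doublingConst n r C * volume (Metric.ball c t) ^ r) *
          (∫⁻ x in Metric.ball c t, σ x) ^ (r - 1) := by
        exact mul_le_mul_left (h.mul_volume_le hr c ht) _
    _ = _ := by ring

/-- The pointwise estimate behind Muckenhoupt's theorem: the maximal function is controlled by
the composition of the maximal functions with respect to the weight and to its dual weight. -/
theorem BallAp.maxFun_rpow_le (h : BallAp r C V) (hr : 1 < r) (hC : C ≠ ⊤) (hV : Measurable V)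
    (hV0 : ∀ x, V x ≠ 0) (hVt : ∀ x, V x ≠ ⊤) (T : ℝ) {f : Rn n → ℝ≥0∞} (hf : Measurable f)
    (x : Rn n) :
    maxFun volume T f x ^ (r - 1) ≤ C * maxFun (volume.withDensity V) T (fun y =>
      maxFun (volume.withDensity fun x => V x ^ (-(1 / (r - 1)))) T
        (fun z => f z * (V z ^ (-(1 / (r - 1))))⁻¹) y ^ (r - 1) * (V y)⁻¹) x := by
  have hr1 : 0 < r - 1 := by linarith
  set σ : Rn n → ℝ≥0∞ := fun x => V x ^ (-(1 / (r - 1))) with hσ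
  have hσm : Measurable σ := hV.pow_const _
  have hσ0 : ∀ x, σ x ≠ 0 := fun x => by simp [hσ, ENNReal.rpow_eq_zero_iff, hV0 x, hVt x]
  have hσt : ∀ x, σ x ≠ ⊤ := fun x => by simp [hσ, ENNReal.rpow_eq_top_iff, hV0 x, hVt x]
  set m := maxFun (volume.withDensity σ) T (fun z => f z * (σ z)⁻¹) with hm
  have hmm : Measurable m := measurable_maxFun _ _ _
  set G : Rn n → ℝ≥0∞ := fun y => m y ^ (r - 1) * (V y)⁻¹ with hG
  have hGm : Measurable G := (hmm.pow_const _).mul hV.inv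
  have hVG : ∀ y, V y * G y = m y ^ (r - 1) := fun y => by
    rw [hG, mul_left_comm, ENNReal.mul_inv_cancel (hV0 y) (hVt y), mul_one]
  suffices hkey : maxFun volume T f x ≤
      (C * maxFun (volume.withDensity V) T G x) ^ (1 / (r - 1)) by
    refine (ENNReal.rpow_le_rpow hkey hr1.le).trans_eq ?_
    rw [← ENNReal.rpow_mul, one_div_mul_cancel hr1.ne', ENNReal.rpow_one]
  refine iSup_le fun c => iSup_le fun t => iSup_le fun ht => iSup_le fun hx => ?_
  have hB : MeasurableSet (Metric.ball c t) := Metric.isOpen_ball.measurableSet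
  have hv0 := volume_ball_ne_zero c ht.1
  have hvt := volume_ball_ne_top c t
  set B := Metric.ball c t with hBdef
  -- the average of `f / σ` with respect to `σ` bounds the maximal function from below on `B`
  set A := (∫⁻ y in B, f y) / ∫⁻ y in B, σ y with hA
  have hAm : ∀ y ∈ B, A ≤ m y := by
    intro y hy
    refine le_trans (le_of_eq ?_) (le_maxFun _ _ ht.1 ht.2 hy)
    have h1 : ∫⁻ z in B, f z * (σ z)⁻¹ ∂volume.withDensity σ = ∫⁻ z in B, f z := by
      rw [setLIntegral_withDensity_eq_setLIntegral_mul (g := fun z => f z * (σ z)⁻¹) _ hσm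
        (hf.mul hσm.inv) hB]
      refine lintegral_congr fun z => ?_
      rw [Pi.mul_apply, mul_left_comm, ENNReal.mul_inv_cancel (hσ0 z) (hσt z), mul_one]
    rw [withDensity_apply _ hB, h1]
  have hS0 : ∫⁻ y in B, σ y ≠ 0 := by
    rw [← lintegral_indicator hB, Ne, lintegral_eq_zero_iff (hσm.indicator hB)]
    intro h0
    refine hv0 (measure_mono_null ?_ h0)
    intro y hy
    change ¬ (B.indicator σ y = 0)
    rw [indicator_of_mem hy]
    exact hσ0 y
  have hW0 : ∫⁻ y in B, V y ≠ 0 := by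
    rw [← lintegral_indicator hB, Ne, lintegral_eq_zero_iff (hV.indicator hB)]
    intro h0
    refine hv0 (measure_mono_null ?_ h0)
    intro y hy
    change ¬ (B.indicator V y = 0)
    rw [indicator_of_mem hy]
    exact hV0 y
  have hSW := h c t ht.1
  change (∫⁻ y in B, V y) * (∫⁻ y in B, σ y) ^ (r - 1) ≤ C * volume B ^ r at hSW
  have hCt : C * volume B ^ r ≠ ⊤ := ENNReal.mul_ne_top hC (volume_ball_rpow_ne_top c ht.1 r)
  have hWt : ∫⁻ y in B, V y ≠ ⊤ := by
    intro htop
    refine hCt (top_le_iff.1 (le_trans (le_of_eq ?_) hSW))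
    rw [htop, ENNReal.top_mul]
    simpa [ENNReal.rpow_eq_zero_iff, hS0] using fun _ => hr.le
  have hSt : ∫⁻ y in B, σ y ≠ ⊤ := by
    intro htop
    refine hCt (top_le_iff.1 (le_trans (le_of_eq ?_) hSW))
    rw [htop, ENNReal.top_rpow_of_pos hr1, ENNReal.mul_top hW0]
  have hI : ∫⁻ y in B, f y = A * ∫⁻ y in B, σ y := (ENNReal.div_mul_cancel hS0 hSt).symm
  have hM : A ^ (r - 1) * volume B / (∫⁻ y in B, V y) ≤
      maxFun (volume.withDensity V) T G x := by
    refine le_trans ?_ (le_maxFun _ _ ht.1 ht.2 hx)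
    rw [withDensity_apply _ hB, setLIntegral_withDensity_eq_setLIntegral_mul _ hV hGm hB,
      ← setLIntegral_const]
    gcongr ?_ / _
    refine setLIntegral_mono' hB fun y hy => ?_
    rw [Pi.mul_apply, hVG]
    exact ENNReal.rpow_le_rpow (hAm y hy) hr1.le
  rw [← ENNReal.rpow_le_rpow_iff hr1, ← ENNReal.rpow_mul, one_div_mul_cancel hr1.ne',
    ENNReal.rpow_one]
  refine le_trans ?_ (mul_le_mul_right hM C)
  have hvr : volume B ^ r = volume B * volume B ^ (r - 1) := by
    conv_rhs => rw [← ENNReal.rpow_one (volume B), ← ENNReal.rpow_mul, one_mul,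
      ← ENNReal.rpow_add _ _ hv0 hvt, add_sub_cancel]
  rw [hI, ENNReal.div_rpow_of_nonneg _ _ hr1.le, ENNReal.mul_rpow_of_nonneg _ _ hr1.le]
  refine ENNReal.div_le_of_le_mul ?_
  calc A ^ (r - 1) * (∫⁻ y in B, σ y) ^ (r - 1)
      ≤ A ^ (r - 1) * (C * volume B ^ r / ∫⁻ y in B, V y) := by
        gcongr
        rw [ENNReal.le_div_iff_mul_le (Or.inl hW0) (Or.inl hWt), mul_comm]
        exact hSW
    _ = _ := by
        rw [hvr]
        simp only [div_eq_mul_inv]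
        ring

/-- **Muckenhoupt's theorem** for the truncated maximal function, with a constant which does not
depend on the truncation. -/
theorem BallAp.exists_lintegral_maxFun_le (h : BallAp r C V) (hr : 1 < r) (hC : C ≠ ⊤)
    (hV : Measurable V) (hV0 : ∀ x, V x ≠ 0) (hVt : ∀ x, V x ≠ ⊤) :
    ∃ C' : ℝ≥0∞, C' ≠ ⊤ ∧ ∀ (T : ℝ) (f : Rn n → ℝ≥0∞), Measurable f →
      ∫⁻ x, maxFun volume T f x ^ r * V x ≤ C' * ∫⁻ x, f x ^ r * V x := by
  have hr0 : 0 < r := by linarith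
  have hr1 : 0 < r - 1 := by linarith
  set r' := r / (r - 1) with hr'
  have hr'1 : 1 < r' := by rw [hr', lt_div_iff₀ hr1]; linarith
  have hr'0 : 0 < r' := by linarith
  have hD := h.doubling hr hV hV0 hVt
  have hD' := h.dual_doubling hr hV hV0 hVt
  have hDt := doublingConst_ne_top (n := n) hr hC
  have hDt' : doublingConst n r C ^ (1 / (r - 1)) ≠ ⊤ :=
    ENNReal.rpow_ne_top_of_nonneg (by positivity) hDt
  set D := doublingConst n r C
  set D' := D ^ (1 / (r - 1))
  have hfin : ∀ (b : ℝ) (E : ℝ≥0∞), 1 < b → E ≠ ⊤ →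
      ENNReal.ofReal b * (2 * E) * (ENNReal.ofReal (b - 1))⁻¹ * 2 ^ (b - 1) ≠ ⊤ := by
    intro b E hb hE
    refine ENNReal.mul_ne_top (ENNReal.mul_ne_top (ENNReal.mul_ne_top (by simp)
      (ENNReal.mul_ne_top (by simp) hE)) (by simpa using hb))
      (ENNReal.rpow_ne_top_of_nonneg (by linarith) (by simp))
  refine ⟨C ^ r' * ((ENNReal.ofReal r' * (2 * D) * (ENNReal.ofReal (r' - 1))⁻¹ * 2 ^ (r' - 1)) *
    (ENNReal.ofReal r * (2 * D') * (ENNReal.ofReal (r - 1))⁻¹ * 2 ^ (r - 1))),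
    ENNReal.mul_ne_top (ENNReal.rpow_ne_top_of_nonneg hr'0.le hC)
      (ENNReal.mul_ne_top (hfin _ _ hr'1 hDt) (hfin _ _ hr hDt')), fun T f hf => ?_⟩
  have hpt := h.maxFun_rpow_le hr hC hV hV0 hVt T hf
  set σ : Rn n → ℝ≥0∞ := fun x => V x ^ (-(1 / (r - 1))) with hσ
  have hσm : Measurable σ := hV.pow_const _
  set m := maxFun (volume.withDensity σ) T (fun z => f z * (σ z)⁻¹) with hm
  have hmm : Measurable m := measurable_maxFun _ _ _
  set G : Rn n → ℝ≥0∞ := fun y => m y ^ (r - 1) * (V y)⁻¹ with hG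
  have hGm : Measurable G := (hmm.pow_const _).mul hV.inv
  set M := maxFun (volume.withDensity V) T G with hM
  have hMm : Measurable M := measurable_maxFun _ _ _
  have hexp : (r - 1) * r' = r := by rw [hr']; field_simp
  have hfm : Measurable (fun z => f z * (σ z)⁻¹) := hf.mul hσm.inv
  calc ∫⁻ x, maxFun volume T f x ^ r * V x
      ≤ ∫⁻ x, C ^ r' * (V x * M x ^ r') := by
        refine lintegral_mono fun x => ?_
        have := ENNReal.rpow_le_rpow (hpt x) hr'0.le
        rw [← ENNReal.rpow_mul, hexp, ENNReal.mul_rpow_of_nonneg _ _ hr'0.le] at this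
        rw [mul_left_comm, mul_comm (V x)]
        exact mul_le_mul_left this _
    _ = C ^ r' * ∫⁻ x, M x ^ r' ∂volume.withDensity V := by
        rw [lintegral_const_mul' _ _ (ENNReal.rpow_ne_top_of_nonneg hr'0.le hC),
          lintegral_withDensity_eq_lintegral_mul _ hV (hMm.pow_const _)]
        rfl
    _ ≤ C ^ r' * ((ENNReal.ofReal r' * (2 * D) * (ENNReal.ofReal (r' - 1))⁻¹ * 2 ^ (r' - 1)) *
          ∫⁻ x, G x ^ r' ∂volume.withDensity V) :=
        mul_le_mul_right (lintegral_maxFun_rpow_le hDt hD hr'1 T hGm) _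
    _ = C ^ r' * ((ENNReal.ofReal r' * (2 * D) * (ENNReal.ofReal (r' - 1))⁻¹ * 2 ^ (r' - 1)) *
          ∫⁻ x, m x ^ r ∂volume.withDensity σ) := by
        rw [lintegral_withDensity_eq_lintegral_mul _ hV (hGm.pow_const _),
          lintegral_withDensity_eq_lintegral_mul _ hσm (hmm.pow_const _)]
        congr 2
        refine lintegral_congr fun x => ?_
        rw [Pi.mul_apply, Pi.mul_apply, hG]
        simp only
        rw [ENNReal.mul_rpow_of_nonneg _ _ hr'0.le, ← ENNReal.rpow_mul, hexp, mul_left_comm,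
          mul_comm, hσ, ← ENNReal.rpow_neg_one (V x), ← ENNReal.rpow_mul]
        simp only
        congr 1
        nth_rewrite 1 [← ENNReal.rpow_one (V x)]
        rw [← ENNReal.rpow_add _ _ (hV0 x) (hVt x)]
        congr 1
        rw [hr']
        field_simp
        ring
    _ ≤ C ^ r' * ((ENNReal.ofReal r' * (2 * D) * (ENNReal.ofReal (r' - 1))⁻¹ * 2 ^ (r' - 1)) *
          ((ENNReal.ofReal r * (2 * D') * (ENNReal.ofReal (r - 1))⁻¹ * 2 ^ (r - 1)) *
            ∫⁻ x, (f x * (σ x)⁻¹) ^ r ∂volume.withDensity σ)) := by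
        refine mul_le_mul_right (mul_le_mul_right ?_ _) _
        exact lintegral_maxFun_rpow_le hDt' hD' hr T hfm
    _ = _ := by
        rw [lintegral_withDensity_eq_lintegral_mul _ hσm (hfm.pow_const _), ← mul_assoc _ _
          (lintegral _ _), ← mul_assoc _ _ (lintegral _ _)]
        congr 1
        refine lintegral_congr fun x => ?_
        rw [Pi.mul_apply]
        rw [ENNReal.mul_rpow_of_nonneg _ _ hr0.le, mul_left_comm, hσ]
        simp only
        congr 1
        rw [← ENNReal.rpow_neg_one, ← ENNReal.rpow_mul, ← ENNReal.rpow_mul,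
          ← ENNReal.rpow_add _ _ (hV0 x) (hVt x)]
        conv_rhs => rw [← ENNReal.rpow_one (V x)]
        congr 1
        field_simp
        ring

end Muckenhoupt

/-! ### From Muckenhoupt weights on cubes to weights on balls -/

theorem IsApWeight.aemeasurable {p : ℝ} {w : Rn n → ℝ} (hw : IsApWeight p w) :
    AEMeasurable (fun x => ENNReal.ofReal (w x)) volume :=
  hw.locallyIntegrable.aestronglyMeasurable.aemeasurable.ennreal_ofReal

theorem mul_div_rpow_le_iff {W S C v : ℝ≥0∞} {r : ℝ} (hr : 1 < r) (hv0 : v ≠ 0) (hvt : v ≠ ⊤) :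
    W / v * (S / v) ^ (r - 1) ≤ C ↔ W * S ^ (r - 1) ≤ C * v ^ r := by
  have hr1 : 0 < r - 1 := by linarith
  have h1 : W / v * (S / v) ^ (r - 1) = W * S ^ (r - 1) / v ^ r := by
    have h2 : v ^ r = v * v ^ (r - 1) := by
      conv_rhs => rw [← ENNReal.rpow_one v, ← ENNReal.rpow_mul, one_mul,
        ← ENNReal.rpow_add _ _ hv0 hvt, add_sub_cancel]
    rw [ENNReal.div_rpow_of_nonneg _ _ hr1.le, h2]
    simp only [div_eq_mul_inv]
    rw [ENNReal.mul_inv (Or.inl hv0) (Or.inl hvt)]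
    ring
  rw [h1, ENNReal.div_le_iff]
  · simp [ENNReal.rpow_eq_zero_iff, hv0, hvt]
  · simp [ENNReal.rpow_eq_top_iff, hv0, hvt]

/-- An `A_{r₀}` weight satisfies the `A_r` condition on cubes for all `r ≥ r₀`, `r > 1`. -/
theorem IsApWeight.cube_le {r₀ r : ℝ} {w : Rn n → ℝ} (hw : IsApWeight r₀ w) (h1 : 1 ≤ r₀)
    (hrr : r₀ ≤ r) (hr : 1 < r) (a : Rn n) {l : ℝ} (hl : 0 < l) :
    (∫⁻ x in cube a l, ENNReal.ofReal (w x)) *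
      (∫⁻ x in cube a l, ENNReal.ofReal (w x) ^ (-(1 / (r - 1)))) ^ (r - 1) ≤
      apConst r₀ w * volume (cube a l) ^ r := by
  have hr1 : 0 < r - 1 := by linarith
  have hv0 := volume_cube_ne_zero a hl
  have hvt := volume_cube_ne_top a l
  have hm : AEMeasurable (fun x => ENNReal.ofReal (w x)) (volume.restrict (cube a l)) :=
    hw.aemeasurable.restrict
  rw [← mul_div_rpow_le_iff hr hv0 hvt]
  set W := fun x => ENNReal.ofReal (w x) with hW
  rcases h1.eq_or_lt with h1 | h1
  · have hap : (∫⁻ x in cube a l, W x) / volume (cube a l) *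
        essSup (fun x => (W x)⁻¹) (volume.restrict (cube a l)) ≤ apConst r₀ w := by
      rw [apConst, if_pos h1.symm]
      exact le_iSup_of_le a <| le_iSup_of_le l <| le_iSup_of_le hl le_rfl
    refine le_trans (mul_le_mul_right ?_ _) hap
    set E := essSup (fun x => (W x)⁻¹) (volume.restrict (cube a l)) with hE
    have hle : ∫⁻ x in cube a l, W x ^ (-(1 / (r - 1))) ≤
        E ^ (1 / (r - 1)) * volume (cube a l) := by
      rw [← setLIntegral_const]
      refine lintegral_mono_ae ?_
      filter_upwards [ae_le_essSup (μ := volume.restrict (cube a l)) (f := fun x => (W x)⁻¹)]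
        with x hx
      rw [ENNReal.rpow_neg, ← ENNReal.inv_rpow]
      exact ENNReal.rpow_le_rpow hx (by positivity)
    calc _ ≤ (E ^ (1 / (r - 1))) ^ (r - 1) := by
          gcongr
          exact ENNReal.div_le_of_le_mul hle
      _ = E := by rw [← ENNReal.rpow_mul, one_div_mul_cancel hr1.ne', ENNReal.rpow_one]
  · have hap : (∫⁻ x in cube a l, W x) / volume (cube a l) *
        ((∫⁻ x in cube a l, W x ^ (-(1 / (r₀ - 1)))) / volume (cube a l)) ^ (r₀ - 1) ≤
          apConst r₀ w := by
      rw [apConst, if_neg h1.ne']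
      exact le_iSup_of_le a <| le_iSup_of_le l <| le_iSup_of_le hl le_rfl
    refine le_trans (mul_le_mul_right ?_ _) hap
    have hr01 : 0 < r₀ - 1 := by linarith
    set θ := (r₀ - 1) / (r - 1) with hθ
    have hθ0 : 0 ≤ θ := by positivity
    have hθ1 : θ ≤ 1 := (div_le_one hr1).2 (by linarith)
    have hJ := lintegral_rpow_le_rpow_lintegral (hm.pow_const (-(1 / (r₀ - 1)))) hθ0 hθ1
    have hexp : -(1 / (r₀ - 1)) * θ = -(1 / (r - 1)) := by rw [hθ]; field_simp
    simp only [← ENNReal.rpow_mul, hexp, Measure.restrict_apply_univ] at hJ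
    calc _ ≤ ((∫⁻ x in cube a l, W x ^ (-(1 / (r₀ - 1)))) ^ θ *
          volume (cube a l) ^ (1 - θ) / volume (cube a l)) ^ (r - 1) := by gcongr
      _ = (((∫⁻ x in cube a l, W x ^ (-(1 / (r₀ - 1)))) / volume (cube a l)) ^ θ) ^ (r - 1) := by
        congr 1
        rw [ENNReal.div_rpow_of_nonneg _ _ hθ0, sub_eq_add_neg 1 θ, ENNReal.rpow_add _ _ hv0 hvt,
          ENNReal.rpow_one, ENNReal.rpow_neg, mul_div_assoc, mul_comm (volume (cube a l)),
          ENNReal.mul_div_cancel_right hv0 hvt, ← div_eq_mul_inv]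
      _ = _ := by
        rw [← ENNReal.rpow_mul, hθ, div_mul_cancel₀ _ hr1.ne']

/-- A Muckenhoupt weight either vanishes almost everywhere, or agrees almost everywhere with a
measurable function with values in `(0, ∞)`. -/
theorem IsApWeight.ae_eq_zero_or_exists {p : ℝ} {w : Rn n → ℝ} (hw : IsApWeight p w)
    (hp : 1 ≤ p) :
    (∀ᵐ x, ENNReal.ofReal (w x) = 0) ∨ ∃ V : Rn n → ℝ≥0∞, Measurable V ∧ (∀ x, V x ≠ 0) ∧
      (∀ x, V x ≠ ⊤) ∧ V =ᵐ[volume] fun x => ENNReal.ofReal (w x) := by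
  set W := fun x => ENNReal.ofReal (w x) with hW
  have hm : AEMeasurable W volume := hw.aemeasurable
  rw [or_iff_not_imp_left]
  intro hnz
  have hpos : ∀ᵐ x, W x ≠ 0 := by
    by_contra hpos
    -- a large cube on which `W` has positive integral and vanishes on a set of positive measure
    set Q : ℕ → Set (Rn n) := fun N => centeredCube 0 (N + 1 : ℝ) with hQ
    have hQm : ∀ N, MeasurableSet (Q N) := fun N => measurableSet_cube _ _
    have hmono : Monotone Q := by
      intro N M h x hx i
      have h' : (N : ℝ) ≤ M := by exact_mod_cast h
      have := hx i
      simp only [PiLp.sub_apply, PiLp.zero_apply] at this ⊢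
      constructor <;> linarith [this.1, this.2]
    have hun : ⋃ N, Q N = univ := by
      refine eq_univ_of_forall fun x => ?_
      obtain ⟨N, hN⟩ := exists_nat_gt ‖x‖
      refine mem_iUnion.2 ⟨N, ball_subset_centeredCube _ _ ?_⟩
      simp only [Metric.mem_ball, dist_zero_right]
      linarith
    have hex : ∀ s : Set (Rn n), volume s ≠ 0 → ∃ N, volume (s ∩ Q N) ≠ 0 := by
      intro s hs
      by_contra! hcon
      refine hs ?_
      rw [← inter_univ s, ← hun, inter_iUnion]
      exact measure_iUnion_null hcon
    obtain ⟨N, hN⟩ := hex {x | ¬ W x ≠ 0} hpos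
    obtain ⟨M, hM⟩ := hex {x | ¬ W x = 0} hnz
    set K := max N M
    have hc := hw.cube_le hp (r := p + 1) (by linarith) (by linarith)
      (0 - WithLp.toLp 2 fun _ => ((K : ℝ) + 1)) (l := 2 * ((K : ℝ) + 1)) (by positivity)
    change (∫⁻ x in Q K, W x) * (∫⁻ x in Q K, W x ^ (-(1 / (p + 1 - 1)))) ^ (p + 1 - 1) ≤
      apConst p w * volume (Q K) ^ (p + 1) at hc
    have hlt : apConst p w * volume (Q K) ^ (p + 1) ≠ ⊤ :=
      ENNReal.mul_ne_top hw.apConst_lt_top.ne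
        (ENNReal.rpow_ne_top_of_nonneg (by linarith) (volume_cube_ne_top _ _))
    refine hlt (top_le_iff.1 (le_trans (le_of_eq ?_) hc))
    have h1 : ∫⁻ x in Q K, W x ≠ 0 := by
      rw [Ne, lintegral_eq_zero_iff' hm.restrict]
      intro h0
      refine hM (measure_mono_null (inter_subset_inter_right _ (hmono (le_max_right N M))) ?_)
      rw [Filter.EventuallyEq, ae_restrict_iff' (hQm _)] at h0
      refine measure_mono_null ?_ h0
      rintro x ⟨hx, hxQ⟩ hx'
      exact hx (hx' hxQ)
    have h2 : ∫⁻ x in Q K, W x ^ (-(1 / (p + 1 - 1))) = ⊤ := by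
      have hm' := (hm.pow_const (-(1 / (p + 1 - 1)))).restrict (s := Q K)
      by_contra hne
      have := ae_lt_top' hm' hne
      refine hN (measure_mono_null (inter_subset_inter_right _ (hmono (le_max_left N M))) ?_)
      rw [ae_restrict_iff' (hQm _)] at this
      refine measure_mono_null ?_ this
      rintro x ⟨hx, hxQ⟩ hx'
      have hx0 : W x = 0 := not_not.1 hx
      have := hx' hxQ
      rw [hx0, ENNReal.zero_rpow_of_neg (by
        rw [neg_lt_zero, add_sub_cancel_right]; positivity)] at this
      exact lt_irrefl _ this
    rw [h2, ENNReal.top_rpow_of_pos (by linarith), ENNReal.mul_top h1]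
  set U := hm.mk W with hU
  have hUm : Measurable U := hm.measurable_mk
  have hS : MeasurableSet {x | U x = 0 ∨ U x = ⊤} :=
    (hUm (measurableSet_singleton 0)).union (hUm (measurableSet_singleton ⊤))
  classical
  refine ⟨fun x => if U x = 0 ∨ U x = ⊤ then 1 else U x,
    Measurable.ite hS measurable_const hUm, fun x => ?_, fun x => ?_, ?_⟩
  · dsimp only
    split_ifs with h
    · simp
    · exact fun h0 => h (Or.inl h0)
  · dsimp only
    split_ifs with h
    · simp
    · exact fun h0 => h (Or.inr h0)
  · filter_upwards [hm.ae_eq_mk, hpos] with x hx hx0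
    rw [if_neg]
    · exact hx.symm
    · rw [← hU] at hx
      rw [← hx]
      simpa [hW] using hx0

theorem IsApWeight.exists_ballAp {r₀ r : ℝ} {w : Rn n → ℝ} (hw : IsApWeight r₀ w) (h1 : 1 ≤ r₀)
    (hrr : r₀ ≤ r) (hr : 1 < r) {V : Rn n → ℝ≥0∞}
    (hVw : V =ᵐ[volume] fun x => ENNReal.ofReal (w x)) :
    ∃ C : ℝ≥0∞, C ≠ ⊤ ∧ BallAp r C V := by
  refine ⟨apConst r₀ w * cubeRatio n ^ r, ENNReal.mul_ne_top hw.apConst_lt_top.ne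
    (ENNReal.rpow_ne_top_of_nonneg (by linarith) (cubeRatio_ne_top n)), fun c t ht => ?_⟩
  have h := hw.cube_le h1 hrr hr (c - WithLp.toLp 2 fun _ => t) (l := 2 * t) (by positivity)
  rw [volume_centeredCube c ht, ENNReal.mul_rpow_of_nonneg _ _ (by linarith), ← mul_assoc] at h
  refine le_trans ?_ h
  have hsub := ball_subset_centeredCube c t
  rw [lintegral_congr_ae (ae_restrict_of_ae hVw)]
  have h2 : ∫⁻ x in Metric.ball c t, V x ^ (-(1 / (r - 1))) =
      ∫⁻ x in Metric.ball c t, ENNReal.ofReal (w x) ^ (-(1 / (r - 1))) := by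
    refine lintegral_congr_ae (ae_restrict_of_ae ?_)
    filter_upwards [hVw] with x hx
    rw [hx]
  rw [h2]
  gcongr

/-- The `A_1` condition in terms of the values at the centres of balls. Only countably many cubes
are used for a given radius, so that the exceptional sets remain null. -/
theorem IsApWeight.exists_ball_le {w : Rn n → ℝ} (hw : IsApWeight 1 w) {V : Rn n → ℝ≥0∞}
    (hV0 : ∀ x, V x ≠ 0) (hVt : ∀ x, V x ≠ ⊤)
    (hVw : V =ᵐ[volume] fun x => ENNReal.ofReal (w x)) :
    ∃ C : ℝ≥0∞, C ≠ ⊤ ∧ ∀ t : ℝ, 0 < t → ∀ᵐ z : Rn n,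
      ∫⁻ x in Metric.ball z t, V x ≤ C * volume (Metric.ball z t) * V z := by
  refine ⟨apConst 1 w * (2 ^ n * cubeRatio n), ENNReal.mul_ne_top hw.apConst_lt_top.ne
    (ENNReal.mul_ne_top (by simp) (cubeRatio_ne_top n)), fun t ht => ?_⟩
  have hcube : ∀ j : ℕ, ∀ᵐ z : Rn n, z ∈ cube (TopologicalSpace.denseSeq (Rn n) j) (4 * t) →
      ∫⁻ x in cube (TopologicalSpace.denseSeq (Rn n) j) (4 * t), V x ≤
        apConst 1 w * volume (cube (TopologicalSpace.denseSeq (Rn n) j) (4 * t)) * V z := by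
    intro j
    set Q := cube (TopologicalSpace.denseSeq (Rn n) j) (4 * t) with hQ
    have hap : (∫⁻ x in Q, ENNReal.ofReal (w x)) / volume Q *
        essSup (fun x => (ENNReal.ofReal (w x))⁻¹) (volume.restrict Q) ≤ apConst 1 w := by
      rw [apConst, if_pos rfl]
      exact le_iSup_of_le _ <| le_iSup_of_le (4 * t) <| le_iSup_of_le (by positivity) le_rfl
    rw [← lintegral_congr_ae (ae_restrict_of_ae hVw)] at hap
    have hess := ae_le_essSup (μ := volume.restrict Q) (f := fun x => (ENNReal.ofReal (w x))⁻¹)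
    rw [ae_restrict_iff' (measurableSet_cube _ _)] at hess
    filter_upwards [hess, hVw] with z hz hzw hzQ
    have h1 := (mul_le_mul_right (hz hzQ) _).trans hap
    rw [← hzw, ← div_eq_mul_inv, ENNReal.div_le_iff (hV0 z) (hVt z), ENNReal.div_le_iff
      (volume_cube_ne_zero _ (by positivity)) (volume_cube_ne_top _ _)] at h1
    rwa [mul_right_comm]
  filter_upwards [ae_all_iff.2 hcube] with z hz
  obtain ⟨j, hj⟩ := (TopologicalSpace.denseRange_denseSeq (Rn n)).exists_dist_lt
    (z - WithLp.toLp 2 fun _ => 2 * t) ht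
  set a := TopologicalSpace.denseSeq (Rn n) j with ha
  have hcoord : ∀ i, t < z i - a i ∧ z i - a i < 3 * t := by
    intro i
    rw [dist_eq_norm] at hj
    have h := (PiLp.norm_apply_le (z - (WithLp.toLp 2 fun _ => 2 * t) - a) i).trans_lt hj
    simp only [PiLp.sub_apply, Real.norm_eq_abs, abs_lt] at h
    constructor <;> linarith [h.1, h.2]
  have hsub : Metric.ball z t ⊆ cube a (4 * t) := by
    intro x hx i
    have h := ball_subset_centeredCube z t hx i
    simp only [PiLp.sub_apply] at h
    have := hcoord i
    constructor <;> linarith [h.1, h.2]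
  have hvol : volume (cube a (4 * t)) = 2 ^ n * cubeRatio n * volume (Metric.ball z t) := by
    rw [mul_assoc, ← volume_centeredCube z ht, volume_cube, volume_cube,
      show 4 * t = 2 * (2 * t) by ring, ENNReal.ofReal_mul (by norm_num), mul_pow]
    simp
  calc ∫⁻ x in Metric.ball z t, V x ≤ ∫⁻ x in cube a (4 * t), V x := lintegral_mono_set hsub
    _ ≤ _ := hz j (hsub (Metric.mem_ball_self ht))
    _ = _ := by rw [hvol]; ring

/-! ### Averages over balls and the truncated potential -/

/-- The average of `g` over the ball of radius `t` about `y`. -/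
noncomputable def ballAvg (t : ℝ) (g : Rn n → ℝ≥0∞) (y : Rn n) : ℝ≥0∞ :=
  (∫⁻ z in Metric.ball y t, g z) / volume (Metric.ball y t)

/-- The averages of `g` over the balls about `y` of radius less than `Λ`, integrated with the weight
`τ ^ (k - 1)`. For `k < n` and up to constants this is `Λ ^ (-k)` times the Riesz potential of order
`k` of `g`, truncated at scale `Λ`. -/
noncomputable def potential (k : ℕ) (Λ : ℝ) (g : Rn n → ℝ≥0∞) (y : Rn n) : ℝ≥0∞ :=
  ∫⁻ τ in Ioo (0 : ℝ) 1, ENNReal.ofReal (τ ^ (k - 1)) * ballAvg (τ * Λ) g y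

theorem measurable_setLIntegral_ball {g : Rn n → ℝ≥0∞} (hg : Measurable g) :
    Measurable fun p : ℝ × Rn n => ∫⁻ z in Metric.ball p.2 p.1, g z := by
  have hS : MeasurableSet {a : (ℝ × Rn n) × Rn n | dist a.2 a.1.2 < a.1.1} :=
    measurableSet_lt (by fun_prop) (by fun_prop)
  have hm : Measurable ({a : (ℝ × Rn n) × Rn n | dist a.2 a.1.2 < a.1.1}.indicator
      fun a => g a.2) := (hg.comp measurable_snd).indicator hS
  have := hm.lintegral_prod_right' (ν := volume)
  refine (congrArg Measurable (funext fun p => ?_)).mp this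
  rw [← lintegral_indicator Metric.isOpen_ball.measurableSet]
  rfl

theorem measurable_ballAvg {g : Rn n → ℝ≥0∞} (hg : Measurable g) :
    Measurable fun p : ℝ × Rn n => ballAvg p.1 g p.2 := by
  refine (measurable_setLIntegral_ball hg).div ?_
  simpa using measurable_setLIntegral_ball (n := n) (g := fun _ => 1) measurable_const

theorem measurable_ballAvg_comp {X : Type*} [MeasurableSpace X] {g : Rn n → ℝ≥0∞}
    (hg : Measurable g) {t : X → ℝ} {y : X → Rn n} (ht : Measurable t) (hy : Measurable y) :
    Measurable fun x => ballAvg (t x) g (y x) := by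
  have h := (measurable_ballAvg hg).comp (ht.prodMk hy)
  exact h

theorem measurable_ballAvg_right {g : Rn n → ℝ≥0∞} (hg : Measurable g) (t : ℝ) :
    Measurable (ballAvg t g) :=
  measurable_ballAvg_comp hg measurable_const measurable_id

theorem measurable_potential_integrand {g : Rn n → ℝ≥0∞} (hg : Measurable g) (k : ℕ) (Λ : ℝ) :
    Measurable fun p : Rn n × ℝ => ENNReal.ofReal (p.2 ^ (k - 1)) * ballAvg (p.2 * Λ) g p.1 := by
  have h2 : Measurable fun p : Rn n × ℝ => ENNReal.ofReal (p.2 ^ (k - 1)) := by fun_prop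
  exact h2.mul (measurable_ballAvg_comp hg (measurable_snd.mul_const Λ) measurable_fst)

theorem measurable_potential_integrand_left {g : Rn n → ℝ≥0∞} (hg : Measurable g) (k : ℕ) (Λ : ℝ)
    (y : Rn n) : Measurable fun τ : ℝ => ENNReal.ofReal (τ ^ (k - 1)) * ballAvg (τ * Λ) g y := by
  have h2 : Measurable fun τ : ℝ => ENNReal.ofReal (τ ^ (k - 1)) := by fun_prop
  exact h2.mul (measurable_ballAvg_comp hg (measurable_id.mul_const Λ) measurable_const)

theorem measurable_potential {g : Rn n → ℝ≥0∞} (hg : Measurable g) (k : ℕ) (Λ : ℝ) :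
    Measurable (potential k Λ g) :=
  (measurable_potential_integrand hg k Λ).lintegral_prod_right' (ν := volume.restrict (Ioo 0 1))

theorem ballAvg_mono {g g' : Rn n → ℝ≥0∞} (h : ∀ x, g x ≤ g' x) (t : ℝ) (y : Rn n) :
    ballAvg t g y ≤ ballAvg t g' y :=
  ENNReal.div_le_div_right (lintegral_mono h) _

theorem potential_mono {g g' : Rn n → ℝ≥0∞} (h : ∀ x, g x ≤ g' x) (k : ℕ) (Λ : ℝ) (y : Rn n) :
    potential k Λ g y ≤ potential k Λ g' y :=
  lintegral_mono fun _ => mul_le_mul_right (ballAvg_mono h _ _) _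

theorem ballAvg_le_maxFun (g : Rn n → ℝ≥0∞) {t T : ℝ} (ht : 0 < t) (htT : t ≤ T) (y : Rn n) :
    ballAvg t g y ≤ maxFun volume T g y :=
  le_maxFun _ _ ht htT (Metric.mem_ball_self ht)

theorem ballAvg_rpow_le {g : Rn n → ℝ≥0∞} (hg : Measurable g) {u : ℝ} (hu : 1 ≤ u) {t : ℝ}
    (ht : 0 < t) (y : Rn n) : ballAvg t g y ^ u ≤ ballAvg t (fun z => g z ^ u) y := by
  have hu0 : 0 < u := by linarith
  have hv0 := volume_ball_ne_zero y ht
  have hvt := volume_ball_ne_top y t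
  have h := rpow_lintegral_le_lintegral_rpow (μ := volume.restrict (Metric.ball y t))
    hg.aemeasurable hu
  rw [Measure.restrict_apply_univ] at h
  rw [ballAvg, ballAvg, ENNReal.div_rpow_of_nonneg _ _ hu0.le]
  refine ENNReal.div_le_of_le_mul (h.trans_eq ?_)
  have h2 : volume (Metric.ball y t) ^ u =
      volume (Metric.ball y t) * volume (Metric.ball y t) ^ (u - 1) := by
    conv_rhs => rw [← ENNReal.rpow_one (volume (Metric.ball y t)), ← ENNReal.rpow_mul, one_mul,
      ← ENNReal.rpow_add _ _ hv0 hvt, add_sub_cancel]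
  rw [h2, ← mul_assoc, ENNReal.div_mul_cancel hv0 hvt, mul_comm]

theorem lintegral_pow_Ioo_le_one (k : ℕ) :
    ∫⁻ τ in Ioo (0 : ℝ) 1, ENNReal.ofReal (τ ^ (k - 1)) ≤ 1 := by
  calc _ ≤ ∫⁻ _ in Ioo (0 : ℝ) 1, 1 := by
        refine setLIntegral_mono' measurableSet_Ioo fun τ hτ => ?_
        rw [ENNReal.ofReal_le_one]
        exact pow_le_one₀ hτ.1.le hτ.2.le
    _ = 1 := by simp

theorem potential_le_of_forall_le {k : ℕ} {Λ : ℝ} {g : Rn n → ℝ≥0∞} {y : Rn n} {b : ℝ≥0∞}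
    (h : ∀ τ : ℝ, 0 < τ → τ < 1 → ballAvg (τ * Λ) g y ≤ b) : potential k Λ g y ≤ b := by
  calc _ ≤ ∫⁻ τ in Ioo (0 : ℝ) 1, ENNReal.ofReal (τ ^ (k - 1)) * b :=
        setLIntegral_mono' measurableSet_Ioo fun τ hτ => mul_le_mul_right (h τ hτ.1 hτ.2) _
    _ = (∫⁻ τ in Ioo (0 : ℝ) 1, ENNReal.ofReal (τ ^ (k - 1))) * b :=
        lintegral_mul_const _ (by fun_prop)
    _ ≤ b := mul_le_of_le_one_left' (lintegral_pow_Ioo_le_one k)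

theorem potential_rpow_le_maxFun (k : ℕ) {Λ : ℝ} (hΛ : 0 < Λ) {g : Rn n → ℝ≥0∞}
    (hg : Measurable g) {u : ℝ} (hu : 1 ≤ u) {T : ℝ} (hT : Λ ≤ T) (y : Rn n) :
    potential k Λ g y ^ u ≤ maxFun volume T (fun z => g z ^ u) y := by
  have hu0 : 0 < u := by linarith
  suffices h : potential k Λ g y ≤ maxFun volume T (fun z => g z ^ u) y ^ (1 / u) by
    refine (ENNReal.rpow_le_rpow h hu0.le).trans_eq ?_
    rw [← ENNReal.rpow_mul, one_div_mul_cancel hu0.ne', ENNReal.rpow_one]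
  refine potential_le_of_forall_le fun τ h0 h1 => ?_
  rw [one_div, ENNReal.le_rpow_inv_iff hu0]
  exact (ballAvg_rpow_le hg hu (by positivity) y).trans
    (ballAvg_le_maxFun _ (by positivity) (by nlinarith) y)

/-- By Tonelli's theorem, averaging over balls of a fixed radius is bounded on the weighted space
`L^1` for `A_1` weights. -/
theorem lintegral_ballAvg_mul_le {g V : Rn n → ℝ≥0∞} (hg : Measurable g) (hV : Measurable V)
    {C : ℝ≥0∞} {t : ℝ} (ht : 0 < t)
    (h : ∀ᵐ z : Rn n, ∫⁻ x in Metric.ball z t, V x ≤ C * volume (Metric.ball z t) * V z) :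
    ∫⁻ x, ballAvg t g x * V x ≤ C * ∫⁻ x, g x * V x := by
  set v := volume (Metric.ball (0 : Rn n) t) with hv
  have hvc : ∀ y : Rn n, volume (Metric.ball y t) = v := fun y => by
    rw [hv, volume_ball_eq y ht, volume_ball_eq 0 ht]
  have hv0 : v ≠ 0 := volume_ball_ne_zero _ ht
  have hvt : v ≠ ⊤ := volume_ball_ne_top _ _
  have hS : MeasurableSet {a : Rn n × Rn n | dist a.1 a.2 < t} :=
    measurableSet_lt (by fun_prop) measurable_const
  set F : Rn n → Rn n → ℝ≥0∞ := fun x z =>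
    {a : Rn n × Rn n | dist a.1 a.2 < t}.indicator (fun a => g a.2 * V a.1) (x, z) with hF
  have hFm : Measurable (Function.uncurry F) :=
    ((hg.comp measurable_snd).mul (hV.comp measurable_fst)).indicator hS
  have h1 : ∀ x, ballAvg t g x * V x = (∫⁻ z, F x z) * v⁻¹ := by
    intro x
    have : ∫⁻ z, F x z = (∫⁻ z in Metric.ball x t, g z) * V x := by
      rw [← lintegral_mul_const _ hg, ← lintegral_indicator Metric.isOpen_ball.measurableSet]
      refine lintegral_congr fun z => ?_
      simp only [hF, indicator, Metric.mem_ball, mem_ofPred_eq, dist_comm x z]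
    rw [this, ballAvg, hvc, div_eq_mul_inv, mul_right_comm]
  have h2 : ∀ z, ∫⁻ x, F x z = g z * ∫⁻ x in Metric.ball z t, V x := by
    intro z
    rw [← lintegral_const_mul _ hV, ← lintegral_indicator Metric.isOpen_ball.measurableSet]
    refine lintegral_congr fun x => ?_
    simp only [hF, indicator, Metric.mem_ball, mem_ofPred_eq]
  calc ∫⁻ x, ballAvg t g x * V x = (∫⁻ x, ∫⁻ z, F x z) * v⁻¹ := by
        simp only [h1]
        rw [lintegral_mul_const' _ _ (ENNReal.inv_ne_top.2 hv0)]
    _ = (∫⁻ z, ∫⁻ x, F x z) * v⁻¹ := by rw [lintegral_lintegral_swap hFm.aemeasurable]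
    _ ≤ (∫⁻ z, (C * v) * (g z * V z)) * v⁻¹ := by
        gcongr ?_ * _
        refine lintegral_mono_ae ?_
        filter_upwards [h] with z hz
        rw [h2, ← hvc z]
        calc _ ≤ g z * (C * volume (Metric.ball z t) * V z) := by gcongr
          _ = _ := by ring
    _ = C * ∫⁻ x, g x * V x := by
        rw [lintegral_const_mul _ (f := fun x => g x * V x) (hg.mul hV), mul_right_comm,
          mul_assoc C,
          ENNReal.mul_inv_cancel hv0 hvt, mul_one]

theorem setLIntegral_ballAvg_le {g : Rn n → ℝ≥0∞} (hg : Measurable g) {t Λ : ℝ} (ht : 0 < t)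
    (htΛ : t ≤ Λ) (x : Rn n) :
    ∫⁻ y in Metric.ball x Λ, ballAvg t g y ≤ ∫⁻ y in Metric.ball x (2 * Λ), g y := by
  have hm : MeasurableSet (Metric.ball x (2 * Λ)) := Metric.isOpen_ball.measurableSet
  have h := lintegral_ballAvg_mul_le (hg.indicator hm) (V := fun _ => 1) measurable_const
    (C := 1) ht (Filter.Eventually.of_forall fun z => by simp)
  simp only [mul_one, one_mul] at h
  rw [lintegral_indicator hm] at h
  refine le_trans ?_ h
  rw [← lintegral_indicator Metric.isOpen_ball.measurableSet]
  refine lintegral_mono fun y => ?_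
  by_cases hy : y ∈ Metric.ball x Λ
  · rw [indicator_of_mem hy, ballAvg, ballAvg]
    refine ENNReal.div_le_div_right (le_of_eq ?_) _
    refine setLIntegral_congr_fun Metric.isOpen_ball.measurableSet fun z hz => ?_
    rw [indicator_of_mem]
    rw [Metric.mem_ball] at *
    linarith [dist_triangle z y x]
  · rw [indicator_of_notMem hy]
    exact zero_le

theorem lintegral_potential_mul_le {g V : Rn n → ℝ≥0∞} (hg : Measurable g) (hV : Measurable V)
    {C : ℝ≥0∞} (h : ∀ t : ℝ, 0 < t → ∀ᵐ z : Rn n,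
      ∫⁻ x in Metric.ball z t, V x ≤ C * volume (Metric.ball z t) * V z)
    (k : ℕ) {Λ : ℝ} (hΛ : 0 < Λ) :
    ∫⁻ x, potential k Λ g x * V x ≤ C * ∫⁻ x, g x * V x := by
  have hm := measurable_potential_integrand hg k Λ
  calc ∫⁻ x, potential k Λ g x * V x
      = ∫⁻ x, ∫⁻ τ in Ioo (0 : ℝ) 1,
          ENNReal.ofReal (τ ^ (k - 1)) * ballAvg (τ * Λ) g x * V x := by
        refine lintegral_congr fun x => ?_
        rw [potential, lintegral_mul_const _ (measurable_potential_integrand_left hg k Λ x)]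
    _ = ∫⁻ τ in Ioo (0 : ℝ) 1, ∫⁻ x,
          ENNReal.ofReal (τ ^ (k - 1)) * ballAvg (τ * Λ) g x * V x :=
        lintegral_lintegral_swap (hm.mul (hV.comp measurable_fst)).aemeasurable
    _ ≤ ∫⁻ τ in Ioo (0 : ℝ) 1, ENNReal.ofReal (τ ^ (k - 1)) * (C * ∫⁻ x, g x * V x) := by
        refine setLIntegral_mono' measurableSet_Ioo fun τ hτ => ?_
        simp only [mul_assoc]
        rw [lintegral_const_mul' _ _ ENNReal.ofReal_ne_top]
        have : 0 < τ * Λ := mul_pos hτ.1 hΛ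
        exact mul_le_mul_right (lintegral_ballAvg_mul_le hg hV this (h _ this)) _
    _ ≤ C * ∫⁻ x, g x * V x := by
        rw [lintegral_mul_const _ (by fun_prop)]
        exact mul_le_of_le_one_left' (lintegral_pow_Ioo_le_one k)

/-- The truncated potential is bounded on `L^1` with respect to Lebesgue measure. -/
theorem lintegral_potential_le {g : Rn n → ℝ≥0∞} (hg : Measurable g) (k : ℕ) {Λ : ℝ}
    (hΛ : 0 < Λ) : ∫⁻ x, potential k Λ g x ≤ ∫⁻ x, g x := by
  simpa using lintegral_potential_mul_le hg (V := fun _ => 1) measurable_const (C := 1)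
    (fun t _ => Filter.Eventually.of_forall fun z => by simp) k hΛ

theorem lintegral_rpow_sub_one_Ioo {δ : ℝ} (hδ : 0 < δ) :
    ∫⁻ τ in Ioo (0 : ℝ) 1, ENNReal.ofReal (τ ^ (δ - 1)) = ENNReal.ofReal (1 / δ) := by
  rw [← ofReal_integral_eq_lintegral_ofReal]
  · rw [← integral_Ioc_eq_integral_Ioo, ← intervalIntegral.integral_of_le zero_le_one,
      integral_rpow (Or.inl (by linarith))]
    simp [Real.zero_rpow hδ.ne']
  · exact (intervalIntegral.intervalIntegrable_rpow' (by linarith)).1.mono_set Ioo_subset_Ioc_self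
  · filter_upwards [self_mem_ae_restrict measurableSet_Ioo] with t ht
    exact Real.rpow_nonneg ht.1.le _

/-- The average of `(ballAvg (τ Λ) g) ^ q` over a ball of radius `Λ`: interpolation between the
`L^u` bound, which is uniform in `τ`, and the `L^∞` bound. -/
theorem setLIntegral_ballAvg_rpow_le {g : Rn n → ℝ≥0∞} (hg : Measurable g) {u q : ℝ}
    (hu : 1 ≤ u) (huq : u ≤ q) {Λ τ : ℝ} (hΛ : 0 < Λ) (h0 : 0 < τ) (h1 : τ < 1) (x : Rn n) :
    ∫⁻ y in Metric.ball x Λ, ballAvg (τ * Λ) g y ^ q ≤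
      ENNReal.ofReal (τ ^ (-(n : ℝ) * (q / u - 1))) * (volume (Metric.ball x Λ) *
        ((∫⁻ y in Metric.ball x (2 * Λ), g y ^ u) / volume (Metric.ball x Λ)) ^ (q / u)) := by
  have hu0 : 0 < u := by linarith
  have hqu : 0 ≤ q / u - 1 := sub_nonneg.2 ((one_le_div hu0).2 huq)
  have ht : 0 < τ * Λ := mul_pos h0 hΛ
  set v := volume (Metric.ball x Λ) with hv
  have hv0 : v ≠ 0 := volume_ball_ne_zero _ hΛ
  have hvt : v ≠ ⊤ := volume_ball_ne_top _ _
  set I := ∫⁻ y in Metric.ball x (2 * Λ), g y ^ u with hI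
  have hgu : Measurable fun y => g y ^ u := hg.pow_const u
  have hpt : ∀ y ∈ Metric.ball x Λ, ballAvg (τ * Λ) g y ^ q ≤
      (ENNReal.ofReal (τ ^ (-(n : ℝ))) * (I / v)) ^ (q / u - 1) *
        ballAvg (τ * Λ) (fun z => g z ^ u) y := by
    intro y hy
    set E := ballAvg (τ * Λ) (fun z => g z ^ u) y with hE
    have hEle : E ≤ ENNReal.ofReal (τ ^ (-(n : ℝ))) * (I / v) := by
      rw [hE, ballAvg, volume_ball_mul y x h0 hΛ, ← hv]
      have hsub : Metric.ball y (τ * Λ) ⊆ Metric.ball x (2 * Λ) := by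
        refine Metric.ball_subset_ball' ?_
        have := Metric.mem_ball.1 hy
        nlinarith
      calc _ ≤ I / (ENNReal.ofReal τ ^ n * v) :=
            ENNReal.div_le_div_right (lintegral_mono_set hsub) _
        _ = _ := by
          rw [Real.rpow_neg h0.le, Real.rpow_natCast, ENNReal.ofReal_inv_of_pos (by positivity),
            ENNReal.ofReal_pow h0.le, div_eq_mul_inv, ENNReal.mul_inv (Or.inr hvt) (Or.inr hv0),
            div_eq_mul_inv]
          ring
    calc ballAvg (τ * Λ) g y ^ q = (ballAvg (τ * Λ) g y ^ u) ^ (q / u) := by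
          rw [← ENNReal.rpow_mul, mul_div_cancel₀ _ hu0.ne']
      _ ≤ E ^ (q / u) := ENNReal.rpow_le_rpow (ballAvg_rpow_le hg hu ht y) (by linarith)
      _ = E ^ (q / u - 1) * E := by
          conv_lhs => rw [← sub_add_cancel (q / u) 1, ENNReal.rpow_add_of_nonneg _ _ hqu
            zero_le_one, ENNReal.rpow_one]
      _ ≤ _ := by gcongr
  calc _ ≤ ∫⁻ y in Metric.ball x Λ, (ENNReal.ofReal (τ ^ (-(n : ℝ))) * (I / v)) ^ (q / u - 1) *
        ballAvg (τ * Λ) (fun z => g z ^ u) y :=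
        setLIntegral_mono' Metric.isOpen_ball.measurableSet hpt
    _ ≤ (ENNReal.ofReal (τ ^ (-(n : ℝ))) * (I / v)) ^ (q / u - 1) * I := by
        rw [lintegral_const_mul _ (measurable_ballAvg_right hgu _)]
        exact mul_le_mul_right (setLIntegral_ballAvg_le hgu ht (by nlinarith) x) _
    _ = _ := by
        rw [ENNReal.mul_rpow_of_nonneg _ _ hqu,
          ENNReal.ofReal_rpow_of_nonneg (by positivity) hqu, ← Real.rpow_mul h0.le, mul_assoc]
        congr 1
        conv_rhs => rw [← sub_add_cancel (q / u) 1, ENNReal.rpow_add_of_nonneg _ _ hqu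
            zero_le_one, ENNReal.rpow_one, mul_left_comm, ENNReal.mul_div_cancel hv0 hvt]

/-- Subcritical Sobolev inequality for the truncated potential. -/
theorem setLIntegral_potential_rpow_le {g : Rn n → ℝ≥0∞} (hg : Measurable g) {k : ℕ}
    (hk : 1 ≤ k) {u q : ℝ} (hu : 1 ≤ u) (huq : u ≤ q) (hδ : 0 < k - n * (1 / u - 1 / q))
    {Λ : ℝ} (hΛ : 0 < Λ) (x : Rn n) :
    ∫⁻ y in Metric.ball x Λ, potential k Λ g y ^ q ≤
      ENNReal.ofReal (1 / (k - n * (1 / u - 1 / q))) ^ q * (volume (Metric.ball x Λ) *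
        (2 ^ n * ballAvg (2 * Λ) (fun z => g z ^ u) x) ^ (q / u)) := by
  have hq : 1 ≤ q := hu.trans huq
  have hq0 : 0 < q := by linarith
  have hu0 : 0 < u := by linarith
  set δ : ℝ := k - n * (1 / u - 1 / q) with hδdef
  set v := volume (Metric.ball x Λ) with hv
  have hv0 : v ≠ 0 := volume_ball_ne_zero _ hΛ
  have hvt : v ≠ ⊤ := volume_ball_ne_top _ _
  set ρ : ℝ → ℝ≥0∞ := fun τ => ENNReal.ofReal (τ ^ (δ - 1)) with hρ
  have hρm : Measurable ρ := by fun_prop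
  set ν : Measure ℝ := (volume.restrict (Ioo 0 1)).withDensity ρ with hν
  have hνu : ν univ = ENNReal.ofReal (1 / δ) := by
    rw [hν, withDensity_apply _ MeasurableSet.univ, Measure.restrict_univ,
      lintegral_rpow_sub_one_Ioo hδ]
  have hAm : Measurable fun p : Rn n × ℝ => ballAvg (p.2 * Λ) g p.1 :=
    measurable_ballAvg_comp hg (measurable_snd.mul_const Λ) measurable_fst
  set F : Rn n → ℝ → ℝ≥0∞ := fun y τ => ENNReal.ofReal (τ ^ ((k : ℝ) - δ)) * ballAvg (τ * Λ) g y
    with hF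
  have hFm : Measurable (Function.uncurry F) := by
    have h2 : Measurable fun p : Rn n × ℝ => ENNReal.ofReal (p.2 ^ ((k : ℝ) - δ)) := by fun_prop
    exact h2.mul hAm
  have hFy : ∀ y, Measurable (F y) := fun y => hFm.of_uncurry_left
  have hpot : ∀ y, potential k Λ g y = ∫⁻ τ, F y τ ∂ν := by
    intro y
    rw [hν, lintegral_withDensity_eq_lintegral_mul _ hρm (hFy y), potential]
    refine setLIntegral_congr_fun measurableSet_Ioo fun τ hτ => ?_
    simp only [Pi.mul_apply, hρ, hF]
    rw [← mul_assoc, ← ENNReal.ofReal_mul (Real.rpow_nonneg hτ.1.le _),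
      ← Real.rpow_add hτ.1, ← Real.rpow_natCast, Nat.cast_sub hk]
    congr 3
    push_cast
    ring
  have hJ : ∀ y, potential k Λ g y ^ q ≤ ENNReal.ofReal (1 / δ) ^ (q - 1) *
      ∫⁻ τ in Ioo (0 : ℝ) 1, ρ τ * F y τ ^ q := by
    intro y
    have := rpow_lintegral_le_lintegral_rpow (μ := ν) (hFy y).aemeasurable hq
    rw [hνu, ← hpot, hν, lintegral_withDensity_eq_lintegral_mul _ hρm ((hFy y).pow_const q)] at this
    exact this
  set I := ∫⁻ y in Metric.ball x (2 * Λ), g y ^ u with hI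
  have hIv : I / v = 2 ^ n * ballAvg (2 * Λ) (fun z => g z ^ u) x := by
    rw [ballAvg, volume_ball_mul x x two_pos hΛ, ← hI, ← hv, div_eq_mul_inv, div_eq_mul_inv,
      ENNReal.mul_inv (Or.inr hvt) (Or.inr hv0), mul_left_comm, ← mul_assoc (2 ^ n : ℝ≥0∞),
      ENNReal.ofReal_ofNat, ENNReal.mul_inv_cancel (by simp) (by simp), one_mul]
  calc ∫⁻ y in Metric.ball x Λ, potential k Λ g y ^ q
      ≤ ∫⁻ y in Metric.ball x Λ, ENNReal.ofReal (1 / δ) ^ (q - 1) *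
          ∫⁻ τ in Ioo (0 : ℝ) 1, ρ τ * F y τ ^ q := lintegral_mono fun y => hJ y
    _ = ENNReal.ofReal (1 / δ) ^ (q - 1) *
          ∫⁻ τ in Ioo (0 : ℝ) 1, ∫⁻ y in Metric.ball x Λ, ρ τ * F y τ ^ q := by
        rw [lintegral_const_mul' _ _ (ENNReal.rpow_ne_top_of_nonneg (by linarith)
          ENNReal.ofReal_ne_top), lintegral_lintegral_swap]
        exact ((hρm.comp measurable_snd).mul (hFm.pow_const q)).aemeasurable
    _ ≤ ENNReal.ofReal (1 / δ) ^ (q - 1) *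
          ∫⁻ τ in Ioo (0 : ℝ) 1, ρ τ * (v * (I / v) ^ (q / u)) := by
        refine mul_le_mul_right (setLIntegral_mono' measurableSet_Ioo fun τ hτ => ?_) _
        rw [lintegral_const_mul' _ _ ENNReal.ofReal_ne_top]
        refine mul_le_mul_right ?_ _
        have h0 : 0 < τ := hτ.1
        simp only [hF]
        calc _ = ENNReal.ofReal (τ ^ ((k : ℝ) - δ)) ^ q *
              ∫⁻ y in Metric.ball x Λ, ballAvg (τ * Λ) g y ^ q := by
              rw [← lintegral_const_mul' _ _ (ENNReal.rpow_ne_top_of_nonneg hq0.le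
                ENNReal.ofReal_ne_top)]
              exact lintegral_congr fun y => ENNReal.mul_rpow_of_nonneg _ _ hq0.le
          _ ≤ _ := mul_le_mul_right
                (setLIntegral_ballAvg_rpow_le hg hu huq hΛ hτ.1 hτ.2 x) _
          _ = v * (I / v) ^ (q / u) := by
              rw [← mul_assoc, ENNReal.ofReal_rpow_of_nonneg (by positivity) hq0.le,
                ← Real.rpow_mul h0.le, ← ENNReal.ofReal_mul (by positivity), ← Real.rpow_add h0]
              have : ((k : ℝ) - δ) * q + -(n : ℝ) * (q / u - 1) = 0 := by
                rw [hδdef]; field_simp; ring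
              rw [this, Real.rpow_zero, ENNReal.ofReal_one, one_mul]
    _ = _ := by
        rw [lintegral_mul_const _ hρm, lintegral_rpow_sub_one_Ioo hδ, hIv, ← mul_assoc]
        congr 1
        conv_rhs => rw [← sub_add_cancel q 1, ENNReal.rpow_add_of_nonneg _ _ (by linarith)
          zero_le_one, ENNReal.rpow_one]

variable {𝕜 : Type*} [RCLike 𝕜]

/-! ### Taylor expansion and differences of smooth functions -/

theorem lintegral_comp_add_smul {H : Rn n → ℝ≥0∞} (hH : Measurable H) (c : Rn n) {τ : ℝ}
    (hτ : 0 < τ) : ∫⁻ z, H (c + τ • z) = (ENNReal.ofReal τ ^ n)⁻¹ * ∫⁻ z, H z := by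
  have h1 : ∫⁻ z, H (c + τ • z) = ∫⁻ z, H (c + z) ∂(Measure.map (τ • ·) volume) := by
    rw [lintegral_map (by fun_prop) (by fun_prop)]
  rw [h1, Measure.map_addHaar_smul _ hτ.ne', lintegral_smul_measure, finrank_euclideanSpace_fin,
    abs_of_pos (by positivity), ENNReal.ofReal_inv_of_pos (by positivity),
    ENNReal.ofReal_pow hτ.le, lintegral_add_left_eq_self, smul_eq_mul]

/-- `F` is a jet: `F (i :: L)` is the `i`-th partial derivative of `F L`, for all words `L`.
Derivatives are indexed by words rather than by multi-indices, which makes the iterated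
directional derivatives free of multinomial coefficients. -/
def IsJet (F : List (Fin n) → Rn n → 𝕜) : Prop :=
  ∀ L x, ∃ F' : Rn n →L[ℝ] 𝕜, HasFDerivAt (F L) F' x ∧ ∀ v : Rn n, F' v = ∑ i, v i • F (i :: L) x

/-- The directional derivatives `(v · ∇)^j` of the entries of a jet. -/
def dirDeriv (F : List (Fin n) → Rn n → 𝕜) (v : Rn n) : ℕ → List (Fin n) → Rn n → 𝕜
  | 0, L, x => F L x
  | j + 1, L, x => ∑ i, v i • dirDeriv F v j (i :: L) x

theorem IsJet.hasDerivAt_dirDeriv {F : List (Fin n) → Rn n → 𝕜} (hF : IsJet F) (y v : Rn n) (j : ℕ)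
    (L : List (Fin n)) (τ : ℝ) :
    HasDerivAt (fun τ : ℝ => dirDeriv F v j L (y - τ • v))
      (-dirDeriv F v (j + 1) L (y - τ • v)) τ := by
  induction j generalizing L with
  | zero =>
    obtain ⟨F', hF', hv⟩ := hF L (y - τ • v)
    have h1 : HasDerivAt (fun τ : ℝ => y - τ • v) (-v) τ := by
      simpa using ((hasDerivAt_id τ).smul_const v).const_sub y
    have := hF'.comp_hasDerivAt τ h1
    rw [map_neg, hv] at this
    exact this
  | succ j ih =>
    have h := HasDerivAt.fun_sum (u := Finset.univ) fun i _ => (ih (i :: L)).const_smul (v i)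
    simp only [smul_neg, Finset.sum_neg_distrib] at h
    exact h

/-- Along an arithmetic progression of directions, directional derivatives of order `j` are
polynomials of degree at most `j` in the index. -/
theorem exists_polynomial_dirDeriv (F : List (Fin n) → Rn n → 𝕜) (a b x : Rn n) (j : ℕ)
    (L : List (Fin n)) :
    ∃ P : Polynomial 𝕜, P.natDegree ≤ j ∧ ∀ m : ℕ,
      dirDeriv F (a + (m : ℝ) • b) j L x = P.eval (m : 𝕜) := by
  induction j generalizing L with
  | zero => exact ⟨Polynomial.C (F L x), by simp, fun m => by simp [dirDeriv]⟩
  | succ j ih =>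
    choose P hP hPe using ih
    refine ⟨∑ i, (Polynomial.C ((a i : ℝ) : 𝕜) + Polynomial.C ((b i : ℝ) : 𝕜) * Polynomial.X) *
      P (i :: L), Polynomial.natDegree_sum_le_of_forall_le _ _ fun i _ => ?_, fun m => ?_⟩
    · refine Polynomial.natDegree_mul_le.trans ?_
      have : (Polynomial.C ((a i : ℝ) : 𝕜) +
          Polynomial.C ((b i : ℝ) : 𝕜) * Polynomial.X).natDegree ≤ 1 := by
        rw [add_comm]
        exact Polynomial.natDegree_linear_le
      have := hP (i :: L)
      omega
    · simp only [dirDeriv, Polynomial.eval_finsetSum]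
      refine Finset.sum_congr rfl fun i _ => ?_
      rw [hPe, Polynomial.eval_mul, RCLike.real_smul_eq_coe_mul]
      simp only [Polynomial.eval_add, Polynomial.eval_mul, Polynomial.eval_C, Polynomial.eval_X,
        PiLp.add_apply, PiLp.smul_apply, smul_eq_mul]
      push_cast
      ring

theorem enorm_dirDeriv_le {F : List (Fin n) → Rn n → 𝕜} (v : Rn n) {x : Rn n} {B : ℝ≥0∞} (j : ℕ)
    (L : List (Fin n)) (hB : ∀ L' : List (Fin n), L'.length = L.length + j → ‖F L' x‖ₑ ≤ B) :
    ‖dirDeriv F v j L x‖ₑ ≤ (n * ‖v‖ₑ) ^ j * B := by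
  induction j generalizing L with
  | zero => simpa [dirDeriv] using hB L rfl
  | succ j ih =>
    calc ‖dirDeriv F v (j + 1) L x‖ₑ ≤ ∑ i, ‖v i • dirDeriv F v j (i :: L) x‖ₑ :=
          enorm_sum_le _ _
      _ ≤ ∑ _i : Fin n, ‖v‖ₑ * ((n * ‖v‖ₑ) ^ j * B) := by
          refine Finset.sum_le_sum fun i _ => ?_
          rw [enorm_smul]
          gcongr
          · rw [enorm_le_iff_norm_le]
            exact PiLp.norm_apply_le v i
          · refine ih (i :: L) fun L' hL' => hB L' ?_
            rw [hL', List.length_cons]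
            omega
      _ = _ := by
          rw [Finset.sum_const, Finset.card_univ, Fintype.card_fin, nsmul_eq_mul]
          ring

/-- The Taylor polynomial of degree less than `k` with centre `z` of a jet, evaluated at `z + v`. -/
noncomputable def taylorPoly (F : List (Fin n) → Rn n → 𝕜) (k : ℕ) (z v : Rn n) : 𝕜 :=
  ∑ j ∈ Finset.range k, (1 / (j.factorial : ℝ)) • dirDeriv F v j [] z

/-- The derivative in `τ` of the Taylor expansion of `F` at `y - τ v`, evaluated at `y`,
telescopes. -/
theorem IsJet.hasDerivAt_taylorSum {F : List (Fin n) → Rn n → 𝕜} (hF : IsJet F) (y v : Rn n)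
    (k : ℕ) (τ : ℝ) :
    HasDerivAt (fun τ : ℝ => ∑ j ∈ Finset.range (k + 1),
        (τ ^ j / (j.factorial : ℝ)) • dirDeriv F v j [] (y - τ • v))
      (-((τ ^ k / (k.factorial : ℝ)) • dirDeriv F v (k + 1) [] (y - τ • v))) τ := by
  induction k with
  | zero => simpa using hF.hasDerivAt_dirDeriv y v 0 [] τ
  | succ k ih =>
    simp only [Finset.sum_range_succ _ (k + 1)]
    have h1 : HasDerivAt (fun τ : ℝ => τ ^ (k + 1) / ((k + 1).factorial : ℝ))
        (τ ^ k / (k.factorial : ℝ)) τ := by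
      refine ((hasDerivAt_pow (k + 1) τ).div_const ((k + 1).factorial : ℝ)).congr_deriv ?_
      rw [Nat.factorial_succ]
      push_cast
      have : (k.factorial : ℝ) ≠ 0 := by positivity
      have : (k : ℝ) + 1 ≠ 0 := by positivity
      field_simp
    have h2 := h1.fun_smul (hF.hasDerivAt_dirDeriv y v (k + 1) [] τ)
    refine (ih.fun_add h2).congr_deriv ?_
    rw [smul_neg]
    abel

/-- Taylor's formula with integral remainder. The expansion has its centre at the far end `z` of the
segment, so that the kernel `τ ^ (k - 1)` is small near `y`. -/
theorem IsJet.enorm_sub_taylorPoly_le {F : List (Fin n) → Rn n → 𝕜} (hF : IsJet F) {k : ℕ}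
    (hk : 1 ≤ k) (y z : Rn n) {G : Rn n → ℝ≥0∞}
    (hG : ∀ τ : ℝ, 0 < τ → τ < 1 → ∀ L : List (Fin n), L.length = k →
      ‖F L (y + τ • (z - y))‖ₑ ≤ G (y + τ • (z - y))) :
    ‖F [] y - taylorPoly F k z (y - z)‖ₑ ≤ (n * ‖z - y‖ₑ) ^ k *
      ∫⁻ τ in Ioo (0 : ℝ) 1, ENNReal.ofReal (τ ^ (k - 1)) * G (y + τ • (z - y)) := by
  obtain ⟨k, rfl⟩ := Nat.exists_eq_add_of_le' hk
  set v := y - z with hv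
  have hvz : z - y = -v := by rw [hv, neg_sub]
  set Φ : ℝ → 𝕜 := fun τ => ∑ j ∈ Finset.range (k + 1),
    (τ ^ j / (j.factorial : ℝ)) • dirDeriv F v j [] (y - τ • v) with hΦ
  have hder := hF.hasDerivAt_taylorSum y v k
  have hcont : Continuous fun τ : ℝ =>
      -((τ ^ k / (k.factorial : ℝ)) • dirDeriv F v (k + 1) [] (y - τ • v)) := by
    have : Continuous fun τ : ℝ => dirDeriv F v (k + 1) [] (y - τ • v) :=
      continuous_iff_continuousAt.2 fun τ =>
        (hF.hasDerivAt_dirDeriv y v (k + 1) [] τ).continuousAt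
    fun_prop
  have hFTC := intervalIntegral.integral_eq_sub_of_hasDerivAt (a := 0) (b := 1)
    (fun τ _ => hder τ) (hcont.intervalIntegrable 0 1)
  have h0 : Φ 0 = F [] y := by
    simp [hΦ, Finset.sum_range_succ', dirDeriv]
  have h1 : Φ 1 = taylorPoly F (k + 1) z v := by
    simp [hΦ, taylorPoly, hv]
  change _ = Φ 1 - Φ 0 at hFTC
  rw [h0, h1, intervalIntegral.integral_of_le zero_le_one] at hFTC
  rw [← enorm_neg, neg_sub, ← hFTC, ← lintegral_const_mul' _ _ (ENNReal.pow_ne_top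
    (ENNReal.mul_ne_top (by simp) enorm_ne_top)), Measure.restrict_congr_set Ioo_ae_eq_Ioc.symm]
  refine (enorm_integral_le_lintegral_enorm _).trans
    (setLIntegral_mono' measurableSet_Ioo fun τ hτ => ?_)
  have hyz : y + τ • (z - y) = y - τ • v := by rw [hvz, smul_neg, sub_eq_add_neg]
  rw [enorm_neg, enorm_smul, hyz, mul_left_comm, Nat.add_sub_cancel, hvz, enorm_neg]
  gcongr
  · rw [Real.enorm_of_nonneg (by have := hτ.1; positivity)]
    refine ENNReal.ofReal_le_ofReal (div_le_self (pow_nonneg hτ.1.le _) ?_)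
    exact_mod_cast Nat.one_le_iff_ne_zero.2 (Nat.factorial_ne_zero k)
  · refine enorm_dirDeriv_le v (k + 1) [] fun L' hL' => ?_
    have := hG τ hτ.1 hτ.2 L' (by simpa using hL')
    rwa [hyz] at this

/-- Differences of order `k` annihilate Taylor polynomials of degree less than `k`. -/
theorem diff_taylorPoly (F : List (Fin n) → Rn n → 𝕜) (k : ℕ) (x h z : Rn n) :
    ∑ j ∈ Finset.range (k + 1), (-1 : 𝕜) ^ (k - j) * (k.choose j : 𝕜) *
      taylorPoly F k z (x + (j : ℝ) • h - z) = 0 := by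
  choose P hP hPe using fun j => exists_polynomial_dirDeriv F (x - z) h z j []
  set Q : Polynomial 𝕜 :=
    ∑ j ∈ Finset.range k, Polynomial.C ((1 / (j.factorial : ℝ) : ℝ) : 𝕜) * P j with hQ
  have hQe : ∀ m : ℕ, taylorPoly F k z (x + (m : ℝ) • h - z) = Q.eval (m : 𝕜) := by
    intro m
    rw [taylorPoly, hQ, Polynomial.eval_finsetSum]
    refine Finset.sum_congr rfl fun j _ => ?_
    rw [Polynomial.eval_mul, Polynomial.eval_C, ← hPe, RCLike.real_smul_eq_coe_mul,
      add_sub_right_comm]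
  rcases Nat.eq_zero_or_pos k with rfl | hk
  · simp [taylorPoly]
  have hdeg : Q.natDegree < k := by
    refine lt_of_le_of_lt (Polynomial.natDegree_sum_le_of_forall_le (n := k - 1) _ _
      fun j hj => ?_) (by omega)
    refine (Polynomial.natDegree_C_mul_le _ _).trans ((hP j).trans ?_)
    have := Finset.mem_range.1 hj
    omega
  have h0 := congrFun (Polynomial.fwdDiff_iter_eq_zero_of_degree_lt hdeg) 0
  rw [fwdDiff_iter_eq_sum_shift] at h0
  rw [Pi.zero_apply] at h0
  rw [← h0]
  refine Finset.sum_congr rfl fun j _ => ?_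
  rw [hQe]
  simp [zsmul_eq_mul]

/-- A cube of prescribed size inside a given cube, containing a given arithmetic progression. -/
theorem exists_subcube {k : ℕ} {a x h : Rn n} {l r : ℝ} (hr : r ≤ l)
    (hx : x ∈ cube a l) (hxk : x + (k : ℝ) • h ∈ cube a l) (hh : ∀ i, |k * h i| < r) :
    ∃ b : Rn n, cube b r ⊆ cube a l ∧ ∀ j ≤ k, x + (j : ℝ) • h ∈ cube b r := by
  have key : ∀ i, ∃ b : ℝ, a i ≤ b ∧ b + r ≤ a i + l ∧ (b < x i ∧ x i < b + r) ∧
      (b < x i + k * h i ∧ x i + k * h i < b + r) := by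
    intro i
    have h1 := hx i
    have h2 := hxk i
    have h3 := abs_lt.1 (hh i)
    simp only [PiLp.add_apply, PiLp.smul_apply, smul_eq_mul] at h2
    set y := x i + k * h i with hy
    have e1 : max (x i) y - r < min (x i) y := by
      rcases max_choice (x i) y with e | e <;> rcases min_choice (x i) y with e' | e' <;>
        rw [e, e'] <;> linarith
    have e2 : max (x i) y < a i + l := max_lt h1.2 h2.2
    have e3 : a i < min (x i) y := lt_min h1.1 h2.1
    set m := min (min (x i) y) (a i + l - r) with hm
    have e4 : max (x i) y - r < m := lt_min e1 (by linarith)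
    have m1 : m ≤ min (x i) y := min_le_left _ _
    have m2 : m ≤ a i + l - r := min_le_right _ _
    have x1 := le_max_left (x i) y
    have x2 := le_max_right (x i) y
    have n1 := min_le_left (x i) y
    have n2 := min_le_right (x i) y
    set mid := (max (x i) y - r + m) / 2 with hmid
    refine ⟨max (a i) mid, le_max_left _ _, ?_, ⟨?_, ?_⟩, ?_, ?_⟩
    · rw [← le_sub_iff_add_le]
      exact max_le (by linarith) (by linarith)
    · exact max_lt h1.1 (by linarith)
    · linarith [le_max_right (a i) mid]
    · exact max_lt h2.1 (by linarith)
    · linarith [le_max_right (a i) mid]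
  choose b hb1 hb2 hb3 hb4 using key
  refine ⟨WithLp.toLp 2 b, fun y hy i => ?_, fun j hj i => ?_⟩
  · have := hy i
    simp only at this
    constructor <;> linarith [this.1, this.2, hb1 i, hb2 i]
  · simp only [PiLp.add_apply, PiLp.smul_apply, smul_eq_mul]
    have hj' : (j : ℝ) ≤ k := by exact_mod_cast hj
    have hj0 : (0 : ℝ) ≤ j := by positivity
    have h3 := hb3 i
    have h4 := hb4 i
    rcases le_total 0 (h i) with hi | hi <;> constructor <;> nlinarith

theorem norm_le_sum_abs (v : Rn n) : ‖v‖ ≤ ∑ i, |v i| := by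
  rw [EuclideanSpace.norm_eq]
  refine Real.sqrt_le_iff.2 ⟨Finset.sum_nonneg fun i _ => abs_nonneg _, ?_⟩
  simp only [Real.norm_eq_abs]
  exact Finset.sum_sq_le_sq_sum_of_nonneg fun i _ => abs_nonneg _

/-- The constant in `IsJet.enorm_diff_le_potential`. -/
noncomputable def taylorConst (n k : ℕ) : ℝ≥0∞ :=
  2 ^ k * (n * n) ^ k * ((4 * n * n) ^ n * volume (Metric.ball (0 : Rn n) 1))

theorem taylorConst_ne_top (n k : ℕ) : taylorConst n k ≠ ⊤ := by
  refine ENNReal.mul_ne_top (ENNReal.mul_ne_top (by simp) (ENNReal.pow_ne_top ?_))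
    (ENNReal.mul_ne_top (ENNReal.pow_ne_top ?_) (volume_ball_ne_top _ _))
  · exact ENNReal.mul_ne_top (by simp) (by simp)
  · exact ENNReal.mul_ne_top (ENNReal.mul_ne_top (by simp) (by simp)) (by simp)

/-- Contraction towards `y` turns an integral over a set of size `Λ` into an average over the ball
of radius `τ Λ`. -/
theorem setLIntegral_comp_segment_le {G : Rn n → ℝ≥0∞} (hG : Measurable G) {R : Set (Rn n)}
    {y : Rn n} {Λ τ : ℝ} (hτ : 0 < τ) (hΛ : 0 < Λ) (hR : R ⊆ Metric.ball y Λ) :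
    ∫⁻ z in R, G (y + τ • (z - y)) ≤ volume (Metric.ball y Λ) * ballAvg (τ * Λ) G y := by
  have hBm : MeasurableSet (Metric.ball y (τ * Λ)) := Metric.isOpen_ball.measurableSet
  have hc : ∀ z : Rn n, y + τ • (z - y) = (y - τ • y) + τ • z := fun z => by
    rw [smul_sub]; abel
  have hv0 := volume_ball_ne_zero y hΛ
  have hvt := volume_ball_ne_top y Λ
  have hτ0 : ENNReal.ofReal τ ^ n ≠ 0 := pow_ne_zero _ (by simpa using hτ)
  have hτt : ENNReal.ofReal τ ^ n ≠ ⊤ := ENNReal.pow_ne_top ENNReal.ofReal_ne_top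
  calc ∫⁻ z in R, G (y + τ • (z - y))
      ≤ ∫⁻ z in Metric.ball y Λ, G (y + τ • (z - y)) := lintegral_mono_set hR
    _ ≤ ∫⁻ z, (Metric.ball y (τ * Λ)).indicator G ((y - τ • y) + τ • z) := by
        rw [← lintegral_indicator Metric.isOpen_ball.measurableSet]
        refine lintegral_mono fun z => ?_
        by_cases hz : z ∈ Metric.ball y Λ
        · rw [indicator_of_mem hz, ← hc, indicator_of_mem]
          rw [Metric.mem_ball, dist_eq_norm, add_sub_cancel_left, norm_smul, Real.norm_of_nonneg
            hτ.le, ← dist_eq_norm]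
          exact mul_lt_mul_of_pos_left hz hτ
        · rw [indicator_of_notMem hz]
          exact zero_le
    _ = (ENNReal.ofReal τ ^ n)⁻¹ * ∫⁻ z in Metric.ball y (τ * Λ), G z := by
        rw [lintegral_comp_add_smul (hG.indicator hBm) _ hτ, lintegral_indicator hBm]
    _ = _ := by
        rw [ballAvg, volume_ball_mul y y hτ hΛ, div_eq_mul_inv, ENNReal.mul_inv (Or.inl hτ0)
          (Or.inl hτt), mul_left_comm, mul_left_comm (volume (Metric.ball y Λ)),
          ENNReal.mul_inv_cancel hv0 hvt, mul_one, mul_comm]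

/-- Differences of a smooth function inside a cube are controlled by the truncated potential of
its `k`-th derivatives: the Taylor polynomials with centre `z` are annihilated by differences of
order `k`, and the remainder is averaged over all `z` in a suitable subcube. -/
theorem IsJet.enorm_diff_le_potential {F : List (Fin n) → Rn n → 𝕜} (hF : IsJet F) {k : ℕ}
    (hk : 1 ≤ k) (hn : 1 ≤ n) {G : Rn n → ℝ≥0∞} (hG : Measurable G) {a x h : Rn n} {l r : ℝ}
    (hGF : ∀ y ∈ cube a l, ∀ L : List (Fin n), L.length = k → ‖F L y‖ₑ ≤ G y)
    (hl : 0 < l) (hr : 0 < r) (hrl : r ≤ 2 * n * l) (hx : x ∈ cube a l)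
    (hxk : x + (k : ℝ) • h ∈ cube a l) (hh : k * ‖h‖ < r) :
    ‖diff k h (F []) x‖ₑ ≤ taylorConst n k * ENNReal.ofReal r ^ k *
      ∑ j ∈ Finset.range (k + 1), potential k (2 * n * r) G (x + (j : ℝ) • h) := by
  have hn' : (1 : ℝ) ≤ n := by exact_mod_cast hn
  -- the subcube has to fit into the cube, and its volume has to be comparable with that of a ball
  -- of radius `Λ`; the latter is where `r ≤ 2 n l` is needed
  set r' := min r l with hr'
  have hr'0 : 0 < r' := lt_min hr hl
  have hrr' : r ≤ 2 * n * r' := by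
    rcases min_choice r l with e | e <;> rw [hr', e]
    · nlinarith
    · exact hrl
  set Λ := 2 * n * r with hΛdef
  have hΛ : 0 < Λ := by positivity
  obtain ⟨b, hbsub, hb⟩ := exists_subcube (min_le_right r l) hx hxk fun i => by
    refine lt_min ?_ ?_
    · refine lt_of_le_of_lt ?_ hh
      rw [abs_mul, Nat.abs_cast]
      gcongr
      exact PiLp.norm_apply_le h i
    · have h1 := hx i
      have h2 := hxk i
      simp only [PiLp.add_apply, PiLp.smul_apply, smul_eq_mul] at h2
      rw [abs_lt]
      constructor <;> linarith [h1.1, h1.2, h2.1, h2.2]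
  set R := cube b r' with hR
  have hdist : ∀ y ∈ R, ∀ z ∈ R, ‖z - y‖ ≤ n * r' := by
    intro y hy z hz
    refine (norm_le_sum_abs _).trans ?_
    calc ∑ i, |(z - y) i| ≤ ∑ _i : Fin n, r' := by
          refine Finset.sum_le_sum fun i _ => ?_
          rw [PiLp.sub_apply, abs_le]
          have h1 := hy i
          have h2 := hz i
          constructor <;> linarith [h1.1, h1.2, h2.1, h2.2]
      _ = n * r' := by simp
  have hball : ∀ y ∈ R, R ⊆ Metric.ball y Λ := by
    intro y hy z hz
    rw [Metric.mem_ball, dist_eq_norm]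
    refine (hdist y hy z hz).trans_lt ?_
    have : r' ≤ r := min_le_left _ _
    rw [hΛdef]
    nlinarith
  have hseg : ∀ y ∈ R, ∀ z ∈ R, ∀ τ : ℝ, 0 < τ → τ < 1 → y + τ • (z - y) ∈ R := by
    intro y hy z hz τ h0 h1 i
    have e1 := hy i
    have e2 := hz i
    simp only [PiLp.add_apply, PiLp.smul_apply, PiLp.sub_apply, smul_eq_mul]
    constructor <;> nlinarith [e1.1, e1.2, e2.1, e2.2]
  set I : Rn n → Rn n → ℝ≥0∞ := fun y z =>
    ∫⁻ τ in Ioo (0 : ℝ) 1, ENNReal.ofReal (τ ^ (k - 1)) * G (y + τ • (z - y)) with hI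
  have hIm : ∀ y, Measurable (fun p : Rn n × ℝ =>
      ENNReal.ofReal (p.2 ^ (k - 1)) * G (y + p.2 • (p.1 - y))) := by
    intro y
    have h1 : Measurable fun p : Rn n × ℝ => ENNReal.ofReal (p.2 ^ (k - 1)) := by fun_prop
    have h2 : Measurable fun p : Rn n × ℝ => y + p.2 • (p.1 - y) := by fun_prop
    exact h1.mul (hG.comp h2)
  have hpt : ∀ z ∈ R, ‖diff k h (F []) x‖ₑ ≤ 2 ^ k * (n * n) ^ k * ENNReal.ofReal r ^ k *
      ∑ j ∈ Finset.range (k + 1), I (x + (j : ℝ) • h) z := by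
    intro z hz
    have hd : diff k h (F []) x = ∑ j ∈ Finset.range (k + 1), (-1 : 𝕜) ^ (k - j) *
        (k.choose j : 𝕜) * (F [] (x + (j : ℝ) • h) -
          taylorPoly F k z (x + (j : ℝ) • h - z)) := by
      simp only [mul_sub, Finset.sum_sub_distrib]
      rw [diff_taylorPoly, sub_zero, diff]
    rw [hd, Finset.mul_sum]
    refine (enorm_sum_le _ _).trans (Finset.sum_le_sum fun j hj => ?_)
    have hj' : j ≤ k := Nat.lt_succ_iff.1 (Finset.mem_range.1 hj)
    have hy := hb j hj'
    rw [enorm_mul, enorm_mul, enorm_pow, enorm_neg, enorm_one, one_pow, one_mul, mul_assoc,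
      mul_assoc]
    have hc : ‖(k.choose j : 𝕜)‖ₑ ≤ 2 ^ k := by
      rw [← ofReal_norm, RCLike.norm_natCast, ENNReal.ofReal_natCast]
      exact_mod_cast Nat.choose_le_two_pow k j
    refine mul_le_mul' hc ?_
    refine (hF.enorm_sub_taylorPoly_le hk _ z (G := G) fun τ h0 h1 L hL =>
      hGF _ (hbsub (hseg _ hy z hz τ h0 h1)) L hL).trans ?_
    rw [← mul_assoc, ← mul_pow]
    refine mul_le_mul' (pow_le_pow_left' ?_ k) le_rfl
    rw [mul_assoc]
    refine mul_le_mul_right ?_ _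
    rw [← ofReal_norm, ← ENNReal.ofReal_natCast, ← ENNReal.ofReal_mul (by positivity)]
    refine ENNReal.ofReal_le_ofReal ((hdist _ hy z hz).trans ?_)
    gcongr
    exact min_le_left _ _
  have hv0 : volume R ≠ 0 := volume_cube_ne_zero _ hr'0
  have hvt : volume R ≠ ⊤ := volume_cube_ne_top _ _
  have hvol : ∀ y : Rn n, volume (Metric.ball y Λ) ≤
      ((4 * n * n) ^ n * volume (Metric.ball (0 : Rn n) 1)) * volume R := by
    intro y
    rw [volume_ball_eq y hΛ, hR, volume_cube, mul_right_comm, ← mul_pow]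
    gcongr
    have : (4 * n * n : ℝ≥0∞) = ENNReal.ofReal (4 * n * n) := by
      rw [ENNReal.ofReal_mul (by positivity), ENNReal.ofReal_mul (by positivity)]
      simp
    rw [this, ← ENNReal.ofReal_mul (by positivity)]
    refine ENNReal.ofReal_le_ofReal ?_
    rw [hΛdef]
    nlinarith
  have hint : ∀ y ∈ R, ∫⁻ z in R, I y z ≤
      ((4 * n * n) ^ n * volume (Metric.ball (0 : Rn n) 1)) * volume R * potential k Λ G y := by
    intro y hy
    calc ∫⁻ z in R, I y z = ∫⁻ τ in Ioo (0 : ℝ) 1, ∫⁻ z in R,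
          ENNReal.ofReal (τ ^ (k - 1)) * G (y + τ • (z - y)) :=
          lintegral_lintegral_swap (hIm y).aemeasurable
      _ ≤ ∫⁻ τ in Ioo (0 : ℝ) 1, ((4 * n * n) ^ n * volume (Metric.ball (0 : Rn n) 1)) *
          volume R * (ENNReal.ofReal (τ ^ (k - 1)) * ballAvg (τ * Λ) G y) := by
          refine setLIntegral_mono' measurableSet_Ioo fun τ hτ => ?_
          rw [lintegral_const_mul' _ _ ENNReal.ofReal_ne_top, mul_left_comm]
          gcongr
          refine (setLIntegral_comp_segment_le hG hτ.1 hΛ (hball y hy)).trans ?_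
          gcongr
          exact hvol y
      _ = _ := by
          rw [lintegral_const_mul _ (measurable_potential_integrand_left hG k Λ y)]
          rfl
  have hIz : ∀ y, Measurable (I y) := fun y =>
    (hIm y).lintegral_prod_right' (ν := volume.restrict (Ioo 0 1))
  refine (ENNReal.mul_le_mul_iff_left hv0 hvt).1 ?_
  calc ‖diff k h (F []) x‖ₑ * volume R = ∫⁻ _ in R, ‖diff k h (F []) x‖ₑ :=
        (setLIntegral_const _ _).symm
    _ ≤ ∫⁻ z in R, 2 ^ k * (n * n) ^ k * ENNReal.ofReal r ^ k *
      ∑ j ∈ Finset.range (k + 1), I (x + (j : ℝ) • h) z :=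
        setLIntegral_mono' (measurableSet_cube _ _) hpt
    _ = 2 ^ k * (n * n) ^ k * ENNReal.ofReal r ^ k *
      ∑ j ∈ Finset.range (k + 1), ∫⁻ z in R, I (x + (j : ℝ) • h) z := by
        rw [lintegral_const_mul _ (Finset.measurable_fun_sum _ fun j _ => hIz _),
          lintegral_finsetSum _ fun j _ => hIz _]
    _ ≤ 2 ^ k * (n * n) ^ k * ENNReal.ofReal r ^ k *
      ∑ j ∈ Finset.range (k + 1), ((4 * n * n) ^ n * volume (Metric.ball (0 : Rn n) 1)) *
        volume R * potential k Λ G (x + (j : ℝ) • h) := by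
        gcongr with j hj
        exact hint _ (hb j (Nat.lt_succ_iff.1 (Finset.mem_range.1 hj)))
    _ = _ := by
        rw [← Finset.mul_sum, taylorConst]
        ring

/-! ### Mollification and weak derivatives -/

section PartialDeriv

variable {φ : Rn n → ℝ}

theorem partialDeriv_eq_fderiv (hφ : ContDiff ℝ ∞ φ) (i : Fin n) :
    partialDeriv i φ = fun x => fderiv ℝ φ x (EuclideanSpace.single i 1) :=
  funext fun x => (hφ.differentiable (by simp) x).lineDeriv_eq_fderiv

theorem contDiff_partialDeriv (hφ : ContDiff ℝ ∞ φ) (i : Fin n) :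
    ContDiff ℝ ∞ (partialDeriv i φ) := by
  rw [partialDeriv_eq_fderiv hφ]
  exact (hφ.fderiv_right (m := ∞) (by simp)).clm_apply contDiff_const

theorem tsupport_partialDeriv_subset (hφ : ContDiff ℝ ∞ φ) (i : Fin n) :
    tsupport (partialDeriv i φ) ⊆ tsupport φ := by
  refine subset_trans (closure_mono fun x hx => ?_) (tsupport_fderiv_subset ℝ (f := φ))
  rw [partialDeriv_eq_fderiv hφ] at hx
  intro h
  exact hx (by simp [h])

theorem partialDeriv_comm (hφ : ContDiff ℝ ∞ φ) (i j : Fin n) :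
    partialDeriv i (partialDeriv j φ) = partialDeriv j (partialDeriv i φ) := by
  have key : ∀ (i j : Fin n) (x : Rn n), partialDeriv i (partialDeriv j φ) x =
      fderiv ℝ (fderiv ℝ φ) x (EuclideanSpace.single i 1) (EuclideanSpace.single j 1) := by
    intro i j x
    rw [partialDeriv_eq_fderiv (contDiff_partialDeriv hφ j), partialDeriv_eq_fderiv hφ]
    have hd : DifferentiableAt ℝ (fderiv ℝ φ) x :=
      (hφ.fderiv_right (m := ∞) (by simp)).differentiable (by simp) x
    simp only
    rw [fderiv_clm_apply hd (differentiableAt_const _)]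
    simp
  funext x
  rw [key, key]
  exact ((contDiff_infty.1 hφ 2).contDiffAt.isSymmSndFDerivAt (by simp)) _ _

theorem contDiff_iterate_partialDeriv (hφ : ContDiff ℝ ∞ φ) (i : Fin n) (m : ℕ) :
    ContDiff ℝ ∞ ((partialDeriv i)^[m] φ) := by
  induction m with
  | zero => exact hφ
  | succ m ih =>
    rw [Function.iterate_succ_apply']
    exact contDiff_partialDeriv ih i

theorem iterate_partialDeriv_comm (hφ : ContDiff ℝ ∞ φ) (i j : Fin n) (m : ℕ) :
    (partialDeriv j)^[m] (partialDeriv i φ) = partialDeriv i ((partialDeriv j)^[m] φ) := by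
  induction m with
  | zero => rfl
  | succ m ih =>
    rw [Function.iterate_succ_apply', ih, Function.iterate_succ_apply',
      partialDeriv_comm (contDiff_iterate_partialDeriv hφ j m)]

theorem contDiff_foldr_partialDeriv (hφ : ContDiff ℝ ∞ φ) (α : Fin n → ℕ) (l : List (Fin n)) :
    ContDiff ℝ ∞ (l.foldr (fun i ψ => (partialDeriv i)^[α i] ψ) φ) := by
  induction l with
  | nil => exact hφ
  | cons j l ih => exact contDiff_iterate_partialDeriv ih j _

theorem multiDeriv_add_single (hφ : ContDiff ℝ ∞ φ) (α β : Fin n → ℕ) (i : Fin n)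
    (hi : β i = α i + 1) (hne : ∀ j, j ≠ i → β j = α j) :
    multiDeriv β φ = partialDeriv i (multiDeriv α φ) := by
  have hnot : ∀ l : List (Fin n), i ∉ l →
      l.foldr (fun i ψ => (partialDeriv i)^[β i] ψ) φ =
        l.foldr (fun i ψ => (partialDeriv i)^[α i] ψ) φ := by
    intro l
    induction l with
    | nil => exact fun _ => rfl
    | cons j l ih =>
      intro h
      rw [List.mem_cons, not_or] at h
      rw [List.foldr_cons, List.foldr_cons, ih h.2, hne j (Ne.symm h.1)]
  have hmem : ∀ l : List (Fin n), l.Nodup → i ∈ l →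
      l.foldr (fun i ψ => (partialDeriv i)^[β i] ψ) φ =
        partialDeriv i (l.foldr (fun i ψ => (partialDeriv i)^[α i] ψ) φ) := by
    intro l
    induction l with
    | nil => exact fun _ h => absurd h List.not_mem_nil
    | cons j l ih =>
      intro hnd h
      rw [List.nodup_cons] at hnd
      rw [List.foldr_cons, List.foldr_cons]
      rcases eq_or_ne j i with rfl | hji
      · rw [hnot l hnd.1, hi, Function.iterate_succ_apply']
      · rw [ih hnd.2 ((List.mem_cons.1 h).resolve_left hji.symm), hne j hji,
          iterate_partialDeriv_comm (contDiff_foldr_partialDeriv hφ α l)]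
  exact hmem _ (List.nodup_finRange n) (List.mem_finRange i)

/-- Iterated partial derivatives along a word in the coordinate directions. -/
noncomputable def wordDeriv : List (Fin n) → (Rn n → ℝ) → Rn n → ℝ
  | [], φ => φ
  | i :: L, φ => partialDeriv i (wordDeriv L φ)

theorem contDiff_wordDeriv (hφ : ContDiff ℝ ∞ φ) (L : List (Fin n)) :
    ContDiff ℝ ∞ (wordDeriv L φ) := by
  induction L with
  | nil => exact hφ
  | cons i L ih => exact contDiff_partialDeriv ih i

theorem tsupport_wordDeriv_subset (hφ : ContDiff ℝ ∞ φ) (L : List (Fin n)) :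
    tsupport (wordDeriv L φ) ⊆ tsupport φ := by
  induction L with
  | nil => exact subset_rfl
  | cons i L ih => exact (tsupport_partialDeriv_subset (contDiff_wordDeriv hφ L) i).trans ih

/-- By the symmetry of second derivatives, a derivative along a word depends only on the number of
occurrences of each letter. -/
theorem wordDeriv_eq_multiDeriv (hφ : ContDiff ℝ ∞ φ) (L : List (Fin n)) :
    wordDeriv L φ = multiDeriv (fun i => L.count i) φ := by
  induction L with
  | nil =>
    have : ∀ l : List (Fin n), l.foldr (fun i ψ => (partialDeriv i)^[0] ψ) φ = φ := by
      intro l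
      induction l with
      | nil => rfl
      | cons j l ih => rw [List.foldr_cons, ih]; rfl
    exact (this _).symm
  | cons i L ih =>
    rw [wordDeriv, ih]
    refine (multiDeriv_add_single hφ _ _ i ?_ fun j hj => ?_).symm
    · simp
    · simp [Ne.symm hj]

theorem sum_count_eq_length (L : List (Fin n)) : ∑ i, L.count i = L.length := by
  induction L with
  | nil => simp
  | cons i L ih => simp [List.count_cons, Finset.sum_add_distrib, ih]

theorem wordDeriv_comp_sub (hφ : ContDiff ℝ ∞ φ) (y : Rn n) (L : List (Fin n)) :
    wordDeriv L (fun t => φ (y - t)) = fun t => (-1) ^ L.length * wordDeriv L φ (y - t) := by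
  induction L with
  | nil => simp [wordDeriv]
  | cons i L ih =>
    have hs : ContDiff ℝ ∞ fun t => (-1 : ℝ) ^ L.length * wordDeriv L φ (y - t) :=
      contDiff_const.mul ((contDiff_wordDeriv hφ L).comp (contDiff_const.sub contDiff_id))
    rw [wordDeriv, ih, partialDeriv_eq_fderiv hs, wordDeriv,
      partialDeriv_eq_fderiv (contDiff_wordDeriv hφ L)]
    funext t
    have h1 : HasFDerivAt (fun t : Rn n => y - t) (-ContinuousLinearMap.id ℝ (Rn n)) t :=
      (hasFDerivAt_id t).const_sub y
    have h2 := (((contDiff_wordDeriv hφ L).differentiable (by simp)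
      (y - t)).hasFDerivAt.comp t h1).const_mul ((-1 : ℝ) ^ L.length)
    have h3 : fderiv ℝ (fun t => (-1 : ℝ) ^ L.length * wordDeriv L φ (y - t)) t = _ := h2.fderiv
    rw [h3]
    simp [pow_succ]

end PartialDeriv

/-- The convolution `φ ⋆ f`. -/
noncomputable def mollify (φ : Rn n → ℝ) (f : Rn n → 𝕜) : Rn n → 𝕜 :=
  convolution f φ (ContinuousLinearMap.lsmul ℝ ℝ).flip volume

theorem mollify_apply (φ : Rn n → ℝ) (f : Rn n → 𝕜) (x : Rn n) :
    mollify φ f x = ∫ t, φ (x - t) • f t := rfl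

theorem isJet_mollify {φ : Rn n → ℝ} (hφ : ContDiff ℝ ∞ φ) (hc : HasCompactSupport φ)
    {f : Rn n → 𝕜} (hf : LocallyIntegrable f volume) :
    IsJet fun L => mollify (wordDeriv L φ) f := by
  have hcL : ∀ L, HasCompactSupport (wordDeriv L φ) := fun L =>
    hc.mono' ((subset_tsupport _).trans (tsupport_wordDeriv_subset hφ L))
  intro L x
  have hφL := contDiff_wordDeriv hφ L
  have hφL1 : ContDiff ℝ 1 (wordDeriv L φ) := hφL.of_le (by simp)
  refine ⟨_, (hcL L).hasFDerivAt_convolution_right (ContinuousLinearMap.lsmul ℝ ℝ).flip hf hφL1 x,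
    fun v => ?_⟩
  rw [convolution_precompR_apply _ hf ((hcL L).fderiv ℝ) (hφL1.continuous_fderiv (by simp))]
  have hv : (fun a => fderiv ℝ (wordDeriv L φ) a v) =
      fun a => ∑ i, v i * wordDeriv (i :: L) φ a := by
    funext a
    have : v = ∑ i, v i • EuclideanSpace.single i (1 : ℝ) := by
      have := (EuclideanSpace.basisFun (Fin n) ℝ).sum_repr v
      simpa using this.symm
    conv_lhs => rw [this]
    rw [map_sum]
    refine Finset.sum_congr rfl fun i _ => ?_
    rw [map_smul, wordDeriv, partialDeriv_eq_fderiv hφL, smul_eq_mul]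
  rw [hv]
  have hint : ∀ i, Integrable (fun t => wordDeriv (i :: L) φ (x - t) • f t) volume := fun i =>
    (hcL (i :: L)).convolutionExists_right (ContinuousLinearMap.lsmul ℝ ℝ).flip hf
      (contDiff_wordDeriv hφ (i :: L)).continuous x
  simp only [mollify_apply]
  change ∫ t, (∑ i, v i * wordDeriv (i :: L) φ (x - t)) • f t = _
  simp only [Finset.sum_smul, mul_smul]
  rw [integral_finsetSum (f := fun i t => v i • wordDeriv (i :: L) φ (x - t) • f t) _
    fun i _ => (hint i).smul (v i)]
  exact Finset.sum_congr rfl fun i _ => integral_smul _ _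

/-- Derivatives of a mollification are mollifications of the weak derivative, away from the
boundary. -/
theorem mollify_wordDeriv_indicator_eq {Ω Ω' : Set (Rn n)} (hΩ : MeasurableSet Ω)
    (hsub : Ω' ⊆ Ω)
    {f g : Rn n → 𝕜} {L : List (Fin n)} (hg : HasWeakDeriv Ω (fun i => L.count i) f g)
    {φ : Rn n → ℝ} (hφ : ContDiff ℝ ∞ φ) {ε : ℝ} (hε : tsupport φ ⊆ Metric.closedBall 0 ε)
    {y : Rn n} (hy : Metric.closedBall y ε ⊆ Ω') :
    mollify (wordDeriv L φ) (Ω'.indicator f) y = ∫ t, φ (y - t) • Ω'.indicator g t := by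
  set ψ : Rn n → ℝ := fun t => φ (y - t) with hψ
  have hψs : ContDiff ℝ ∞ ψ := hφ.comp (contDiff_const.sub contDiff_id)
  have hψsupp : tsupport ψ ⊆ Metric.closedBall y ε := by
    refine closure_minimal (fun t ht => ?_) Metric.isClosed_closedBall
    have h1 := hε (subset_tsupport φ (show φ (y - t) ≠ 0 from ht))
    rwa [mem_closedBall_zero_iff, ← dist_eq_norm, dist_comm] at h1
  have hψc : HasCompactSupport ψ :=
    (isCompact_closedBall y ε).of_isClosed_subset (isClosed_tsupport ψ) hψsupp
  have hweak := hg.integral_eq ψ hψs hψc (hψsupp.trans (hy.trans hsub))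
  rw [← wordDeriv_eq_multiDeriv hψs, wordDeriv_comp_sub hφ, sum_count_eq_length] at hweak
  -- the cut-off to the smaller set is not seen by functions supported near `y`
  have hcut : ∀ (χ : Rn n → ℝ) (F : Rn n → 𝕜), tsupport χ ⊆ Metric.closedBall 0 ε →
      ∫ t, χ (y - t) • Ω'.indicator F t = ∫ t in Ω, χ (y - t) • F t := by
    intro χ F hχ
    rw [← integral_indicator hΩ]
    refine integral_congr_ae (Filter.Eventually.of_forall fun t => ?_)
    simp only
    by_cases ht : t ∈ Ω'
    · rw [indicator_of_mem ht, indicator_of_mem (hsub ht)]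
    · have h0 : χ (y - t) = 0 := by
        by_contra h0
        have h1 := hχ (subset_tsupport χ h0)
        rw [mem_closedBall_zero_iff, ← dist_eq_norm, dist_comm] at h1
        exact ht (hy h1)
      simp [h0, indicator]
  rw [mollify_apply, hcut _ _ ((tsupport_wordDeriv_subset hφ L).trans hε), hcut _ _ hε]
  have hsq : ((-1 : ℝ) ^ L.length) * (-1) ^ L.length = 1 := by
    rw [← mul_pow]; simp
  have h2 := congrArg (fun z => ((-1 : ℝ) ^ L.length) • z) hweak
  simp only [mul_smul] at h2
  rw [integral_smul, smul_smul, smul_smul, hsq, one_smul, one_smul] at h2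
  exact h2

/-- The truncated potential commutes with convolutions. -/
theorem potential_lintegral_comm {φ g : Rn n → ℝ≥0∞} (hφ : Measurable φ) (hg : Measurable g)
    (k : ℕ) (Λ : ℝ) (y : Rn n) :
    potential k Λ (fun x => ∫⁻ v, φ v * g (x - v)) y =
      ∫⁻ v, φ v * potential k Λ g (y - v) := by
  have hgm : Measurable fun p : Rn n × Rn n => g (p.1 - p.2) :=
    hg.comp (measurable_fst.sub measurable_snd)
  have hv : ∀ (y v : Rn n) (t : ℝ), volume (Metric.ball (y - v) t) = volume (Metric.ball y t) := by
    intro y v t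
    rcases le_or_gt t 0 with ht | ht
    · rw [Metric.ball_eq_empty.2 ht, Metric.ball_eq_empty.2 ht]
    · rw [volume_ball_eq _ ht, volume_ball_eq _ ht]
  have havg : ∀ t : ℝ, ballAvg t (fun x => ∫⁻ v, φ v * g (x - v)) y =
      ∫⁻ v, φ v * ballAvg t g (y - v) := by
    intro t
    have h1 : ∀ v, ∫⁻ z in Metric.ball y t, g (z - v) = ∫⁻ z in Metric.ball (y - v) t, g z := by
      intro v
      rw [← lintegral_indicator Metric.isOpen_ball.measurableSet,
        ← lintegral_indicator Metric.isOpen_ball.measurableSet,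
        ← lintegral_sub_right_eq_self ((Metric.ball (y - v) t).indicator g) v]
      refine lintegral_congr fun z => ?_
      have : z ∈ Metric.ball y t ↔ z - v ∈ Metric.ball (y - v) t := by
        rw [Metric.mem_ball, Metric.mem_ball, dist_sub_right]
      by_cases hz : z ∈ Metric.ball y t
      · rw [indicator_of_mem hz, indicator_of_mem (this.1 hz)]
      · rw [indicator_of_notMem hz, indicator_of_notMem fun h => hz (this.2 h)]
    have h2 : Measurable fun p : Rn n × Rn n => φ p.2 * g (p.1 - p.2) :=
      (hφ.comp measurable_snd).mul hgm
    rw [ballAvg, lintegral_lintegral_swap h2.aemeasurable, div_eq_mul_inv,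
      ← lintegral_mul_const _ h2.lintegral_prod_left']
    refine lintegral_congr fun v => ?_
    simp only
    rw [lintegral_const_mul _ (hgm.of_uncurry_right (f := fun z v => g (z - v))), h1, ballAvg, hv,
      div_eq_mul_inv, mul_assoc]
  have h3 : Measurable fun p : ℝ × Rn n =>
      ENNReal.ofReal (p.1 ^ (k - 1)) * (φ p.2 * ballAvg (p.1 * Λ) g (y - p.2)) := by
    have e1 : Measurable fun p : ℝ × Rn n => ENNReal.ofReal (p.1 ^ (k - 1)) := by fun_prop
    exact e1.mul ((hφ.comp measurable_snd).mul (measurable_ballAvg_comp hg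
      (measurable_fst.mul_const Λ) (measurable_const.sub measurable_snd)))
  calc potential k Λ (fun x => ∫⁻ v, φ v * g (x - v)) y
      = ∫⁻ τ in Ioo (0 : ℝ) 1, ∫⁻ v,
        ENNReal.ofReal (τ ^ (k - 1)) * (φ v * ballAvg (τ * Λ) g (y - v)) := by
        refine lintegral_congr fun τ => ?_
        rw [havg, lintegral_const_mul' _ _ ENNReal.ofReal_ne_top]
    _ = ∫⁻ v, ∫⁻ τ in Ioo (0 : ℝ) 1,
        ENNReal.ofReal (τ ^ (k - 1)) * (φ v * ballAvg (τ * Λ) g (y - v)) :=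
        lintegral_lintegral_swap h3.aemeasurable
    _ = _ := by
        refine lintegral_congr fun v => ?_
        rw [potential, ← lintegral_const_mul _ (measurable_potential_integrand_left hg k Λ _)]
        exact lintegral_congr fun τ => mul_left_comm _ _ _

/-! ### The pointwise estimate for Sobolev functions -/

section WeakDerivatives

open Filter Topology

/-- Lebesgue differentiation for mollifications of functions with values in `[0, ∞]`; an integrable
such function is finite almost everywhere, which is why `toReal` may appear in the limit. -/
theorem tendsto_lintegral_bump_mul {p : Rn n → ℝ≥0∞} (hp : Measurable p) (hpi : ∫⁻ x, p x ≠ ⊤)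
    {φ : ℕ → ContDiffBump (0 : Rn n)} (hφ : Tendsto (fun i => (φ i).rOut) atTop (𝓝 0))
    (hφ' : ∀ᶠ i in atTop, (φ i).rOut ≤ 2 * (φ i).rIn) :
    ∀ᵐ x : Rn n, Tendsto (fun i => ∫⁻ v, ENNReal.ofReal ((φ i).normed volume v) * p (x - v))
      atTop (𝓝 (ENNReal.ofReal (p x).toReal)) := by
  have hpint : Integrable (fun x => (p x).toReal) volume :=
    integrable_toReal_of_lintegral_ne_top hp.aemeasurable hpi
  have hfin : ∀ᵐ x, p x < ⊤ := ae_lt_top hp hpi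
  filter_upwards [ContDiffBump.ae_convolution_tendsto_right_of_locallyIntegrable hφ hφ'
    hpint.locallyIntegrable] with x hx
  refine (ENNReal.tendsto_ofReal hx).congr fun i => ?_
  have hfinx : ∀ᵐ v, p (x - v) < ⊤ :=
    (Measure.measurePreserving_sub_left (volume : Measure (Rn n)) x).quasiMeasurePreserving.ae hfin
  have hint : Integrable (fun v => (φ i).normed volume v * (p (x - v)).toReal) volume :=
    (φ i).hasCompactSupport_normed.convolutionExists_left (ContinuousLinearMap.lsmul ℝ ℝ)
      (φ i).continuous_normed hpint.locallyIntegrable x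
  change ENNReal.ofReal (∫ v, (φ i).normed volume v * (p (x - v)).toReal) = _
  rw [ofReal_integral_eq_lintegral_ofReal hint (Eventually.of_forall fun v =>
    mul_nonneg ((φ i).nonneg_normed v) ENNReal.toReal_nonneg)]
  refine lintegral_congr_ae ?_
  filter_upwards [hfinx] with v hv
  rw [ENNReal.ofReal_mul ((φ i).nonneg_normed v), ENNReal.ofReal_toReal hv.ne]

theorem hasWeakDeriv_weakDeriv {Ω : Set (Rn n)} {α : Fin n → ℕ} {f : Rn n → 𝕜}
    (h : ∃ g, HasWeakDeriv Ω α f g) : HasWeakDeriv Ω α f (weakDeriv Ω α f) := by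
  rw [weakDeriv, dif_pos h]
  exact h.choose_spec

/-- The concentric cube at distance `ε` from the boundary. -/
abbrev innerCube (a : Rn n) (l ε : ℝ) : Set (Rn n) :=
  cube (a + WithLp.toLp 2 fun _ => ε) (l - 2 * ε)

theorem mem_innerCube {a x : Rn n} {l ε : ℝ} :
    x ∈ innerCube a l ε ↔ ∀ i, a i + ε < x i ∧ x i < a i + l - ε := by
  refine forall_congr' fun i => ?_
  simp only [PiLp.add_apply]
  constructor <;> rintro ⟨h1, h2⟩ <;> constructor <;> linarith

theorem exists_isCompact_innerCube (a : Rn n) (l : ℝ) {ε : ℝ} (hε : 0 < ε) :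
    ∃ K, IsCompact K ∧ innerCube a l ε ⊆ K ∧ K ⊆ cube a l := by
  refine ⟨WithLp.toLp 2 '' (univ.pi fun i => Icc (a i + ε) (a i + l - ε)),
    (isCompact_univ_pi fun i => isCompact_Icc).image (PiLp.continuous_toLp 2 _), fun x hx => ?_, ?_⟩
  · refine ⟨WithLp.ofLp x, fun i _ => ?_, rfl⟩
    have := mem_innerCube.1 hx i
    exact ⟨this.1.le, this.2.le⟩
  · rintro _ ⟨x, hx, rfl⟩ i
    have := hx i (mem_univ i)
    simp only
    constructor <;> linarith [this.1, this.2]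

theorem innerCube_mono (a : Rn n) (l : ℝ) {ε ε' : ℝ} (h : ε ≤ ε') :
    innerCube a l ε' ⊆ innerCube a l ε := by
  intro x hx
  rw [mem_innerCube] at *
  intro i
  constructor <;> linarith [(hx i).1, (hx i).2]

theorem closedBall_subset_innerCube {a y : Rn n} {l ε δ : ℝ} (hy : y ∈ innerCube a l (2 * ε))
    (hδ : δ ≤ ε) : Metric.closedBall y δ ⊆ innerCube a l ε := by
  intro x hx
  rw [mem_innerCube] at *
  intro i
  have h : ‖(x - y) i‖ ≤ δ := (PiLp.norm_apply_le (x - y) i).trans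
    (by simpa [dist_eq_norm] using hx)
  rw [PiLp.sub_apply, Real.norm_eq_abs, abs_le] at h
  constructor <;> linarith [(hy i).1, (hy i).2]

/-- The pointwise estimate away from the boundary, by mollification. -/
theorem exists_null_enorm_diff_le_inner {k : ℕ} (hk : 1 ≤ k) (hn : 1 ≤ n) {a : Rn n} {l ε : ℝ}
    (hε : 0 < ε) (hεl : 8 * ε ≤ l) {f : Rn n → 𝕜} (hf : LocallyIntegrableOn f (cube a l) volume)
    (hw : ∀ α : Fin n → ℕ, ∑ i, α i = k → ∃ g, HasWeakDeriv (cube a l) α f g)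
    {g : Rn n → ℝ≥0∞} (hg : Measurable g)
    (hgK : ∀ K ⊆ cube a l, IsCompact K → ∫⁻ x in K, g x ≠ ⊤)
    (hgf : ∀ α : Fin n → ℕ, ∑ i, α i = k →
      ∀ᵐ x ∂volume.restrict (cube a l), ‖weakDeriv (cube a l) α f x‖ₑ ≤ g x)
    {r : ℕ → ℝ} (hr : ∀ m, 0 < r m ∧ r m ≤ n * l) :
    ∃ S : Set (Rn n), volume S = 0 ∧ ∀ x h : Rn n,
      (∀ j ≤ k, x + (j : ℝ) • h ∈ innerCube a l (2 * ε) \ S) → ∀ m, k * ‖h‖ < r m →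
      ‖diff k h f x‖ₑ ≤ taylorConst n k * ENNReal.ofReal (r m) ^ k *
        ∑ j ∈ Finset.range (k + 1), potential k (2 * n * r m) g (x + (j : ℝ) • h) := by
  have hn' : (1 : ℝ) ≤ n := by exact_mod_cast hn
  obtain ⟨K, hKc, hcK, hKQ⟩ := exists_isCompact_innerCube a l hε
  set Ω' := innerCube a l ε with hΩ'
  have hΩ'm : MeasurableSet Ω' := measurableSet_cube _ _
  set f' := Ω'.indicator f with hf'
  have hf'i : Integrable f' volume :=
    (((hf.mono_set hKQ).integrableOn_isCompact hKc).mono_set hcK).integrable_indicator hΩ'm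
  set g' := Ω'.indicator g with hg'
  have hg'm : Measurable g' := hg.indicator hΩ'm
  have hg'g : ∀ x, g' x ≤ g x := fun x => indicator_le_self _ _ x
  have hg'i : ∫⁻ x, g' x ≠ ⊤ := by
    rw [hg', lintegral_indicator hΩ'm]
    exact ne_top_of_le_ne_top (hgK K hKQ hKc) (lintegral_mono_set hcK)
  set φ : ℕ → ContDiffBump (0 : Rn n) := fun i =>
    ⟨1 / ((i : ℝ) + 1), 2 * (1 / ((i : ℝ) + 1)), by positivity, by
      have : (0 : ℝ) < 1 / ((i : ℝ) + 1) := by positivity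
      linarith⟩ with hφ
  have hφ0 : Tendsto (fun i => (φ i).rOut) atTop (𝓝 0) := by
    simpa [hφ] using (tendsto_one_div_add_atTop_nhds_zero_nat (𝕜 := ℝ)).const_mul 2
  have hφ' : ∀ᶠ i in atTop, (φ i).rOut ≤ 2 * (φ i).rIn := Eventually.of_forall fun i => le_rfl
  set p : ℕ → Rn n → ℝ≥0∞ := fun m => potential k (2 * n * r m) g' with hp
  have hΛ : ∀ m, 0 < 2 * n * r m := fun m => by have := (hr m).1; positivity
  have hpm : ∀ m, Measurable (p m) := fun m => measurable_potential hg'm _ _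
  have hpi : ∀ m, ∫⁻ x, p m x ≠ ⊤ := fun m =>
    ne_top_of_le_ne_top hg'i (lintegral_potential_le hg'm k (hΛ m))
  have hae := (ContDiffBump.ae_convolution_tendsto_right_of_locallyIntegrable hφ0 hφ'
    hf'i.locallyIntegrable).and
      (ae_all_iff.2 fun m => tendsto_lintegral_bump_mul (hpm m) (hpi m) hφ0 hφ')
  -- the exceptional set consists of the points at which the mollifications of `f'` or of one of the
  -- countably many potentials do not converge
  refine ⟨_, hae, fun x h hxh m hm => ?_⟩
  have hin : ∀ j ≤ k, x + (j : ℝ) • h ∈ innerCube a l (2 * ε) := fun j hj => (hxh j hj).1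
  have hlim := fun j (hj : j ≤ k) => not_not.1 (hxh j hj).2
  have hdiff : diff k h f x = diff k h f' x := by
    refine Finset.sum_congr rfl fun j hj => ?_
    rw [hf', indicator_of_mem]
    exact innerCube_mono a l (by linarith) (hin j (Nat.lt_succ_iff.1 (Finset.mem_range.1 hj)))
  set G : ℕ → Rn n → ℝ≥0∞ := fun i y =>
    ∫⁻ v, ENNReal.ofReal ((φ i).normed volume v) * g' (y - v) with hG
  have hφm : ∀ i, Measurable fun v => ENNReal.ofReal ((φ i).normed volume v) := fun i =>
    (φ i).continuous_normed.measurable.ennreal_ofReal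
  have hGm : ∀ i, Measurable (G i) := by
    intro i
    have h1 : Measurable fun q : Rn n × Rn n =>
        ENNReal.ofReal ((φ i).normed volume q.2) * g' (q.1 - q.2) :=
      ((hφm i).comp measurable_snd).mul (hg'm.comp (measurable_fst.sub measurable_snd))
    exact h1.lintegral_prod_right'
  have hbound : ∀ᶠ i in atTop, ‖diff k h (mollify ((φ i).normed volume) f') x‖ₑ ≤
      taylorConst n k * ENNReal.ofReal (r m) ^ k * ∑ j ∈ Finset.range (k + 1),
        ∫⁻ v, ENNReal.ofReal ((φ i).normed volume v) * p m (x + (j : ℝ) • h - v) := by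
    filter_upwards [hφ0.eventually_le_const hε] with i hi
    have hs : ContDiff ℝ ∞ ((φ i).normed volume) := (φ i).contDiff_normed
    have hsupp : tsupport ((φ i).normed volume) ⊆ Metric.closedBall 0 ε := by
      rw [ContDiffBump.tsupport_normed_eq]
      exact Metric.closedBall_subset_closedBall hi
    have hjet := isJet_mollify hs (φ i).hasCompactSupport_normed hf'i.locallyIntegrable
    have hGF : ∀ y ∈ innerCube a l (2 * ε), ∀ L : List (Fin n), L.length = k →
        ‖mollify (wordDeriv L ((φ i).normed volume)) f' y‖ₑ ≤ G i y := by
      intro y hy L hL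
      have hsum : ∑ i, L.count i = k := (sum_count_eq_length L).trans hL
      have hwd := hasWeakDeriv_weakDeriv (hw _ hsum)
      have hsubΩ : Ω' ⊆ cube a l := hcK.trans hKQ
      rw [hf', mollify_wordDeriv_indicator_eq (measurableSet_cube a l) hsubΩ hwd hs hsupp
        (closedBall_subset_innerCube hy le_rfl)]
      refine (enorm_integral_le_lintegral_enorm _).trans ?_
      rw [hG]
      simp only
      rw [← lintegral_sub_left_eq_self
        (fun v => ENNReal.ofReal ((φ i).normed volume v) * g' (y - v)) y]
      have hae' := hgf _ hsum
      rw [ae_restrict_iff' (measurableSet_cube a l)] at hae'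
      refine lintegral_mono_ae ?_
      filter_upwards [hae'] with t ht
      rw [enorm_smul, Real.enorm_of_nonneg ((φ i).nonneg_normed _), sub_sub_cancel]
      refine mul_le_mul_right ?_ _
      by_cases htΩ : t ∈ Ω'
      · rw [indicator_of_mem htΩ, hg', indicator_of_mem htΩ]
        exact ht (hsubΩ htΩ)
      · rw [indicator_of_notMem htΩ]
        simp
    have h0 := hin 0 (Nat.zero_le k)
    simp only [Nat.cast_zero, zero_smul, add_zero] at h0
    have := hjet.enorm_diff_le_potential hk hn (hGm i) hGF (by linarith) (hr m).1
      ((hr m).2.trans (by nlinarith)) h0 (hin k le_rfl) hm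
    refine this.trans_eq ?_
    congr 1
    exact Finset.sum_congr rfl fun j _ => potential_lintegral_comm (hφm i) hg'm k _ _
  have hconv : ∀ i, mollify ((φ i).normed volume) f' =
      convolution ((φ i).normed volume) f' (ContinuousLinearMap.lsmul ℝ ℝ) volume := fun i =>
    convolution_flip _
  have hL : Tendsto (fun i => ‖diff k h (mollify ((φ i).normed volume) f') x‖ₑ) atTop
      (𝓝 ‖diff k h f' x‖ₑ) := by
    refine Tendsto.enorm (tendsto_finsetSum _ fun j hj => Tendsto.const_mul _ ?_)
    simp only [hconv]
    exact (hlim j (Nat.lt_succ_iff.1 (Finset.mem_range.1 hj))).1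
  have hR := ENNReal.Tendsto.const_mul (a := taylorConst n k * ENNReal.ofReal (r m) ^ k)
    (tendsto_finsetSum (Finset.range (k + 1)) fun j hj =>
      (hlim j (Nat.lt_succ_iff.1 (Finset.mem_range.1 hj))).2 m)
    (Or.inr (ENNReal.mul_ne_top (taylorConst_ne_top n k)
      (ENNReal.pow_ne_top ENNReal.ofReal_ne_top)))
  rw [hdiff]
  refine (le_of_tendsto_of_tendsto hL hR hbound).trans ?_
  gcongr with j hj
  exact ENNReal.ofReal_toReal_le.trans (potential_mono hg'g k _ _)

/-- The pointwise estimate for functions with weak derivatives: off a null set, differences are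
controlled by the truncated potential of the weak derivatives of order `k`. -/
theorem exists_null_enorm_diff_le {k : ℕ} (hk : 1 ≤ k) (hn : 1 ≤ n) {a : Rn n} {l : ℝ}
    (hl : 0 < l) {f : Rn n → 𝕜} (hf : LocallyIntegrableOn f (cube a l) volume)
    (hw : ∀ α : Fin n → ℕ, ∑ i, α i = k → ∃ g, HasWeakDeriv (cube a l) α f g)
    {g : Rn n → ℝ≥0∞} (hg : Measurable g)
    (hgK : ∀ K ⊆ cube a l, IsCompact K → ∫⁻ x in K, g x ≠ ⊤)
    (hgf : ∀ α : Fin n → ℕ, ∑ i, α i = k →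
      ∀ᵐ x ∂volume.restrict (cube a l), ‖weakDeriv (cube a l) α f x‖ₑ ≤ g x)
    {r : ℕ → ℝ} (hr : ∀ m, 0 < r m ∧ r m ≤ n * l) :
    ∃ S : Set (Rn n), volume S = 0 ∧ ∀ x h : Rn n,
      (∀ j ≤ k, x + (j : ℝ) • h ∈ cube a l \ S) → ∀ m, k * ‖h‖ < r m →
      ‖diff k h f x‖ₑ ≤ taylorConst n k * ENNReal.ofReal (r m) ^ k *
        ∑ j ∈ Finset.range (k + 1), potential k (2 * n * r m) g (x + (j : ℝ) • h) := by
  set ε : ℕ → ℝ := fun N => l / 8 * (1 / ((N : ℝ) + 1)) with hε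
  have hε0 : ∀ N, 0 < ε N := fun N => by positivity
  have hεl : ∀ N, 8 * ε N ≤ l := fun N => by
    have : 1 / ((N : ℝ) + 1) ≤ 1 := by
      rw [div_le_one (by positivity)]
      linarith [N.cast_nonneg (α := ℝ)]
    rw [hε]
    simp only
    nlinarith
  have hεlim : Tendsto (fun N => 2 * ε N) atTop (𝓝 0) := by
    simpa [hε] using
      ((tendsto_one_div_add_atTop_nhds_zero_nat (𝕜 := ℝ)).const_mul (l / 8)).const_mul 2
  choose S hS0 hS using fun N =>
    exists_null_enorm_diff_le_inner hk hn (hε0 N) (hεl N) hf hw hg hgK hgf hr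
  refine ⟨⋃ N, S N, measure_iUnion_null hS0, fun x h hxh m hm => ?_⟩
  have hev : ∀ j ≤ k, ∀ᶠ N in atTop, x + (j : ℝ) • h ∈ innerCube a l (2 * ε N) := by
    intro j hj
    have hmem := (hxh j hj).1
    have : ∀ i, ∀ᶠ N in atTop, a i + 2 * ε N < (x + (j : ℝ) • h) i ∧
        (x + (j : ℝ) • h) i < a i + l - 2 * ε N := by
      intro i
      filter_upwards [hεlim.eventually_lt_const (sub_pos.2 (hmem i).1),
        hεlim.eventually_lt_const (sub_pos.2 (hmem i).2)] with N h1 h2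
      constructor <;> linarith
    filter_upwards [eventually_all.2 this] with N hN
    exact mem_innerCube.2 hN
  have hev' : ∀ᶠ N in atTop, ∀ j ∈ Finset.range (k + 1),
      x + (j : ℝ) • h ∈ innerCube a l (2 * ε N) :=
    (Finset.eventually_all _).2 fun j hj => hev j (Nat.lt_succ_iff.1 (Finset.mem_range.1 hj))
  obtain ⟨N, hN⟩ := hev'.exists
  exact hS N x h (fun j hj => ⟨hN j (Finset.mem_range.2 (Nat.lt_succ_iff.2 hj)),
    fun hmem => (hxh j hj).2 (mem_iUnion.2 ⟨N, hmem⟩)⟩) m hm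

end WeakDerivatives

/-! ### The Gagliardo functional as a sum over dyadic scales -/

/-- The dyadic scales of a cube of edge length `l`. They start at `n l`, which exceeds the distance
of any two points of the cube. -/
noncomputable def scale (n : ℕ) (l : ℝ) (m : ℕ) : ℝ := n * l / 2 ^ m

theorem scale_pos (hn : 1 ≤ n) {l : ℝ} (hl : 0 < l) (m : ℕ) : 0 < scale n l m := by
  have : (0 : ℝ) < n := by exact_mod_cast hn
  rw [scale]
  positivity

theorem scale_le {l : ℝ} (hl : 0 < l) (m : ℕ) : scale n l m ≤ n * l :=
  div_le_self (by positivity) (one_le_pow₀ one_le_two)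

theorem scale_succ (l : ℝ) (m : ℕ) : scale n l (m + 1) = scale n l m / 2 := by
  rw [scale, scale, pow_succ, div_div]

theorem exists_scale {l t : ℝ} (hn : 1 ≤ n) (ht : 0 < t) (htl : t < n * l) :
    ∃ m, scale n l (m + 1) ≤ t ∧ t < scale n l m := by
  have hn' : (0 : ℝ) < n := by exact_mod_cast hn
  have hex : ∃ m, scale n l m ≤ t := by
    obtain ⟨m, hm⟩ := pow_unbounded_of_one_lt (n * l / t) one_lt_two
    refine ⟨m, ?_⟩
    rw [scale, div_le_iff₀ (by positivity)]
    rw [div_lt_iff₀ ht] at hm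
    linarith
  classical
  have h0 : Nat.find hex ≠ 0 := by
    intro h
    have := Nat.find_spec hex
    rw [h, scale, pow_zero, div_one] at this
    linarith
  obtain ⟨m, hm⟩ := Nat.exists_eq_succ_of_ne_zero h0
  refine ⟨m, ?_, ?_⟩
  · have := Nat.find_spec hex
    rwa [hm] at this
  · exact not_le.1 (Nat.find_min hex (by omega))

/-- The increments `h` for which `k |h|` lies between two consecutive scales. -/
def annulus (k : ℕ) (l : ℝ) (m : ℕ) : Set (Rn n) :=
  {h | scale n l (m + 1) ≤ k * ‖h‖ ∧ k * ‖h‖ < scale n l m}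

theorem measurableSet_annulus (k : ℕ) (l : ℝ) (m : ℕ) :
    MeasurableSet (annulus k l m : Set (Rn n)) := by
  have hm : Measurable fun h : Rn n => (k : ℝ) * ‖h‖ := by fun_prop
  exact (measurableSet_le measurable_const hm).inter (measurableSet_lt hm measurable_const)

theorem admissible_subset {k : ℕ} (hk : 1 ≤ k) (hn : 1 ≤ n) {a x : Rn n} {l : ℝ}
    (hx : x ∈ cube a l) :
    admissible (cube a l) x k ⊆ {0} ∪ ⋃ m, admissible (cube a l) x k ∩ annulus k l m := by
  intro h hh
  rcases eq_or_ne h 0 with h0 | h0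
  · exact Or.inl h0
  right
  have hk' : (0 : ℝ) < k := by exact_mod_cast hk
  have hxk : x + (k : ℝ) • h ∈ cube a l := hh k (Finset.mem_Icc.2 ⟨hk, le_rfl⟩)
  have hlt : k * ‖h‖ < n * l := by
    have : Nonempty (Fin n) := ⟨⟨0, hn⟩⟩
    calc k * ‖h‖ ≤ k * ∑ i, |h i| := by gcongr; exact norm_le_sum_abs h
      _ = ∑ i, |k * h i| := by
        rw [Finset.mul_sum]
        exact Finset.sum_congr rfl fun i _ => by rw [abs_mul, Nat.abs_cast]
      _ < ∑ _i : Fin n, l := by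
        refine Finset.sum_lt_sum_of_nonempty Finset.univ_nonempty fun i _ => ?_
        have h1 := hx i
        have h2 := hxk i
        simp only [PiLp.add_apply, PiLp.smul_apply, smul_eq_mul] at h2
        rw [abs_lt]
        constructor <;> linarith [h1.1, h1.2, h2.1, h2.2]
      _ = n * l := by simp
  obtain ⟨m, hm⟩ := exists_scale hn (mul_pos hk' (norm_pos_iff.2 h0)) hlt
  exact mem_iUnion.2 ⟨m, hh, hm⟩

/-- The quantity which controls the contribution of the scale `r` to the Gagliardo functional. The
first summand accounts for the point `x` itself, the second one for the points `x + j h` with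
`1 ≤ j`, over which the potential is integrated. -/
noncomputable def scaleTerm (n k : ℕ) (u q r : ℝ) (g : Rn n → ℝ≥0∞) (x : Rn n) : ℝ≥0∞ :=
  potential k (2 * n * r) g x ^ q +
    ENNReal.ofReal (1 / (k - n * (1 / u - 1 / q))) ^ q *
      (2 ^ n * ballAvg (2 * (2 * n * r)) (fun z => g z ^ u) x) ^ (q / u)

/-- The `L^q` integral over an annulus of the potential at `x + j h`. -/
theorem setLIntegral_annulus_potential_le {k : ℕ} (hk : 1 ≤ k) (hn : 1 ≤ n) {u q : ℝ} (hu : 1 ≤ u)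
    (huq : u ≤ q) (hδ : 0 < k - n * (1 / u - 1 / q)) {l : ℝ} (hl : 0 < l) {g : Rn n → ℝ≥0∞}
    (hg : Measurable g) (x : Rn n) (m j : ℕ) (hj : j ≤ k) :
    ∫⁻ h in annulus k l m, potential k (2 * n * scale n l m) g (x + (j : ℝ) • h) ^ q ≤
      volume (Metric.ball x (2 * n * scale n l m)) * scaleTerm n k u q (scale n l m) g x := by
  have hn' : (1 : ℝ) ≤ n := by exact_mod_cast hn
  have hk' : (1 : ℝ) ≤ k := by exact_mod_cast hk
  have hr := scale_pos hn hl m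
  set r := scale n l m with hrdef
  set Λ := 2 * n * r with hΛdef
  have hΛ : 0 < Λ := by positivity
  have hrΛ : r ≤ Λ := by rw [hΛdef]; nlinarith
  set P := potential k Λ g with hP
  have hPm : Measurable fun y => P y ^ q := (measurable_potential hg k Λ).pow_const q
  have hlt : ∀ h ∈ annulus k l m, k * ‖h‖ < r := fun h hh => hh.2
  rcases Nat.eq_zero_or_pos j with rfl | hj0
  · simp only [Nat.cast_zero, zero_smul, add_zero]
    rw [setLIntegral_const, mul_comm]
    refine mul_le_mul' ?_ le_self_add
    rw [volume_ball_eq x hΛ, ← volume_ball_eq (0 : Rn n) hΛ]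
    refine measure_mono fun h hh => ?_
    rw [Metric.mem_ball, dist_zero_right]
    have := hlt h hh
    nlinarith [norm_nonneg h]
  · have hj0' : (1 : ℝ) ≤ j := by exact_mod_cast hj0
    have hjk : (j : ℝ) ≤ k := by exact_mod_cast hj
    have hB : MeasurableSet (Metric.ball x Λ) := Metric.isOpen_ball.measurableSet
    calc ∫⁻ h in annulus k l m, P (x + (j : ℝ) • h) ^ q
        ≤ ∫⁻ h, (Metric.ball x Λ).indicator (fun y => P y ^ q) (x + (j : ℝ) • h) := by
          rw [← lintegral_indicator (measurableSet_annulus k l m)]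
          refine lintegral_mono fun h => ?_
          by_cases hh : h ∈ annulus k l m
          · rw [indicator_of_mem hh, indicator_of_mem]
            rw [Metric.mem_ball, dist_eq_norm, add_sub_cancel_left, norm_smul,
              Real.norm_of_nonneg (by positivity)]
            have := hlt h hh
            nlinarith [norm_nonneg h]
          · rw [indicator_of_notMem hh]
            exact zero_le
      _ = (ENNReal.ofReal j ^ n)⁻¹ * ∫⁻ y in Metric.ball x Λ, P y ^ q := by
          rw [lintegral_comp_add_smul (hPm.indicator hB) x (by linarith), lintegral_indicator hB]
      _ ≤ ∫⁻ y in Metric.ball x Λ, P y ^ q := by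
          refine mul_le_of_le_one_left' (ENNReal.inv_le_one.2 (one_le_pow₀ ?_))
          simpa using hj0'
      _ ≤ _ := setLIntegral_potential_rpow_le hg hk hu huq hδ hΛ x
      _ ≤ _ := by
          rw [mul_left_comm]
          gcongr
          exact le_add_self

/-- The constant in the estimate of one scale of the Gagliardo functional. -/
noncomputable def gagliardoConst (n k : ℕ) (q : ℝ) : ℝ≥0∞ :=
  ENNReal.ofReal ((2 * k) ^ (n + k * q)) * (taylorConst n k ^ q * (k + 1) ^ q *
    (ENNReal.ofReal (2 * n) ^ n * volume (Metric.ball (0 : Rn n) 1)))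

theorem gagliardoConst_ne_top (n k : ℕ) {q : ℝ} (hq : 0 ≤ q) : gagliardoConst n k q ≠ ⊤ :=
  ENNReal.mul_ne_top ENNReal.ofReal_ne_top <| ENNReal.mul_ne_top (ENNReal.mul_ne_top
    (ENNReal.rpow_ne_top_of_nonneg hq (taylorConst_ne_top n k))
    (ENNReal.rpow_ne_top_of_nonneg hq (by simp))) <|
    ENNReal.mul_ne_top (ENNReal.pow_ne_top ENNReal.ofReal_ne_top) (volume_ball_ne_top _ _)

/-- The contribution of one scale to the Gagliardo functional. -/
theorem setLIntegral_annulus_diff_le {k : ℕ} (hk : 1 ≤ k) (hn : 1 ≤ n) {u q s : ℝ} (hu : 1 ≤ u)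
    (huq : u ≤ q) (hδ : 0 < k - n * (1 / u - 1 / q)) (hs0 : 0 < s) (hs1 : s < 1)
    {a : Rn n} {l : ℝ} (hl : 0 < l)
    {f : Rn n → 𝕜} {g : Rn n → ℝ≥0∞} (hg : Measurable g) {S : Set (Rn n)} (hS0 : volume S = 0)
    (hS : ∀ x h : Rn n, (∀ j ≤ k, x + (j : ℝ) • h ∈ cube a l \ S) → ∀ m, k * ‖h‖ < scale n l m →
      ‖diff k h f x‖ₑ ≤ taylorConst n k * ENNReal.ofReal (scale n l m) ^ k *
        ∑ j ∈ Finset.range (k + 1), potential k (2 * n * scale n l m) g (x + (j : ℝ) • h))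
    {x : Rn n} (hx : x ∈ cube a l \ S) (m : ℕ) :
    ∫⁻ h in admissible (cube a l) x k ∩ annulus k l m,
      ‖diff k h f x‖ₑ ^ q / ‖h‖ₑ ^ ((n : ℝ) + s * (k : ℝ) * q) ≤
      gagliardoConst n k q * (ENNReal.ofReal (scale n l m ^ ((1 - s) * k * q)) *
        scaleTerm n k u q (scale n l m) g x) := by
  have hn' : (1 : ℝ) ≤ n := by exact_mod_cast hn
  have hk' : (1 : ℝ) ≤ k := by exact_mod_cast hk
  have hq : 1 ≤ q := hu.trans huq
  have hq0 : 0 < q := by linarith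
  have hr := scale_pos hn hl m
  have hrs := scale_succ (n := n) l m
  set r := scale n l m with hrdef
  set Λ := 2 * n * r with hΛdef
  have hΛ : 0 < Λ := by positivity
  set P := potential k Λ g with hP
  have hPm : Measurable P := measurable_potential hg k Λ
  set e : ℝ := (n : ℝ) + s * (k : ℝ) * q with he
  have he0 : 0 < e := by positivity
  have hae : ∀ᵐ h : Rn n, ∀ j ∈ Finset.Icc 1 k, x + (j : ℝ) • h ∉ S := by
    refine (ae_ball_iff (Finset.Icc 1 k).countable_toSet).2 fun j hj => ?_
    have hj1 : (0 : ℝ) < j := by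
      have := (Finset.mem_Icc.1 hj).1
      exact_mod_cast this
    have hT := measurableSet_toMeasurable volume S
    have h1 := lintegral_comp_add_smul ((measurable_const (a := (1 : ℝ≥0∞))).indicator hT) x hj1
    rw [lintegral_indicator hT, setLIntegral_const, measure_toMeasurable, hS0, mul_zero, mul_zero,
      lintegral_eq_zero_iff] at h1
    · filter_upwards [h1] with h hh hmem
      rw [indicator_of_mem (subset_toMeasurable _ _ hmem)] at hh
      exact one_ne_zero hh
    · exact ((measurable_const (a := (1 : ℝ≥0∞))).indicator hT).comp (by fun_prop)
  have hadm : MeasurableSet (admissible (cube a l) x k ∩ annulus k l m) := by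
    have : admissible (cube a l) x k =
        ⋂ j ∈ Finset.Icc 1 k, (fun h : Rn n => x + (j : ℝ) • h) ⁻¹' cube a l := by
      ext h; simp [admissible]
    rw [this]
    refine (Finset.measurableSet_biInter _ fun j _ => ?_).inter (measurableSet_annulus k l m)
    exact (measurableSet_cube a l).preimage (by fun_prop)
  set A : ℝ≥0∞ := ENNReal.ofReal ((2 * k / r) ^ e) with hA
  set B : ℝ≥0∞ := (taylorConst n k * ENNReal.ofReal r ^ k) ^ q * (k + 1) ^ (q - 1) with hB
  have hBt : B ≠ ⊤ := ENNReal.mul_ne_top (ENNReal.rpow_ne_top_of_nonneg hq0.le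
    (ENNReal.mul_ne_top (taylorConst_ne_top n k) (ENNReal.pow_ne_top ENNReal.ofReal_ne_top)))
    (ENNReal.rpow_ne_top_of_nonneg (by linarith) (by simp))
  have hpt : ∀ᵐ h : Rn n, h ∈ admissible (cube a l) x k ∩ annulus k l m →
      ‖diff k h f x‖ₑ ^ q / ‖h‖ₑ ^ e ≤
        A * (B * ∑ j ∈ Finset.range (k + 1), P (x + (j : ℝ) • h) ^ q) := by
    filter_upwards [hae] with h hh ⟨hadm, han⟩
    have h1 : ∀ j ≤ k, x + (j : ℝ) • h ∈ cube a l \ S := by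
      intro j hj
      rcases Nat.eq_zero_or_pos j with rfl | hj0
      · simpa using hx
      · exact ⟨hadm j (Finset.mem_Icc.2 ⟨hj0, hj⟩), hh j (Finset.mem_Icc.2 ⟨hj0, hj⟩)⟩
    have h2 := hS x h h1 m han.2
    have h3 : ‖diff k h f x‖ₑ ^ q ≤ B * ∑ j ∈ Finset.range (k + 1), P (x + (j : ℝ) • h) ^ q := by
      refine (ENNReal.rpow_le_rpow h2 hq0.le).trans ?_
      rw [ENNReal.mul_rpow_of_nonneg _ _ hq0.le, hB, mul_assoc (_ ^ q)]
      refine mul_le_mul_right ?_ _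
      have := ENNReal.rpow_sum_le_const_mul_sum_rpow (Finset.range (k + 1))
        (fun j => P (x + (j : ℝ) • h)) hq
      simpa using this
    have h4 : (‖h‖ₑ ^ e)⁻¹ ≤ A := by
      have hnorm : r / (2 * k) ≤ ‖h‖ := by
        have := han.1
        rw [hrs] at this
        rw [div_le_iff₀ (by positivity)]
        linarith
      have hpos : 0 < r / (2 * k) := by positivity
      rw [← ofReal_norm, ENNReal.ofReal_rpow_of_pos (hpos.trans_le hnorm),
        ← ENNReal.ofReal_inv_of_pos (Real.rpow_pos_of_pos (hpos.trans_le hnorm) _)]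
      refine ENNReal.ofReal_le_ofReal ?_
      rw [← Real.inv_rpow (norm_nonneg _)]
      refine Real.rpow_le_rpow (by positivity) ?_ he0.le
      rw [← inv_div r (2 * k)]
      exact inv_anti₀ hpos hnorm
    rw [div_eq_mul_inv, mul_comm]
    exact mul_le_mul' h4 h3
  calc _ ≤ ∫⁻ h in admissible (cube a l) x k ∩ annulus k l m,
        A * (B * ∑ j ∈ Finset.range (k + 1), P (x + (j : ℝ) • h) ^ q) := by
        refine lintegral_mono_ae ?_
        rwa [ae_restrict_iff' hadm]
    _ ≤ ∫⁻ h in annulus k l m, A * (B * ∑ j ∈ Finset.range (k + 1), P (x + (j : ℝ) • h) ^ q) :=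
        lintegral_mono_set inter_subset_right
    _ = A * (B * ∑ j ∈ Finset.range (k + 1),
          ∫⁻ h in annulus k l m, P (x + (j : ℝ) • h) ^ q) := by
        rw [lintegral_const_mul' _ _ ENNReal.ofReal_ne_top, lintegral_const_mul' _ _ hBt,
          lintegral_finsetSum]
        intro j _
        exact (hPm.comp (by fun_prop)).pow_const q
    _ ≤ A * (B * ∑ j ∈ Finset.range (k + 1),
          volume (Metric.ball x Λ) * scaleTerm n k u q r g x) := by
        gcongr with j hj
        exact setLIntegral_annulus_potential_le hk hn hu huq hδ hl hg x m j
          (Nat.lt_succ_iff.1 (Finset.mem_range.1 hj))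
    _ = (A * (ENNReal.ofReal r ^ k) ^ q * ENNReal.ofReal r ^ n) *
          (taylorConst n k ^ q * (k + 1) ^ q *
            (ENNReal.ofReal (2 * n) ^ n * volume (Metric.ball (0 : Rn n) 1))) *
            scaleTerm n k u q r g x := by
        rw [Finset.sum_const, Finset.card_range, nsmul_eq_mul, hB, volume_ball_eq x hΛ, hΛdef,
          ENNReal.ofReal_mul (by positivity), mul_pow, ENNReal.mul_rpow_of_nonneg _ _ hq0.le]
        have : ((k : ℝ≥0∞) + 1) ^ q = (k + 1) ^ (q - 1) * (k + 1) := by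
          conv_lhs => rw [← sub_add_cancel q 1, ENNReal.rpow_add_of_nonneg _ _ (by linarith)
            zero_le_one, ENNReal.rpow_one]
        rw [this]
        push_cast
        ring
    _ ≤ (ENNReal.ofReal ((2 * k) ^ (n + k * q)) * ENNReal.ofReal (r ^ ((1 - s) * k * q))) *
          (taylorConst n k ^ q * (k + 1) ^ q *
            (ENNReal.ofReal (2 * n) ^ n * volume (Metric.ball (0 : Rn n) 1))) *
            scaleTerm n k u q r g x := by
        gcongr ?_ * _ * _
        rw [← ENNReal.ofReal_pow hr.le, ← ENNReal.ofReal_pow hr.le,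
          ENNReal.ofReal_rpow_of_nonneg (by positivity) hq0.le, hA,
          ← ENNReal.ofReal_mul (by positivity), ← ENNReal.ofReal_mul (by positivity),
          ← ENNReal.ofReal_mul (by positivity)]
        refine ENNReal.ofReal_le_ofReal ?_
        have e1 : (2 * k / r) ^ e * (r ^ k) ^ q * r ^ n =
            (2 * k) ^ e * r ^ ((1 - s) * k * q) := by
          rw [Real.div_rpow (by positivity) hr.le, ← Real.rpow_natCast, ← Real.rpow_natCast,
            ← Real.rpow_mul hr.le, div_eq_mul_inv, ← Real.rpow_neg hr.le, mul_assoc, mul_assoc,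
            ← Real.rpow_add hr, ← Real.rpow_add hr]
          congr 2
          rw [he]
          ring
        rw [e1]
        gcongr
        · linarith
        · rw [he]
          have : s * (k * q) ≤ 1 * (k * q) := by gcongr
          linarith
    _ = _ := by
        rw [gagliardoConst]
        ring

/-- The sum over all dyadic scales of the bounds in `setLIntegral_annulus_diff_le`. -/
noncomputable def scaleSum (n k : ℕ) (u q s l : ℝ) (g : Rn n → ℝ≥0∞) (x : Rn n) : ℝ≥0∞ :=
  ∑' m, gagliardoConst n k q * (ENNReal.ofReal (scale n l m ^ ((1 - s) * k * q)) *
    scaleTerm n k u q (scale n l m) g x)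

/-- The Gagliardo functional is controlled by a sum over dyadic scales. -/
theorem gagliardo_rpow_le {k : ℕ} (hk : 1 ≤ k) (hn : 1 ≤ n) {u q s : ℝ} (hu : 1 ≤ u)
    (huq : u ≤ q) (hδ : 0 < k - n * (1 / u - 1 / q)) (hs0 : 0 < s) (hs1 : s < 1)
    {a : Rn n} {l : ℝ} (hl : 0 < l)
    {f : Rn n → 𝕜} {g : Rn n → ℝ≥0∞} (hg : Measurable g) {S : Set (Rn n)} (hS0 : volume S = 0)
    (hS : ∀ x h : Rn n, (∀ j ≤ k, x + (j : ℝ) • h ∈ cube a l \ S) → ∀ m, k * ‖h‖ < scale n l m →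
      ‖diff k h f x‖ₑ ≤ taylorConst n k * ENNReal.ofReal (scale n l m) ^ k *
        ∑ j ∈ Finset.range (k + 1), potential k (2 * n * scale n l m) g (x + (j : ℝ) • h))
    {x : Rn n} (hx : x ∈ cube a l \ S) :
    gagliardo k q s (cube a l) f x ^ q ≤
      scaleSum n k u q s l g x := by
  have hq0 : 0 < q := by linarith
  rw [gagliardo, ← ENNReal.rpow_mul, one_div_mul_cancel hq0.ne', ENNReal.rpow_one]
  have : Nonempty (Fin n) := ⟨⟨0, hn⟩⟩
  have h0 : volume ({0} : Set (Rn n)) = 0 := measure_singleton 0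
  refine (lintegral_mono_set (admissible_subset hk hn hx.1)).trans ?_
  refine (lintegral_union_le _ _ _).trans ?_
  rw [Measure.restrict_eq_zero.2 h0, lintegral_zero_measure, zero_add]
  exact (lintegral_iUnion_le _ _).trans (ENNReal.tsum_le_tsum fun m =>
    setLIntegral_annulus_diff_le hk hn hu huq hδ hs0 hs1 hl hg hS0 hS hx m)

/-! ### Summation over the scales -/

theorem two_rpow_neg_le {s t : ℝ} (hs0 : 0 < s) (hs1 : s < 1) (ht : 1 ≤ t) :
    (2 : ℝ) ^ (-((1 - s) * t)) ≤ 1 - (1 - s) / 2 := by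
  calc (2 : ℝ) ^ (-((1 - s) * t)) ≤ 2 ^ (-(1 - s)) := by
        refine Real.rpow_le_rpow_of_exponent_le one_le_two (neg_le_neg ?_)
        exact le_mul_of_one_le_right (by linarith) ht
    _ = (1 + -(1 / 2)) ^ (1 - s) := by
        rw [Real.rpow_neg zero_le_two, ← Real.inv_rpow zero_le_two]
        norm_num
    _ ≤ 1 + (1 - s) * -(1 / 2) :=
        rpow_one_add_le_one_add_mul_self (by norm_num) (by linarith) (by linarith)
    _ = _ := by ring

/-- The factor `(1 - s)⁻¹` of the main estimate is the sum of a geometric series. -/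
theorem tsum_scale_rpow_le (hn : 1 ≤ n) {s t l : ℝ} (hs0 : 0 < s) (hs1 : s < 1) (ht : 1 ≤ t)
    (hl : 0 < l) :
    ∑' m, ENNReal.ofReal (scale n l m ^ ((1 - s) * t)) ≤
      ENNReal.ofReal (n ^ t * 2) * ENNReal.ofReal (l ^ ((1 - s) * t) * (1 - s)⁻¹) := by
  have hn' : (1 : ℝ) ≤ n := by exact_mod_cast hn
  have hs : 0 < 1 - s := by linarith
  set ρ : ℝ := 2 ^ (-((1 - s) * t)) with hρ
  have hρ0 : 0 < ρ := by positivity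
  have hterm : ∀ m, ENNReal.ofReal (scale n l m ^ ((1 - s) * t)) =
      ENNReal.ofReal ((n * l) ^ ((1 - s) * t)) * ENNReal.ofReal ρ ^ m := by
    intro m
    rw [← ENNReal.ofReal_pow hρ0.le, ← ENNReal.ofReal_mul (by positivity), scale,
      Real.div_rpow (by positivity) (by positivity), hρ, ← Real.rpow_natCast, ← Real.rpow_natCast,
      ← Real.rpow_mul zero_le_two, ← Real.rpow_mul zero_le_two, div_eq_mul_inv,
      ← Real.rpow_neg zero_le_two]
    congr 3
    ring
  simp_rw [hterm]
  rw [ENNReal.tsum_mul_left, ENNReal.tsum_geometric, ← ENNReal.ofReal_one,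
    ← ENNReal.ofReal_sub _ hρ0.le]
  have hle := two_rpow_neg_le hs0 hs1 ht
  rw [← hρ] at hle
  rw [← ENNReal.ofReal_inv_of_pos (by linarith), ← ENNReal.ofReal_mul (by positivity),
    ← ENNReal.ofReal_mul (by positivity)]
  refine ENNReal.ofReal_le_ofReal ?_
  have h1 : (1 - ρ)⁻¹ ≤ 2 * (1 - s)⁻¹ := by
    rw [show 2 * (1 - s)⁻¹ = ((1 - s) / 2)⁻¹ by rw [inv_div]; ring]
    exact inv_anti₀ (by linarith) (by linarith)
  have h2 : ((n : ℝ) * l) ^ ((1 - s) * t) ≤ n ^ t * l ^ ((1 - s) * t) := by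
    rw [Real.mul_rpow (by positivity) hl.le]
    gcongr
    nlinarith
  calc (n * l) ^ ((1 - s) * t) * (1 - ρ)⁻¹
      ≤ (n ^ t * l ^ ((1 - s) * t)) * (2 * (1 - s)⁻¹) := by
        gcongr
        rw [inv_nonneg]
        linarith
    _ = _ := by ring

theorem tsum_rpow_le_tsum {z : ℝ} (hz0 : 0 < z) (hz1 : z ≤ 1) (Y : ℕ → ℝ≥0∞) :
    (∑' m, Y m) ^ z ≤ ∑' m, Y m ^ z := by
  refine le_of_tendsto' ((ENNReal.continuous_rpow_const.tendsto _).comp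
    ENNReal.summable.hasSum.tendsto_sum_nat) fun N => ?_
  refine le_trans ?_ (ENNReal.sum_le_tsum (Finset.range N))
  simp only [Function.comp_apply]
  induction N with
  | zero =>
    simp [ENNReal.zero_rpow_of_pos hz0]
  | succ N ih =>
    rw [Finset.sum_range_succ, Finset.sum_range_succ]
    exact (ENNReal.rpow_add_le_add_rpow _ _ hz0.le hz1).trans (by gcongr)

/-! ### Exponents -/

theorem IsApWeight.criticalIndex_bounds {p : ℝ} {w : Rn n → ℝ} (hw : IsApWeight p w)
    (hp : 1 ≤ p) : 1 ≤ criticalIndex w ∧ criticalIndex w ≤ p :=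
  ⟨le_csInf ⟨p, hp, hw⟩ fun _ h => h.1, csInf_le ⟨1, fun _ h => h.1⟩ ⟨hp, hw⟩⟩

/-- For `1 < p` there is an exponent `r` for which `w` belongs to the Muckenhoupt class and
the subcritical Sobolev embedding from exponent `p / r` into exponent `q` is available. -/
theorem IsApWeight.exists_exponent {p q : ℝ} {k : ℕ} {w : Rn n → ℝ} (hw : IsApWeight p w)
    (hp : 1 < p) (hq : 1 ≤ q) (hn : 1 ≤ n) (hk : 1 ≤ k)
    (h : (n : ℝ) * (criticalIndex w / p - 1 / q) < k) :
    ∃ r₀ r : ℝ, 1 ≤ r₀ ∧ IsApWeight r₀ w ∧ r₀ ≤ r ∧ 1 < r ∧ r ≤ p ∧ p / r ≤ q ∧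
      0 < k - n * (1 / (p / r) - 1 / q) := by
  have hn' : (1 : ℝ) ≤ n := by exact_mod_cast hn
  have hk' : (1 : ℝ) ≤ k := by exact_mod_cast hk
  have hp0 : 0 < p := by linarith
  have hq0 : 0 < q := by linarith
  obtain ⟨hc1, hcp⟩ := hw.criticalIndex_bounds hp.le
  -- the condition on `r` is `r < τ`
  set τ : ℝ := p * (k / n + 1 / q) with hτ
  have hiff : ∀ r : ℝ, n * (r / p - 1 / q) < k ↔ r < τ := by
    intro r
    rw [hτ, ← lt_div_iff₀' (by linarith), sub_lt_iff_lt_add, div_lt_iff₀' hp0]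
  have hcτ := (hiff _).1 h
  rcases lt_or_ge p τ with hpτ | hpτ
  · refine ⟨p, p, hp.le, hw, le_rfl, hp, le_rfl, by rw [div_self hp0.ne']; exact hq, ?_⟩
    rw [one_div_div, sub_pos]
    exact (hiff p).2 hpτ
  · -- `p / q` enters the maximum to ensure `p / r ≤ q`, and `(1 + τ) / 2` to ensure `1 < r`
    obtain ⟨r₀, ⟨h1, hr₀⟩, hlt⟩ := exists_lt_of_csInf_lt
      (s := {r : ℝ | 1 ≤ r ∧ IsApWeight r w}) ⟨p, hp.le, hw⟩ hcτ
    have hpq : p / q < τ := by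
      rw [hτ, mul_add, mul_one_div]
      have : 0 < p * (k / n) := by positivity
      linarith
    have hpqp : p / q ≤ p := div_le_self hp0.le hq
    refine ⟨r₀, max (max r₀ (p / q)) ((1 + τ) / 2), h1, hr₀,
      (le_max_left _ _).trans (le_max_left _ _), ?_, ?_, ?_, ?_⟩
    · exact lt_of_lt_of_le (by linarith) (le_max_right _ _)
    · exact max_le (max_le (by linarith) hpqp) (by linarith)
    · rw [div_le_iff₀ (lt_of_lt_of_le (by positivity)
        ((le_max_right _ _).trans (le_max_left _ _)) : 0 < max (max r₀ (p / q)) ((1 + τ) / 2)),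
        ← div_le_iff₀' hq0]
      exact (le_max_right _ _).trans (le_max_left _ _)
    · rw [one_div_div, sub_pos, hiff]
      exact max_lt (max_lt hlt hpq) (by linarith)

/-! ### Weighted estimates -/

/-- All scales are controlled by the same maximal function. -/
theorem scaleTerm_le_maxFun {k : ℕ} (hn : 1 ≤ n) {u q : ℝ} (hu : 1 ≤ u) (huq : u ≤ q)
    {l : ℝ} (hl : 0 < l) {g : Rn n → ℝ≥0∞} (hg : Measurable g) (x : Rn n) (m : ℕ) :
    scaleTerm n k u q (scale n l m) g x ≤
      (1 + ENNReal.ofReal (1 / (k - n * (1 / u - 1 / q))) ^ q * (2 ^ n) ^ (q / u)) *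
        maxFun volume (2 * (2 * n * (n * l))) (fun z => g z ^ u) x ^ (q / u) := by
  have hn' : (1 : ℝ) ≤ n := by exact_mod_cast hn
  have hu0 : 0 < u := by linarith
  have hq0 : 0 < q := by linarith
  have hr := scale_pos hn hl m
  have hle := scale_le (n := n) hl m
  set M := maxFun volume (2 * (2 * n * (n * l))) (fun z => g z ^ u) x with hM
  have hT : 2 * n * scale n l m ≤ 2 * n * (n * l) := by gcongr
  have hr' : 0 < 2 * n * scale n l m := by positivity
  have h1 : potential k (2 * n * scale n l m) g x ^ q ≤ M ^ (q / u) := by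
    have := ENNReal.rpow_le_rpow (potential_rpow_le_maxFun k hr' hg hu
      (T := 2 * (2 * n * (n * l))) (by linarith) x) (z := q / u) (by positivity)
    rwa [← ENNReal.rpow_mul, mul_div_cancel₀ _ hu0.ne'] at this
  have h2 : ballAvg (2 * (2 * n * scale n l m)) (fun z => g z ^ u) x ≤ M :=
    ballAvg_le_maxFun _ (by linarith) (by linarith) x
  rw [scaleTerm, add_mul, one_mul, mul_assoc (ENNReal.ofReal (1 / (k - n * (1 / u - 1 / q))) ^ q)]
  refine add_le_add h1 (mul_le_mul_right ?_ _)
  rw [ENNReal.mul_rpow_of_nonneg _ _ (by positivity)]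
  exact mul_le_mul_right (ENNReal.rpow_le_rpow h2 (by positivity)) _

/-- Domination of the Gagliardo functional by a maximal function, at the cost of the factor
`(1 - s)⁻¹`. -/
theorem scaleSum_le_maxFun {k : ℕ} (hk : 1 ≤ k) (hn : 1 ≤ n) {u q s : ℝ} (hu : 1 ≤ u)
    (huq : u ≤ q) (hs0 : 0 < s) (hs1 : s < 1) {l : ℝ} (hl : 0 < l)
    {g : Rn n → ℝ≥0∞} (hg : Measurable g) (x : Rn n) :
    scaleSum n k u q s l g x ≤ gagliardoConst n k q * (ENNReal.ofReal (n ^ (k * q) * 2) *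
      (1 + ENNReal.ofReal (1 / (k - n * (1 / u - 1 / q))) ^ q * (2 ^ n) ^ (q / u))) *
      ENNReal.ofReal (l ^ ((1 - s) * (k * q)) * (1 - s)⁻¹) *
        maxFun volume (2 * (2 * n * (n * l))) (fun z => g z ^ u) x ^ (q / u) := by
  have hk' : (1 : ℝ) ≤ k := by exact_mod_cast hk
  have hq1 : 1 ≤ q := hu.trans huq
  set c := (1 + ENNReal.ofReal (1 / (k - n * (1 / u - 1 / q))) ^ q * (2 ^ n) ^ (q / u))
  set M := maxFun volume (2 * (2 * n * (n * l))) (fun z => g z ^ u) x ^ (q / u)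
  calc scaleSum n k u q s l g x ≤ ∑' m, gagliardoConst n k q *
        (ENNReal.ofReal (scale n l m ^ ((1 - s) * (k * q))) * (c * M)) := by
        refine ENNReal.tsum_le_tsum fun m => ?_
        rw [mul_assoc (1 - s)]
        exact mul_le_mul_right (mul_le_mul_right (scaleTerm_le_maxFun hn hu huq hl hg x m) _) _
    _ = gagliardoConst n k q * ((∑' m, ENNReal.ofReal (scale n l m ^ ((1 - s) * (k * q)))) *
          (c * M)) := by
        rw [ENNReal.tsum_mul_left, ENNReal.tsum_mul_right]
    _ ≤ gagliardoConst n k q * ((ENNReal.ofReal (n ^ (k * q) * 2) *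
          ENNReal.ofReal (l ^ ((1 - s) * (k * q)) * (1 - s)⁻¹)) * (c * M)) :=
        mul_le_mul_right (mul_le_mul_left
          (tsum_scale_rpow_le hn hs0 hs1 (one_le_mul_of_one_le_of_one_le hk' hq1) hl) _) _
    _ = _ := by ring

/-- The weighted estimate for `1 < p`, from Muckenhoupt's theorem. -/
theorem exists_lintegral_rpow_le_of_one_lt {k : ℕ} (hk : 1 ≤ k) (hn : 1 ≤ n) {p q r : ℝ}
    (hr : 1 < r) (hrp : r ≤ p) (hprq : p / r ≤ q)
    {V : Rn n → ℝ≥0∞} (hV : Measurable V) (hV0 : ∀ x, V x ≠ 0) (hVt : ∀ x, V x ≠ ⊤)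
    {C₀ : ℝ≥0∞} (hC₀ : C₀ ≠ ⊤) (hB : BallAp r C₀ V) :
    ∃ K : ℝ≥0∞, K ≠ ⊤ ∧ ∀ s : ℝ, 0 < s → s < 1 → ∀ l : ℝ, 0 < l →
      ∀ (Ω : Set (Rn n)) (F g : Rn n → ℝ≥0∞), Measurable g →
      (∀ᵐ x ∂volume.restrict Ω, F x ^ q ≤ scaleSum n k (p / r) q s l g x) →
      (∫⁻ x in Ω, F x ^ p * V x) ^ (1 / p) ≤
        K * ENNReal.ofReal (l ^ ((1 - s) * k) * ((1 - s) ^ (1 / q))⁻¹) *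
          (∫⁻ x, g x ^ p * V x) ^ (1 / p) := by
  have hr0 : 0 < r := by linarith
  have hp0 : 0 < p := by linarith
  set u := p / r with hu
  have hu1 : 1 ≤ u := by rwa [hu, one_le_div hr0]
  have hu0 : 0 < u := by linarith
  have hq0 : 0 < q := by linarith
  obtain ⟨C', hC', hmax⟩ := hB.exists_lintegral_maxFun_le hr hC₀ hV hV0 hVt
  set D : ℝ≥0∞ := gagliardoConst n k q * (ENNReal.ofReal (n ^ (k * q) * 2) *
      (1 + ENNReal.ofReal (1 / (k - n * (1 / u - 1 / q))) ^ q * (2 ^ n) ^ (q / u))) with hD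
  have hDt : D ≠ ⊤ := by
    refine ENNReal.mul_ne_top (gagliardoConst_ne_top n k hq0.le)
      (ENNReal.mul_ne_top ENNReal.ofReal_ne_top (ENNReal.add_ne_top.2 ⟨ENNReal.one_ne_top,
        ENNReal.mul_ne_top (ENNReal.rpow_ne_top_of_nonneg hq0.le ENNReal.ofReal_ne_top)
          (ENNReal.rpow_ne_top_of_nonneg (by positivity) (by simp))⟩))
  refine ⟨D ^ (1 / q) * C' ^ (1 / p), ENNReal.mul_ne_top
    (ENNReal.rpow_ne_top_of_nonneg (by positivity) hDt)
    (ENNReal.rpow_ne_top_of_nonneg (by positivity) hC'), ?_⟩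
  intro s hs0 hs1 l hl Ω F g hg hF
  have hs : 0 < 1 - s := by linarith
  set T : ℝ := 2 * (2 * n * (n * l))
  set M := maxFun volume T (fun z => g z ^ u)
  set L : ℝ≥0∞ := ENNReal.ofReal (l ^ ((1 - s) * k) * ((1 - s) ^ (1 / q))⁻¹) with hL
  have hLt : L ≠ ⊤ := ENNReal.ofReal_ne_top
  have hLq : ENNReal.ofReal (l ^ ((1 - s) * (k * q)) * (1 - s)⁻¹) = L ^ q := by
    rw [hL, ENNReal.ofReal_rpow_of_nonneg (by positivity) hq0.le,
      Real.mul_rpow (by positivity) (by positivity), ← Real.rpow_mul hl.le,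
      Real.inv_rpow (by positivity), ← Real.rpow_mul hs.le, one_div_mul_cancel hq0.ne',
      Real.rpow_one, mul_assoc]
  have hpt : ∀ᵐ x ∂volume.restrict Ω,
      F x ^ p * V x ≤ (D ^ (1 / q) * L) ^ p * (M x ^ r * V x) := by
    filter_upwards [hF] with x hx
    have h1 := hx.trans (scaleSum_le_maxFun hk hn hu1 hprq hs0 hs1 hl hg x)
    rw [hLq] at h1
    have h2 := ENNReal.rpow_le_rpow h1 (z := p / q) (by positivity)
    rw [← ENNReal.rpow_mul, mul_div_cancel₀ _ hq0.ne',
      ENNReal.mul_rpow_of_nonneg _ _ (by positivity),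
      ENNReal.mul_rpow_of_nonneg _ _ (by positivity), ← ENNReal.rpow_mul, ← ENNReal.rpow_mul,
      mul_div_cancel₀ _ hq0.ne'] at h2
    have e1 : q / u * (p / q) = r := by rw [hu]; field_simp
    rw [e1] at h2
    rw [ENNReal.mul_rpow_of_nonneg _ _ hp0.le, ← ENNReal.rpow_mul, one_div_mul_eq_div, ← mul_assoc]
    exact mul_le_mul_left h2 _
  calc (∫⁻ x in Ω, F x ^ p * V x) ^ (1 / p)
      ≤ ((D ^ (1 / q) * L) ^ p * (C' * ∫⁻ x, g x ^ p * V x)) ^ (1 / p) := by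
        refine ENNReal.rpow_le_rpow ?_ (by positivity)
        refine (lintegral_mono_ae hpt).trans ((setLIntegral_le_lintegral _ _).trans ?_)
        rw [lintegral_const_mul' _ _ (ENNReal.rpow_ne_top_of_nonneg hp0.le (ENNReal.mul_ne_top
          (ENNReal.rpow_ne_top_of_nonneg (by positivity) hDt) hLt))]
        refine mul_le_mul_right ((hmax T _ (hg.pow_const u)).trans_eq ?_) _
        simp_rw [← ENNReal.rpow_mul]
        rw [hu, div_mul_cancel₀ _ hr0.ne']
    _ = _ := by
        have hp1 : 0 ≤ 1 / p := by positivity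
        rw [ENNReal.mul_rpow_of_nonneg _ _ hp1, ENNReal.mul_rpow_of_nonneg _ _ hp1,
          ← ENNReal.rpow_mul, mul_one_div_cancel hp0.ne', ENNReal.rpow_one]
        ring

/-- The weighted estimate for `p = 1`: the means of `g` over balls of a fixed radius are bounded
in the weighted space `L¹`, so the scales can be integrated one at a time. This is where the factor
`(1 - s)⁻¹` is not improved by the exponent `1 / q`. -/
theorem exists_lintegral_le_of_eq_one {k : ℕ} (hk : 1 ≤ k) (hn : 1 ≤ n) {q : ℝ}
    (hq : 1 ≤ q) {V : Rn n → ℝ≥0∞} (hV : Measurable V)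
    {C₀ : ℝ≥0∞} (hC₀ : C₀ ≠ ⊤) (hB : ∀ t : ℝ, 0 < t → ∀ᵐ z : Rn n,
      ∫⁻ x in Metric.ball z t, V x ≤ C₀ * volume (Metric.ball z t) * V z) :
    ∃ K : ℝ≥0∞, K ≠ ⊤ ∧ ∀ s : ℝ, 0 < s → s < 1 → ∀ l : ℝ, 0 < l →
      ∀ (Ω : Set (Rn n)) (F g : Rn n → ℝ≥0∞), Measurable g →
      (∀ᵐ x ∂volume.restrict Ω, F x ^ q ≤ scaleSum n k 1 q s l g x) →
      ∫⁻ x in Ω, F x * V x ≤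
        K * ENNReal.ofReal (l ^ ((1 - s) * k) * (1 - s)⁻¹) * ∫⁻ x, g x * V x := by
  have hq0 : 0 < q := by linarith
  have hk' : (1 : ℝ) ≤ k := by exact_mod_cast hk
  have hn' : (1 : ℝ) ≤ n := by exact_mod_cast hn
  set G : ℝ≥0∞ := gagliardoConst n k q ^ (1 / q) with hG
  have hGt : G ≠ ⊤ := ENNReal.rpow_ne_top_of_nonneg (by positivity)
    (gagliardoConst_ne_top n k hq0.le)
  set E : ℝ≥0∞ := ENNReal.ofReal (1 / (k - n * (1 / 1 - 1 / q))) * 2 ^ n with hE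
  have hEt : E ≠ ⊤ := ENNReal.mul_ne_top ENNReal.ofReal_ne_top (by simp)
  refine ⟨G * (ENNReal.ofReal (n ^ (k : ℝ) * 2) * (C₀ + E * C₀)), ENNReal.mul_ne_top hGt
    (ENNReal.mul_ne_top ENNReal.ofReal_ne_top (ENNReal.add_ne_top.2 ⟨hC₀,
      ENNReal.mul_ne_top hEt hC₀⟩)), ?_⟩
  intro s hs0 hs1 l hl Ω F g hg hF
  have hs : 0 < 1 - s := by linarith
  set I := ∫⁻ x, g x * V x with hI
  set A : ℕ → ℝ≥0∞ := fun m => ENNReal.ofReal (scale n l m ^ ((1 - s) * k)) with hA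
  set P : ℕ → Rn n → ℝ≥0∞ := fun m => potential k (2 * n * scale n l m) g with hP
  set B : ℕ → Rn n → ℝ≥0∞ := fun m => ballAvg (2 * (2 * n * scale n l m)) g with hBdef
  have hr : ∀ m, 0 < 2 * n * scale n l m := fun m => by
    have := scale_pos hn hl m
    positivity
  have hPm : ∀ m, Measurable (P m) := fun m => measurable_potential hg k _
  have hBm : ∀ m, Measurable (B m) := fun m => measurable_ballAvg_right hg _
  have hpt : ∀ᵐ x ∂volume.restrict Ω,
      F x * V x ≤ G * ∑' m, A m * (P m x * V x + E * (B m x * V x)) := by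
    filter_upwards [hF] with x hx
    have h1 := ENNReal.rpow_le_rpow hx (z := 1 / q) (by positivity)
    rw [← ENNReal.rpow_mul, mul_one_div_cancel hq0.ne', ENNReal.rpow_one] at h1
    have h2 : F x ≤ G * ∑' m, A m * (P m x + E * B m x) := by
      refine h1.trans ?_
      rw [scaleSum, ENNReal.tsum_mul_left, ENNReal.mul_rpow_of_nonneg _ _ (by positivity)]
      refine mul_le_mul_right ((tsum_rpow_le_tsum (by positivity)
        ((div_le_one hq0).2 hq) _).trans (ENNReal.tsum_le_tsum fun m => ?_)) _
      have hsc := scale_pos hn hl m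
      rw [ENNReal.mul_rpow_of_nonneg _ _ (by positivity),
        ENNReal.ofReal_rpow_of_pos (by positivity), ← Real.rpow_mul hsc.le, mul_assoc ((1 - s) * k),
        mul_one_div_cancel hq0.ne', mul_one]
      refine mul_le_mul_right ?_ _
      refine (ENNReal.rpow_add_le_add_rpow _ _ (by positivity) ((div_le_one hq0).2 hq)).trans ?_
      simp only [ENNReal.rpow_one, div_one (q : ℝ)]
      rw [← ENNReal.mul_rpow_of_nonneg _ _ hq0.le, ← ENNReal.rpow_mul, ← ENNReal.rpow_mul,
        mul_one_div_cancel hq0.ne', ENNReal.rpow_one, ENNReal.rpow_one, hE, ← mul_assoc]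
    refine (mul_le_mul_left h2 _).trans_eq ?_
    rw [mul_assoc, ← ENNReal.tsum_mul_right]
    refine congrArg (G * ·) (tsum_congr fun m => ?_)
    ring
  have hint : ∀ m, ∫⁻ x, A m * (P m x * V x + E * (B m x * V x)) ≤ A m * ((C₀ + E * C₀) * I) := by
    intro m
    have hPV : Measurable fun x => P m x * V x := (hPm m).mul hV
    rw [lintegral_const_mul' _ _ ENNReal.ofReal_ne_top, lintegral_add_left hPV,
      lintegral_const_mul' _ _ hEt, add_mul, mul_assoc E]
    refine mul_le_mul_right (add_le_add ?_ (mul_le_mul_right ?_ _)) _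
    · exact lintegral_potential_mul_le hg hV hB k (hr m)
    · have := hr m
      exact lintegral_ballAvg_mul_le hg hV (by positivity) (hB _ (by positivity))
  calc ∫⁻ x in Ω, F x * V x
      ≤ ∫⁻ x, G * ∑' m, A m * (P m x * V x + E * (B m x * V x)) :=
        (lintegral_mono_ae hpt).trans (setLIntegral_le_lintegral _ _)
    _ = G * ∑' m, ∫⁻ x, A m * (P m x * V x + E * (B m x * V x)) := by
        rw [lintegral_const_mul' _ _ hGt, lintegral_tsum]
        intro m
        have h1 := (hPm m).mul hV
        have h2 := (hBm m).mul hV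
        exact ((h1.add (h2.const_mul E)).const_mul (A m)).aemeasurable
    _ ≤ G * ∑' m, A m * ((C₀ + E * C₀) * I) :=
        mul_le_mul_right (ENNReal.tsum_le_tsum hint) _
    _ = G * ((∑' m, A m) * ((C₀ + E * C₀) * I)) := by rw [ENNReal.tsum_mul_right]
    _ ≤ G * ((ENNReal.ofReal (n ^ (k : ℝ) * 2) *
          ENNReal.ofReal (l ^ ((1 - s) * k) * (1 - s)⁻¹)) * ((C₀ + E * C₀) * I)) :=
        mul_le_mul_right (mul_le_mul_left (tsum_scale_rpow_le hn hs0 hs1 hk' hl) _) _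
    _ = _ := by ring

/-- The weighted estimate for all `p`, with an exponent `u` for which the Gagliardo functional is
controlled by `scaleSum`. -/
theorem IsApWeight.exists_wNorm_le {p q : ℝ} {k : ℕ} (hn : 1 ≤ n) (hk : 1 ≤ k) {w : Rn n → ℝ}
    (hw : IsApWeight p w) (hp : 1 ≤ p) (hq : 1 ≤ q)
    (hpq : (n : ℝ) * (criticalIndex w / p - 1 / q) < k)
    {V : Rn n → ℝ≥0∞} (hV : Measurable V) (hV0 : ∀ x, V x ≠ 0) (hVt : ∀ x, V x ≠ ⊤)
    (hVw : V =ᵐ[volume] fun x => ENNReal.ofReal (w x)) :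
    ∃ u : ℝ, 1 ≤ u ∧ u ≤ q ∧ 0 < k - n * (1 / u - 1 / q) ∧
    ∃ K : ℝ≥0∞, K ≠ ⊤ ∧ ∀ s : ℝ, 0 < s → s < 1 → ∀ l : ℝ, 0 < l →
      ∀ (Ω : Set (Rn n)) (F g : Rn n → ℝ≥0∞), Measurable g →
      (∀ᵐ x ∂volume.restrict Ω, F x ^ q ≤ scaleSum n k u q s l g x) →
      (∫⁻ x in Ω, F x ^ p * V x) ^ (1 / p) ≤
        K * ENNReal.ofReal (l ^ ((1 - s) * k) * ((1 - s) ^ gammaExp p q)⁻¹) *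
          (∫⁻ x, g x ^ p * V x) ^ (1 / p) := by
  rcases hp.eq_or_lt with rfl | hp1
  · obtain ⟨C₀, hC₀, hB⟩ := hw.exists_ball_le hV0 hVt hVw
    refine ⟨1, le_rfl, hq, ?_, ?_⟩
    · have h1 := (hw.criticalIndex_bounds le_rfl).1
      have : (n : ℝ) * (1 / 1 - 1 / q) ≤ n * (criticalIndex w / 1 - 1 / q) := by gcongr
      linarith
    · obtain ⟨K, hK, h⟩ := exists_lintegral_le_of_eq_one hk hn hq hV hC₀ hB
      refine ⟨K, hK, fun s hs0 hs1 l hl Ω F g hg hF => ?_⟩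
      simpa [gammaExp] using h s hs0 hs1 l hl Ω F g hg hF
  · obtain ⟨r₀, r, h1, hr₀, hrr, hr, hrp, hprq, hδ⟩ := hw.exists_exponent hp1 hq hn hk hpq
    obtain ⟨C₀, hC₀, hB⟩ := hr₀.exists_ballAp h1 hrr hr hVw
    refine ⟨p / r, (one_le_div (by linarith)).2 hrp, hprq, hδ, ?_⟩
    simpa only [gammaExp, if_neg hp1.ne'] using
      exists_lintegral_rpow_le_of_one_lt hk hn hr hrp hprq hV hV0 hVt hC₀ hB

/-! ### The measurable majorant of the derivatives -/

/-- The sum of the norms of the derivatives of order `k` has a measurable representative. It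
vanishes off the cube so that operators on the whole space can be applied to it. -/
theorem MemHomSobolev.exists_majorant {k : ℕ} {p : ℝ} {w : Rn n → ℝ} {a : Rn n} {l : ℝ}
    {f : Rn n → 𝕜} (hf : MemHomSobolev k p w (cube a l) f) :
    ∃ g : Rn n → ℝ≥0∞, Measurable g ∧ (∀ x ∉ cube a l, g x = 0) ∧
      (∀ K ⊆ cube a l, IsCompact K → ∫⁻ x in K, g x ≠ ⊤) ∧
      (∀ α : Fin n → ℕ, ∑ i, α i = k →
        ∀ᵐ x ∂volume.restrict (cube a l), ‖weakDeriv (cube a l) α f x‖ₑ ≤ g x) ∧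
      ∀ᵐ x ∂volume.restrict (cube a l),
        g x ≤ ((Finset.univ : Finset (Fin n)).piAntidiag k).card *
          ENNReal.ofReal (gradNorm k (cube a l) f x) := by
  classical
  set Q := cube a l with hQ
  have hQm : MeasurableSet Q := measurableSet_cube a l
  set A := (Finset.univ : Finset (Fin n)).piAntidiag k with hA
  have hmem : ∀ α : Fin n → ℕ, α ∈ A ↔ ∑ i, α i = k := fun α => by simp [hA]
  set F : Rn n → ℝ≥0∞ := fun x => ∑ α ∈ A, ‖weakDeriv Q α f x‖ₑ with hF
  have hFm : AEMeasurable F (volume.restrict Q) :=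
    Finset.aemeasurable_fun_sum _ fun α hα =>
      (hf.memWLp_weakDeriv α ((hmem α).1 hα)).1.enorm
  refine ⟨Q.indicator (hFm.mk F), hFm.measurable_mk.indicator hQm,
    fun x hx => indicator_of_notMem hx _, fun K hK hKc => ?_, fun α hα => ?_, ?_⟩
  · have hKF : ∫⁻ x in K, Q.indicator (hFm.mk F) x = ∫⁻ x in K, F x := by
      refine lintegral_congr_ae ?_
      filter_upwards [ae_restrict_of_ae_restrict_of_subset hK hFm.ae_eq_mk,
        ae_restrict_mem hKc.measurableSet] with x hx hxK
      rw [indicator_of_mem (hK hxK), hx]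
    rw [hKF, lintegral_finsetSum' _ fun α hα => ((hf.memWLp_weakDeriv α
      ((hmem α).1 hα)).1.mono_measure (Measure.restrict_mono hK le_rfl)).enorm]
    refine (ENNReal.sum_lt_top.2 fun α hα => ?_).ne
    have h := (hasWeakDeriv_weakDeriv
      (hf.exists_weakDeriv α ((hmem α).1 hα))).locallyIntegrableOn_right
    exact (h.integrableOn_compact_subset hK hKc).2
  · filter_upwards [hFm.ae_eq_mk, ae_restrict_mem hQm] with x hx hxQ
    rw [indicator_of_mem hxQ, ← hx]
    exact Finset.single_le_sum (f := fun α => ‖weakDeriv Q α f x‖ₑ) (fun _ _ => zero_le)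
      ((hmem α).2 hα)
  · filter_upwards [hFm.ae_eq_mk, ae_restrict_mem hQm] with x hx hxQ
    rw [indicator_of_mem hxQ, ← hx, ← nsmul_eq_mul]
    refine Finset.sum_le_card_nsmul _ _ _ fun α hα => ?_
    rw [← ofReal_norm]
    refine ENNReal.ofReal_le_ofReal (Real.le_sqrt_of_sq_le ?_)
    exact Finset.single_le_sum (f := fun α => ‖weakDeriv Q α f x‖ ^ 2)
      (fun _ _ => by positivity) hα

end GagliardoCube

open GagliardoCube in
theorem theorem1p4 {𝕜 : Type*} [RCLike 𝕜] (n k : ℕ) (hn : 1 ≤ n) (hk : 1 ≤ k)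
    (p q : ℝ) (hp : 1 ≤ p) (hq : 1 ≤ q)
    (w : Rn n → ℝ) (hw : IsApWeight p w)
    (hpq : (n : ℝ) * (criticalIndex w / p - 1 / q) < (k : ℝ)) :
    ∃ C : ℝ, 0 < C ∧
      ∀ (s : ℝ), 0 < s → s < 1 →
      ∀ (a : Rn n) (l : ℝ), 0 < l →
      ∀ f : Rn n → 𝕜, MemHomSobolev k p w (cube a l) f →
        ENNReal.ofReal ((1 - s) ^ gammaExp p q) *
            wNorm p w (cube a l) (fun x => gagliardo k q s (cube a l) f x) ≤
          ENNReal.ofReal (C * l ^ ((1 - s) * (k : ℝ))) *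
            wNorm p w (cube a l) (fun x => ENNReal.ofReal (gradNorm k (cube a l) f x)) := by
  have hp0 : 0 < p := by linarith
  rcases hw.ae_eq_zero_or_exists hp with h0 | ⟨V, hV, hV0, hVt, hVw⟩
  · -- A weight which vanishes almost everywhere makes both sides zero.
    refine ⟨1, one_pos, fun s _ _ a l _ f _ => ?_⟩
    have hz : wNorm p w (cube a l) (fun x => gagliardo k q s (cube a l) f x) = 0 := by
      rw [wNorm, lintegral_congr_ae (g := fun _ => 0), lintegral_zero,
        ENNReal.zero_rpow_of_pos (by positivity)]
      filter_upwards [ae_restrict_of_ae h0] with x hx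
      rw [hx, mul_zero]
    rw [hz, mul_zero]
    exact zero_le
  obtain ⟨u, hu, huq, hδ, K, hK, hest⟩ :=
    hw.exists_wNorm_le hn hk hp hq hpq hV hV0 hVt hVw
  have hwV : ∀ (Ω : Set (Rn n)) (F : Rn n → ℝ≥0∞),
      wNorm p w Ω F = (∫⁻ x in Ω, F x ^ p * V x) ^ (1 / p) := by
    intro Ω F
    rw [wNorm]
    congr 1
    refine lintegral_congr_ae ?_
    filter_upwards [ae_restrict_of_ae hVw] with x hx
    rw [hx]
  set N : ℝ≥0∞ := (((Finset.univ : Finset (Fin n)).piAntidiag k).card : ℝ≥0∞) with hN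
  have hNt : N ≠ ⊤ := ENNReal.natCast_ne_top _
  have hKN : K * N ≠ ⊤ := ENNReal.mul_ne_top hK hNt
  refine ⟨(K * N).toReal + 1, by positivity, fun s hs0 hs1 a l hl f hf => ?_⟩
  have hs : 0 < 1 - s := by linarith
  obtain ⟨g, hg, hgQ, hgK, hgf, hgN⟩ := hf.exists_majorant
  obtain ⟨S, hS0, hS⟩ := exists_null_enorm_diff_le hk hn hl hf.locallyIntegrableOn
    hf.exists_weakDeriv hg hgK hgf (r := scale n l) fun m => ⟨scale_pos hn hl m, scale_le hl m⟩
  have hgag : ∀ᵐ x ∂volume.restrict (cube a l),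
      gagliardo k q s (cube a l) f x ^ q ≤ scaleSum n k u q s l g x := by
    filter_upwards [ae_restrict_mem (measurableSet_cube a l),
      ae_restrict_of_ae (measure_eq_zero_iff_ae_notMem.1 hS0)] with x hx hxS
    exact gagliardo_rpow_le hk hn hu huq hδ hs0 hs1 hl hg hS0 hS ⟨hx, hxS⟩
  have hgrad : (∫⁻ x, g x ^ p * V x) ^ (1 / p) ≤
      N * wNorm p w (cube a l) (fun x => ENNReal.ofReal (gradNorm k (cube a l) f x)) := by
    have hp1 : 0 ≤ 1 / p := by positivity
    have hQ : ∫⁻ x, g x ^ p * V x = ∫⁻ x in cube a l, g x ^ p * V x := by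
      rw [← lintegral_indicator (measurableSet_cube a l)]
      refine lintegral_congr fun x => ?_
      by_cases hx : x ∈ cube a l
      · rw [indicator_of_mem hx]
      · rw [indicator_of_notMem hx, hgQ x hx, ENNReal.zero_rpow_of_pos hp0, zero_mul]
    have hNp : N = (N ^ p) ^ (1 / p) := by
      rw [← ENNReal.rpow_mul, mul_one_div_cancel hp0.ne', ENNReal.rpow_one]
    rw [hQ, hwV, hNp, ← ENNReal.mul_rpow_of_nonneg _ _ hp1,
      ← lintegral_const_mul' _ _ (ENNReal.rpow_ne_top_of_nonneg hp0.le hNt)]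
    refine ENNReal.rpow_le_rpow (lintegral_mono_ae ?_) hp1
    filter_upwards [hgN] with x hx
    rw [← mul_assoc, ← ENNReal.mul_rpow_of_nonneg _ _ hp0.le]
    exact mul_le_mul_left (ENNReal.rpow_le_rpow hx hp0.le) _
  have hmain := hest s hs0 hs1 l hl (cube a l) _ g hg hgag
  rw [← hwV] at hmain
  set W := wNorm p w (cube a l) (fun x => ENNReal.ofReal (gradNorm k (cube a l) f x))
  have hγ : 0 < (1 - s) ^ gammaExp p q := by positivity
  calc _ ≤ ENNReal.ofReal ((1 - s) ^ gammaExp p q) *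
        (K * ENNReal.ofReal (l ^ ((1 - s) * k) * ((1 - s) ^ gammaExp p q)⁻¹) * (N * W)) :=
        mul_le_mul_right (hmain.trans (mul_le_mul_right hgrad _)) _
    _ = K * N * (ENNReal.ofReal ((1 - s) ^ gammaExp p q) *
          ENNReal.ofReal (l ^ ((1 - s) * k) * ((1 - s) ^ gammaExp p q)⁻¹)) * W := by ring
    _ = K * N * ENNReal.ofReal (l ^ ((1 - s) * k)) * W := by
        rw [← ENNReal.ofReal_mul hγ.le, mul_left_comm, mul_inv_cancel₀ hγ.ne', mul_one]
    _ ≤ ENNReal.ofReal ((K * N).toReal + 1) * ENNReal.ofReal (l ^ ((1 - s) * k)) * W := by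
        refine mul_le_mul_left (mul_le_mul_left ?_ _) _
        rw [ENNReal.le_ofReal_iff_toReal_le hKN (by positivity)]
        linarith
    _ = _ := by rw [← ENNReal.ofReal_mul (by positivity)]
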